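/- Let $d\ge 1$ and let $\widehat u(\xi)=\int_{\mathbb R^d}u(x)e^{-2\pi i x\cdot\xi}\,dx$. Fix $\psi\in\mathcal S(\mathbb R^d)$ with $\operatorname{supp}\psi\subset[-1,1]^d$ and $\sum_{n\in\mathbb Z^d}\psi(\xi-n)=1$ for all $\xi$, and let $\psi(D-n)$ be the Fourier multiplier with symbol $\psi(\xi-n)$. Let $S(t)=e^{it\Delta}$. Let $(q,r)$ be Schrödinger admissible, i.e. $2\le q,r\le\infty$, $\frac2q+\frac dr=\frac d2$, $(q,r,d)\ne(2,\infty,2)$, with $q,r<\infty$, and let $r\le\widetilde r<\infty$. Let $c_0>0$. Then there are constants $C,c,K>0$, depending only on $d,\psi,q,r,\widetilde r,c_0$, such that the following holds. Let $\{g_n\}_{n\in\mathbb Z^d}$ be independent mean-zero complex random variables on a probability space $(\Omega,\mathcal F,P)$, such that for each $n$ the real and imaginary parts of $g_n$ are independent and their laws $\mu_n^{(1)},\mu_n^{(2)}$ satisfy $\int_{\mathbb R}e^{\gamma x}\,d\mu_n^{(j)}(x)\le e^{c_0\gamma^2}$ for all $\gamma\in\mathbb R$ and $j=1,2$. Let $\varphi\in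 L^2(\mathbb R^d)$. Then the series $$\varphi^\omega=\sum_{n\in\mathbb Z^d}g_n(\omega)\,\psi(D-n)\varphi$$ converges unconditionally in $L^2(\mathbb R^d)$ for almost every $\omega$, and $$P\Big(\|S(t)\varphi^\omega\|_{L^q_tL^{\widetilde r}_x(\mathbb R\times\mathbb R^d)}>\lambda\Big)\le C\exp\big(-c\,\lambda^2\|\varphi\|_{L^2}^{-2}\big)\qquad\text{for all }\lambda>0$$ (the right-hand side being read as $C$ if $\varphi=0$). In particular, for every $0<\varepsilon\le\frac12$, $$\|S(t)\varphi^\omega\|_{L^q_tL^{\widetilde r}_x(\mathbb R\times\mathbb R^d)}\le K\Big(\log\frac1\varepsilon\Big)^{1/2}\|\varphi\|_{L^2}$$ for all $\omega$ outside a set of probability at most $\varepsilon$. -/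

import Mathlib

open MeasureTheory ProbabilityTheory
open scoped ENNReal FourierTransform SchwartzMap

noncomputable section

namespace WienerRandomization

/-- The physical (and frequency) space `ℝ^d` with its Euclidean structure. -/
abbrev Space (d : ℕ) : Type := EuclideanSpace ℝ (Fin d)

/-- The complex Hilbert space `L²(ℝ^d)`. -/
abbrev L2 (d : ℕ) : Type := Lp ℂ 2 (volume : Measure (Space d))

/-- The point of `ℝ^d` with integer coordinates `n`. -/
def latticePoint {d : ℕ} (n : Fin d → ℤ) : Space d :=
  WithLp.toLp 2 (fun i => (n i : ℝ))

/-- The Fourier multiplier `m(D) f = 𝓕⁻¹ (m · 𝓕 f)` on `L²(ℝ^d)` with an essentially bounded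
symbol `m`.  The Fourier transform is `𝓕 f (ξ) = ∫ f(x) exp(-2πi x·ξ) dx`, extended to `L²`. -/
def fourierMultiplier {d : ℕ} (m : Space d → ℂ) (hm : MemLp m ∞ volume) (f : L2 d) : L2 d :=
  𝓕⁻ (((Lp.memLp (𝓕 f : L2 d)).smul (r := 2) hm).toLp (m • ⇑(𝓕 f : L2 d)) : L2 d)

/-- A window for the Wiener decomposition: a Schwartz function supported in `[-1,1]^d` whose integer
translates sum to one. -/
structure IsWienerWindow {d : ℕ} (ψ : 𝓢(Space d, ℂ)) : Prop where
  support_subset : tsupport ψ ⊆ {ξ | ∀ i, ξ i ∈ Set.Icc (-1 : ℝ) 1}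
  hasSum_one : ∀ ξ : Space d, HasSum (fun n : Fin d → ℤ => ψ (ξ - latticePoint n)) 1

theorem memLp_window {d : ℕ} (ψ : 𝓢(Space d, ℂ)) (n : Fin d → ℤ) :
    MemLp (fun ξ : Space d => ψ (ξ - latticePoint n)) ∞ volume :=
  (ψ.memLp_top volume).comp_measurePreserving (measurePreserving_sub_right volume _)

/-- The frequency-uniform projection `ψ(D - n)`. -/
def windowProj {d : ℕ} (ψ : 𝓢(Space d, ℂ)) (n : Fin d → ℤ) (f : L2 d) : L2 d :=
  fourierMultiplier (fun ξ => ψ (ξ - latticePoint n)) (memLp_window ψ n) f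

/-- The symbol of `exp(i t Δ)`; the symbol of `Δ` is `-4π²|ξ|²`. -/
def schrodingerSymbol {d : ℕ} (t : ℝ) (ξ : Space d) : ℂ :=
  Complex.exp (Complex.I * t * (-(4 * (Real.pi : ℂ) ^ 2 * (‖ξ‖ : ℂ) ^ 2)))

theorem memLp_schrodingerSymbol {d : ℕ} (t : ℝ) :
    MemLp (schrodingerSymbol (d := d) t) ∞ volume := by
  refine memLp_top_of_bound (Continuous.aestronglyMeasurable ?_) 1 (ae_of_all _ fun ξ => ?_)
  · unfold schrodingerSymbol
    fun_prop
  · have h : Complex.I * t * (-(4 * (Real.pi : ℂ) ^ 2 * (‖ξ‖ : ℂ) ^ 2))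
        = ((-(t * (4 * Real.pi ^ 2 * ‖ξ‖ ^ 2)) : ℝ) : ℂ) * Complex.I := by
      push_cast
      ring
    rw [schrodingerSymbol, h, Complex.norm_exp_ofReal_mul_I]

/-- The free Schrödinger group `S(t) = exp(i t Δ)` on `L²(ℝ^d)`. -/
def schrodinger {d : ℕ} (t : ℝ) (f : L2 d) : L2 d :=
  fourierMultiplier (schrodingerSymbol t) (memLp_schrodingerSymbol t) f

/-- The space-time norm `‖S(t) f‖_{L^q_t L^r_x(ℝ × ℝ^d)}`, with values in `[0, ∞]`. -/
def strichartzNorm {d : ℕ} (q r : ℝ≥0∞) (f : L2 d) : ℝ≥0∞ :=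
  eLpNorm (fun t : ℝ => eLpNorm (schrodinger t f) r (volume : Measure (Space d))) q volume

/-- Schrödinger admissible pairs of exponents in dimension `d` (with `1/∞ = 0`). -/
def SchrodingerAdmissible (d : ℕ) (q r : ℝ≥0∞) : Prop :=
  2 ≤ q ∧ 2 ≤ r ∧ 2 / q + (d : ℝ≥0∞) / r = (d : ℝ≥0∞) / 2 ∧ ¬(q = 2 ∧ r = ∞ ∧ d = 2)

/-- The exponential moment bound `∫ exp(γ x) dμ(x) ≤ exp(c γ²)` for all real `γ`. -/
def ExpMomentBound (μ : Measure ℝ) (c : ℝ) : Prop :=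
  ∀ γ : ℝ, Integrable (fun x => Real.exp (γ * x)) μ ∧
    |∫ x, Real.exp (γ * x) ∂μ| ≤ Real.exp (c * γ ^ 2)

/-- Independent complex random variables `g n` of mean zero, each with independent real and
imaginary parts, whose laws all satisfy the exponential moment bound with the constant `c`. -/
structure IsRandomizer {d : ℕ} {Ω : Type*} [MeasurableSpace Ω] (P : Measure Ω)
    (g : (Fin d → ℤ) → Ω → ℂ) (c : ℝ) : Prop where
  measurable : ∀ n, Measurable (g n)
  indep : iIndepFun g P
  indep_re_im : ∀ n, IndepFun (fun ω => (g n ω).re) (fun ω => (g n ω).im) P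
  mean_zero : ∀ n, Integrable (g n) P ∧ ∫ ω, g n ω ∂P = 0
  bound_re : ∀ n, ExpMomentBound (P.map fun ω => (g n ω).re) c
  bound_im : ∀ n, ExpMomentBound (P.map fun ω => (g n ω).im) c

/-- The `n`-th term `g_n(ω) ψ(D - n) φ` of the Wiener randomization. -/
def randomTerm {d : ℕ} {Ω : Type*} (ψ : 𝓢(Space d, ℂ)) (g : (Fin d → ℤ) → Ω → ℂ) (φ : L2 d)
    (ω : Ω) (n : Fin d → ℤ) : L2 d :=
  g n ω • windowProj ψ n φ

/-- The Wiener randomization `φ^ω = ∑ₙ g_n(ω) ψ(D - n) φ`, an unconditional sum in `L²(ℝ^d)`. -/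
def randomization {d : ℕ} {Ω : Type*} (ψ : 𝓢(Space d, ℂ)) (g : (Fin d → ℤ) → Ω → ℂ) (φ : L2 d)
    (ω : Ω) : L2 d :=
  ∑' n, randomTerm ψ g φ ω n

end WienerRandomization

end

/-!
Write `u_n = S(t) ψ(D - n) φ`, so that `S(t) φ^ω = ∑ g_n(ω) u_n`.

*The deterministic input* is the square-function bound `∑ ‖u_n‖²_{L^q L^ρ} ≤ C ‖φ‖²` for every finite
`ρ ≥ r` (`exists_tsum_evolution_window_le`). Each piece `ψ(D - n) φ` has frequencies in a cube of side
two, so convolution with a kernel whose modulus does not depend on `n` gives Bernstein's inequality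
`L^r → L^∞`, and hence `L^r → L^ρ`, uniformly in `n`; this reduces `L^q L^ρ` to the admissible norm
`L^q L^r`. The Strichartz estimate then bounds a piece by the `L²` norm of `𝓕 φ` on its cube, and the
cubes overlap at most `3 ^ d` times.

*The Strichartz estimate*, including the endpoint `q = 2`, is not in Mathlib and is proved here by the
Keel–Tao argument in the form of a bound for an abstract family of Hilbert space vectors `w_k(t)`
(`exists_enorm_sum_integral_sq_le`), where `k` labels atoms supported on sets of measure about `2 ^ k`. The
square norm of `∑_k ∫ w_k` is expanded into pairings at times `s, t`, split according to the dyadic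
size `2 ^ (j / σ)` of `|s - t|`. A pairing of the scales `k, l` at separation `j` is controlled by the
dispersive bound, and also by the energy bound for either factor combined with the estimate for a single
scale for the other one; one of these three bounds decays geometrically in `|k - j| + |l - j|`
(`exponent_trichotomy`), and the triple sum over `j, k, l` is estimated by Schur's test. For the
Schrödinger group the dispersive bound comes from the Fourier transform of complex gaussians
(`norm_integral_schrodingerSymbol_mul_le`), and the dual estimate is turned into the Strichartz
estimate by testing it against `|u|^{r-2} u ‖u(t)‖_r^{q-r}` (`exists_strichartz`).

*The probabilistic input* is that `∑ g_n z_n` has real and imaginary parts which are subgaussian with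
variance proxy `2 c₀ ∑ |z_n|²`, so that its moments of order `k` are at most
`4 (4 e c₀ k ∑ |z_n|²)^{k/2}` (`IsRandomizer.lintegral_enorm_sum_rpow_le`). For `k ≥ max(q, ρ)`
Minkowski's inequality moves the expectation inside and the square sum outside the mixed norm, whence
the `k`-th moment of the space-time norm is at most `4 (C k ‖φ‖²)^{k/2}`. Markov's inequality with
`k ∼ λ² / ‖φ‖²` gives the gaussian tail.

Partial sums are finite sums of explicit continuous functions `evolution (𝓕 (ψ(D - n) φ))`; the limit is
reached by lower semicontinuity of the space-time norm and Fatou's lemma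
(`exists_measurable_majorant`). The series converges in `L²` because `∑ |g_n|² ‖ψ(D - n) φ‖²` has finite
expectation and the pieces are almost orthogonal.
-/

namespace WienerRandomization

/-! ### Minkowski's integral inequality -/

/-- Minkowski's integral inequality `‖∫ f(·, b) dν(b)‖_{L^s(μ)} ≤ ∫ ‖f(·, b)‖_{L^s(μ)} dν(b)`. With
the weight `w b = ‖f(·, b)‖_{L^s(μ)}` it is Hölder's inequality in `b` for
`f = (f w^{-1/s'}) · w^{1/s'}`, followed by Tonelli's theorem. -/
theorem lintegral_rpow_lintegral_le {α β : Type*} [MeasurableSpace α] [MeasurableSpace β]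
    (μ : Measure α) (ν : Measure β) [SFinite μ] [SFinite ν] {f : α → β → ℝ≥0∞}
    (hf : Measurable (Function.uncurry f)) {s : ℝ} (hs : 1 ≤ s) :
    (∫⁻ a, (∫⁻ b, f a b ∂ν) ^ s ∂μ) ^ (1 / s) ≤ ∫⁻ b, (∫⁻ a, f a b ^ s ∂μ) ^ (1 / s) ∂ν := by
  rcases hs.eq_or_lt with rfl | hs
  · simpa using (lintegral_lintegral_swap hf.aemeasurable).le
  have hs0 : 0 < s := by linarith
  set w : β → ℝ≥0∞ := fun b => (∫⁻ a, f a b ^ s ∂μ) ^ (1 / s) with hw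
  have hf' : Measurable fun z : β × α => f z.2 z.1 ^ s :=
    (hf.comp measurable_swap).pow_const s
  have hwm : Measurable w := (hf'.lintegral_prod_right' (ν := μ)).pow_const _
  rcases eq_or_ne (∫⁻ b, w b ∂ν) ⊤ with hW | hW
  · exact hW ▸ le_top
  have hwfin : ∀ᵐ b ∂ν, w b < ⊤ := ae_lt_top hwm hW
  have hset : MeasurableSet {z : α × β | w z.2 = 0 → f z.1 z.2 = 0} := by
    have h1 : MeasurableSet {z : α × β | w z.2 = 0} :=
      (hwm.comp measurable_snd) (measurableSet_singleton 0)
    have h2 : MeasurableSet {z : α × β | f z.1 z.2 = 0} := hf (measurableSet_singleton 0)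
    exact (h1.compl.union h2).congr (by ext z; simp [imp_iff_not_or])
  have hz : ∀ᵐ a ∂μ, ∀ᵐ b ∂ν, w b = 0 → f a b = 0 := by
    rw [Measure.ae_ae_comm (p := fun a b => w b = 0 → f a b = 0) hset]
    refine Filter.Eventually.of_forall fun b => ?_
    by_cases hb : w b = 0
    · have h0 : ∫⁻ a, f a b ^ s ∂μ = 0 := by
        simpa [hw, ENNReal.rpow_eq_zero_iff, hs0, hs0.not_gt] using hb
      have hfb : Measurable fun a => f a b := hf.comp measurable_prodMk_right
      rw [lintegral_eq_zero_iff (hfb.pow_const s)] at h0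
      filter_upwards [h0] with a ha _
      simpa [ENNReal.rpow_eq_zero_iff, hs0, hs0.not_gt] using ha
    · exact Filter.Eventually.of_forall fun a h => absurd h hb
  have hconj : s.HolderConjugate (s / (s - 1)) := Real.HolderConjugate.conjExponent hs
  set s' := s / (s - 1) with hs'
  have hs'0 : 0 < s' := hconj.symm.pos
  have key : ∀ᵐ a ∂μ, (∫⁻ b, f a b ∂ν) ^ s
      ≤ (∫⁻ b, f a b ^ s * w b ^ (1 - s) ∂ν) * (∫⁻ b, w b ∂ν) ^ (s - 1) := by
    filter_upwards [hz] with a ha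
    have h1 : ∫⁻ b, f a b ∂ν ≤ ∫⁻ b, ((fun b => f a b * w b ^ (-(1 / s')))
        * fun b => w b ^ (1 / s')) b ∂ν := by
      refine lintegral_mono_ae ?_
      filter_upwards [ha, hwfin] with b hb hb'
      rcases eq_or_ne (w b) 0 with h0 | h0
      · simp [hb h0]
      · rw [Pi.mul_apply, mul_assoc, ← ENNReal.rpow_add _ _ h0 hb'.ne]
        simp
    have hfa : Measurable (f a) := hf.comp measurable_prodMk_left
    have h2 := h1.trans (ENNReal.lintegral_mul_le_Lp_mul_Lq ν hconj
      (hfa.mul (hwm.pow_const _)).aemeasurable (hwm.pow_const _).aemeasurable)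
    have h3 := ENNReal.rpow_le_rpow h2 hs0.le
    refine h3.trans ?_
    rw [ENNReal.mul_rpow_of_nonneg _ _ hs0.le, ← ENNReal.rpow_mul, ← ENNReal.rpow_mul,
      one_div_mul_cancel hs0.ne', ENNReal.rpow_one]
    have e1 : 1 / s' * s = s - 1 := by
      rw [hs']; field_simp
    have e2 : -(1 / s') * s = 1 - s := by rw [neg_mul, e1]; ring
    rw [e1]
    refine mul_le_mul' (le_of_eq ?_) (le_of_eq ?_)
    · refine lintegral_congr fun b => ?_
      rw [ENNReal.mul_rpow_of_nonneg _ _ hs0.le, ← ENNReal.rpow_mul, e2]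
    · congr 1
      refine lintegral_congr fun b => ?_
      rw [← ENNReal.rpow_mul, one_div_mul_cancel hs'0.ne', ENNReal.rpow_one]
  have total : ∫⁻ a, (∫⁻ b, f a b ∂ν) ^ s ∂μ ≤ (∫⁻ b, w b ∂ν) ^ s := by
    refine (lintegral_mono_ae key).trans ?_
    have hm : Measurable (Function.uncurry fun a b => f a b ^ s * w b ^ (1 - s)) :=
      (hf.pow_const s).mul ((hwm.comp measurable_snd).pow_const _)
    have hm' : Measurable fun a => ∫⁻ b, f a b ^ s * w b ^ (1 - s) ∂ν :=
      hm.lintegral_prod_right' (ν := ν)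
    rw [lintegral_mul_const _ hm',
      lintegral_lintegral_swap hm.aemeasurable]
    have h4 : ∫⁻ b, ∫⁻ a, f a b ^ s * w b ^ (1 - s) ∂μ ∂ν ≤ ∫⁻ b, w b ∂ν := by
      refine lintegral_mono_ae ?_
      filter_upwards [hwfin] with b hb
      have hfb : Measurable fun a => f a b := hf.comp measurable_prodMk_right
      rw [lintegral_mul_const _ (hfb.pow_const s)]
      have h5 : ∫⁻ a, f a b ^ s ∂μ = w b ^ s := by
        rw [hw]; simp only
        rw [← ENNReal.rpow_mul, one_div_mul_cancel hs0.ne', ENNReal.rpow_one]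
      rw [h5]
      rcases eq_or_ne (w b) 0 with h0 | h0
      · simp [h0, hs0]
      · rw [← ENNReal.rpow_add _ _ h0 hb.ne]; simp
    refine (mul_le_mul_left h4 _).trans (le_of_eq ?_)
    rcases eq_or_ne (∫⁻ b, w b ∂ν) 0 with h0 | h0
    · simp [h0, hs0]
    · nth_rewrite 1 [← ENNReal.rpow_one (∫⁻ b, w b ∂ν)]
      rw [← ENNReal.rpow_add _ _ h0 hW]
      congr 1; ring
  calc _ ≤ ((∫⁻ b, w b ∂ν) ^ s) ^ (1 / s) := ENNReal.rpow_le_rpow total (by positivity)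
    _ = _ := by rw [← ENNReal.rpow_mul, mul_one_div_cancel hs0.ne', ENNReal.rpow_one]

/-! ### Level decomposition of a function -/

/-- The decreasing rearrangement of `H` at `2 ^ k`: the smallest height `l` such that `H` exceeds
`l` only on a set of measure at most `2 ^ k`. -/
noncomputable def dyadicLevel {α : Type*} [MeasurableSpace α] (μ : Measure α) (H : α → ℝ≥0∞)
    (k : ℤ) : ℝ≥0∞ :=
  sInf {l | μ {x | l < H x} ≤ 2 ^ k}

section Level

variable {α : Type*} [MeasurableSpace α] {μ : Measure α} {H : α → ℝ≥0∞}

theorem measure_dyadicLevel_lt (k : ℤ) : μ {x | dyadicLevel μ H k < H x} ≤ 2 ^ k := by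
  have hne : {l : ℝ≥0∞ | μ {x | l < H x} ≤ 2 ^ k}.Nonempty := ⟨⊤, by simp⟩
  obtain ⟨u, hu, hlim, hmem⟩ := exists_seq_tendsto_sInf hne (OrderBot.bddBelow _)
  have hsub : {x | dyadicLevel μ H k < H x} ⊆ ⋃ n, {x | u n < H x} := by
    intro x hx
    obtain ⟨n, hn⟩ := (hlim.eventually_lt_const hx).exists
    exact Set.mem_iUnion.2 ⟨n, hn⟩
  have hmono : Monotone fun n => {x | u n < H x} :=
    fun m n hmn x hx => (hu hmn).trans_lt hx
  refine (measure_mono hsub).trans ?_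
  rw [hmono.measure_iUnion]
  exact iSup_le hmem

theorem lt_measure_of_lt_dyadicLevel {k : ℤ} {l : ℝ≥0∞} (hl : l < dyadicLevel μ H k) :
    2 ^ k < μ {x | l < H x} :=
  not_le.1 fun h => notMem_of_lt_csInf hl (OrderBot.bddBelow _) h

theorem dyadicLevel_antitone : Antitone (dyadicLevel μ H) := fun k l hkl =>
  sInf_le ((measure_dyadicLevel_lt k).trans (ENNReal.zpow_le_of_le (by norm_num) hkl))

/-- The powers of two below `m` form a geometric series with largest term below `m`. -/
theorem tsum_two_zpow_lt_le (m : ℝ≥0∞) :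
    ∑' k : ℤ, (if (2 : ℝ≥0∞) ^ k < m then (2 : ℝ≥0∞) ^ k else 0) ≤ 2 * m := by
  rcases eq_or_ne m 0 with rfl | h0
  · simp
  rcases eq_or_ne m ⊤ with rfl | hT
  · simp
  obtain ⟨n, hn, hn'⟩ := ENNReal.exists_mem_Ioc_zpow h0 hT (y := 2) (by norm_num) (by norm_num)
  have hinj : Function.Injective fun i : ℕ => n - (i : ℤ) := fun i j h => by
    simpa using h
  rw [← hinj.tsum_eq]
  · calc ∑' i : ℕ, (if (2 : ℝ≥0∞) ^ (n - (i : ℤ)) < m then (2 : ℝ≥0∞) ^ (n - (i : ℤ)) else 0)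
        ≤ ∑' i : ℕ, (2 : ℝ≥0∞) ^ n * (2⁻¹) ^ i := by
          refine ENNReal.tsum_le_tsum fun i => ?_
          split_ifs
          · rw [sub_eq_add_neg, ENNReal.zpow_add (by norm_num) (by norm_num), ENNReal.zpow_neg,
              zpow_natCast, ENNReal.inv_pow]
          · exact zero_le
      _ = 2 * 2 ^ n := by
          rw [ENNReal.tsum_mul_left, ENNReal.tsum_geometric, ENNReal.one_sub_inv_two, inv_inv,
            mul_comm]
      _ ≤ 2 * m := by gcongr
  · intro k hk
    have hk' : (2 : ℝ≥0∞) ^ k < m := by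
      by_contra h
      simp [h] at hk
    have : k < n + 1 := by
      by_contra! h
      exact absurd (hk'.trans_le hn') (not_lt.2 (ENNReal.zpow_le_of_le (by norm_num) h))
    exact ⟨(n - k).toNat, by simp only; omega⟩

theorem lintegral_indicator_ofReal_lt (y : ℝ≥0∞) :
    ∫⁻ l in Set.Ioi (0 : ℝ), (if ENNReal.ofReal l < y then 1 else 0) = y := by
  have h : ∀ l : ℝ, (if ENNReal.ofReal l < y then (1 : ℝ≥0∞) else 0)
      = {l : ℝ | ENNReal.ofReal l < y}.indicator 1 l := fun l => by
    simp [Set.indicator_apply]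
  simp_rw [h]
  have hm : MeasurableSet {l : ℝ | ENNReal.ofReal l < y} :=
    measurableSet_lt ENNReal.measurable_ofReal measurable_const
  rw [lintegral_indicator_one hm, Measure.restrict_apply hm]
  rcases eq_or_ne y ⊤ with rfl | hy
  · simp
  · have : {l : ℝ | ENNReal.ofReal l < y} ∩ Set.Ioi 0 = Set.Ioo 0 y.toReal := by
      ext l
      simp only [Set.mem_inter_iff, Set.mem_ofPred_eq, Set.mem_Ioi, Set.mem_Ioo]
      rw [and_comm]
      refine and_congr_right fun hl => ?_
      rw [ENNReal.ofReal_lt_iff_lt_toReal hl.le hy]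
    rw [this, Real.volume_Ioo, sub_zero, ENNReal.ofReal_toReal hy]

/-- By the layer-cake formula, since `l < dyadicLevel μ H k` forces `2 ^ k < μ {l < H}`. -/
theorem tsum_two_zpow_mul_dyadicLevel_le [SFinite μ] (hH : Measurable H) :
    ∑' k : ℤ, 2 ^ k * dyadicLevel μ H k ≤ 2 * ∫⁻ x, H x ∂μ := by
  have hmeas : Measurable fun z : ℝ × α => (if ENNReal.ofReal z.1 < H z.2 then (1 : ℝ≥0∞) else 0) :=
    Measurable.ite (measurableSet_lt (ENNReal.measurable_ofReal.comp measurable_fst)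
      (hH.comp measurable_snd)) measurable_const measurable_const
  have hlev : ∀ y : ℝ≥0∞, Measurable fun l : ℝ => (if ENNReal.ofReal l < y then (1 : ℝ≥0∞) else 0) :=
    fun y => Measurable.ite (measurableSet_lt ENNReal.measurable_ofReal measurable_const)
      measurable_const measurable_const
  calc ∑' k : ℤ, 2 ^ k * dyadicLevel μ H k
      = ∑' k : ℤ, ∫⁻ l in Set.Ioi (0 : ℝ),
          2 ^ k * (if ENNReal.ofReal l < dyadicLevel μ H k then 1 else 0) := by
        refine tsum_congr fun k => ?_
        rw [lintegral_const_mul _ (hlev _), lintegral_indicator_ofReal_lt]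
    _ = ∫⁻ l in Set.Ioi (0 : ℝ),
          ∑' k : ℤ, 2 ^ k * (if ENNReal.ofReal l < dyadicLevel μ H k then 1 else 0) :=
        (lintegral_tsum fun k => ((hlev _).const_mul _).aemeasurable).symm
    _ ≤ ∫⁻ l in Set.Ioi (0 : ℝ), 2 * μ {x | ENNReal.ofReal l < H x} := by
        refine lintegral_mono fun l => ?_
        refine (ENNReal.tsum_le_tsum fun k => ?_).trans (tsum_two_zpow_lt_le _)
        by_cases h : ENNReal.ofReal l < dyadicLevel μ H k
        · simp [h, lt_measure_of_lt_dyadicLevel h]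
        · simp [h]
    _ = ∫⁻ l in Set.Ioi (0 : ℝ), 2 * ∫⁻ x, (if ENNReal.ofReal l < H x then 1 else 0) ∂μ := by
        refine lintegral_congr fun l => ?_
        congr 1
        have h : ∀ x, (if ENNReal.ofReal l < H x then (1 : ℝ≥0∞) else 0)
          = {x | ENNReal.ofReal l < H x}.indicator 1 x := fun x => by simp [Set.indicator_apply]
        simp_rw [h]
        rw [lintegral_indicator_one (measurableSet_lt measurable_const hH)]
    _ = 2 * ∫⁻ x, H x ∂μ := by
        rw [lintegral_const_mul _ hmeas.lintegral_prod_right', lintegral_lintegral_swap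
          (f := fun l x => if ENNReal.ofReal l < H x then (1 : ℝ≥0∞) else 0) hmeas.aemeasurable]
        simp_rw [lintegral_indicator_ofReal_lt]

/-- The rearrangement of an integrable function tends to zero at infinity. -/
theorem exists_dyadicLevel_lt [SFinite μ] (hH : Measurable H) (hint : ∫⁻ x, H x ∂μ ≠ ⊤) {y : ℝ≥0∞}
    (hy : y ≠ 0) : ∃ K : ℕ, dyadicLevel μ H K < y := by
  by_contra! hcon
  have h1 : ∀ K : ℕ, 2 ^ K * y ≤ 2 * ∫⁻ x, H x ∂μ := fun K => by
    refine le_trans ?_ ((ENNReal.le_tsum (K : ℤ)).trans (tsum_two_zpow_mul_dyadicLevel_le hH))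
    rw [zpow_natCast]
    gcongr
    exact hcon K
  have h2 : Filter.Tendsto (fun K : ℕ => (2 : ℝ≥0∞) ^ K * y) Filter.atTop (nhds (⊤ * y)) :=
    ENNReal.Tendsto.mul_const
      (ENNReal.tendsto_pow_atTop_nhds_top_iff.2 (by norm_num)) (Or.inl (by simp))
  rw [ENNReal.top_mul hy] at h2
  exact ENNReal.mul_ne_top (by norm_num) hint (top_le_iff.1 (le_of_tendsto' h2 h1))

theorem ae_exists_le_dyadicLevel : ∀ᵐ x ∂μ, ∃ K : ℕ, H x ≤ dyadicLevel μ H (-K) := by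
  rw [ae_iff]
  refine le_antisymm ?_ zero_le
  have h2 : Filter.Tendsto (fun K : ℕ => (2 : ℝ≥0∞) ^ (-(K : ℤ))) Filter.atTop (nhds 0) := by
    simp_rw [ENNReal.zpow_neg, zpow_natCast, ENNReal.inv_pow]
    exact ENNReal.tendsto_pow_atTop_nhds_zero_of_lt_one (by norm_num)
  refine ge_of_tendsto' h2 fun K =>
    (measure_mono fun x hx => ?_).trans (measure_dyadicLevel_lt (H := H) (-K))
  simp only [Set.mem_ofPred_eq, not_exists, not_le] at hx
  exact hx K

end Level

/-! ### Bilinear estimates localised to dyadic time separations -/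

/-- The `L^p` norm of a nonnegative function of time. -/
noncomputable def lpTime (p : ℝ) (c : ℝ → ℝ≥0∞) : ℝ≥0∞ := (∫⁻ t, c t ^ p) ^ (1 / p)

/-- The `L^p` norm of `c` over the window `[t - R, t + R]`. -/
noncomputable def windowNorm (p R : ℝ) (c : ℝ → ℝ≥0∞) (t : ℝ) : ℝ≥0∞ :=
  (∫⁻ s in Metric.closedBall t R, c s ^ p) ^ (1 / p)

/-- The pairs of times at distance in `[2^{j/σ}, 2^{(j+1)/σ})`; on this set `|s - t|^{-σ}` is
comparable to `2^{-j}`. -/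
def timeAnnulus (σ : ℝ) (j : ℤ) : Set (ℝ × ℝ) :=
  {z | (2 : ℝ) ^ (j / σ) ≤ |z.1 - z.2| ∧ |z.1 - z.2| < (2 : ℝ) ^ ((j + 1) / σ)}

theorem measurableSet_timeAnnulus (σ : ℝ) (j : ℤ) : MeasurableSet (timeAnnulus σ j) := by
  have h : Measurable fun z : ℝ × ℝ => |z.1 - z.2| := by fun_prop
  exact (measurableSet_le measurable_const h).inter (measurableSet_lt h measurable_const)

theorem measurableSet_closedBall_prod (R : ℝ) :
    MeasurableSet {z : ℝ × ℝ | z.1 ∈ Metric.closedBall z.2 R} := by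
  simp only [Metric.mem_closedBall]
  exact measurableSet_le (by fun_prop) measurable_const

theorem measurable_setLIntegral_closedBall (R : ℝ) {c : ℝ → ℝ≥0∞} (hc : Measurable c) :
    Measurable fun t => ∫⁻ s in Metric.closedBall t R, c s := by
  have : (fun t => ∫⁻ s in Metric.closedBall t R, c s)
      = fun t => ∫⁻ s, {z : ℝ × ℝ | z.1 ∈ Metric.closedBall z.2 R}.indicator
          (fun z => c z.1) (s, t) := by
    ext t
    rw [← lintegral_indicator Metric.isClosed_closedBall.measurableSet]
    rfl
  rw [this]
  exact (((hc.comp measurable_fst).indicator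
    (measurableSet_closedBall_prod R)).comp measurable_swap).lintegral_prod_right'

theorem lintegral_setLIntegral_closedBall {R : ℝ} (c : ℝ → ℝ≥0∞) (hc : Measurable c) :
    ∫⁻ t, ∫⁻ s in Metric.closedBall t R, c s = ENNReal.ofReal (2 * R) * ∫⁻ s, c s := by
  have h1 : ∀ t, ∫⁻ s in Metric.closedBall t R, c s
      = ∫⁻ s, (Metric.closedBall s R).indicator (fun _ => c s) t := fun t => by
    rw [← lintegral_indicator Metric.isClosed_closedBall.measurableSet]
    refine lintegral_congr fun s => ?_
    simp only [Set.indicator, Metric.mem_closedBall, dist_comm]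
  simp_rw [h1]
  rw [lintegral_lintegral_swap]
  · rw [← lintegral_const_mul _ hc]
    refine lintegral_congr fun s => ?_
    rw [lintegral_indicator Metric.isClosed_closedBall.measurableSet, setLIntegral_const,
      Real.volume_closedBall, mul_comm]
  · have : (Function.uncurry fun (t s : ℝ) => (Metric.closedBall s R).indicator (fun _ => c s) t)
        = {z : ℝ × ℝ | z.1 ∈ Metric.closedBall z.2 R}.indicator fun z => c z.2 := by
      ext z
      simp [Function.uncurry, Set.indicator]
    rw [this]
    exact ((hc.comp measurable_snd).indicator (measurableSet_closedBall_prod R)).aemeasurable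

section Window

variable {p q : ℝ} (hq : 2 ≤ q) (hpq : p.HolderConjugate q)
include hpq

theorem setLIntegral_closedBall_le_windowNorm {R : ℝ} {c : ℝ → ℝ≥0∞} (hc : Measurable c) (t : ℝ) :
    ∫⁻ s in Metric.closedBall t R, c s
      ≤ ENNReal.ofReal (2 * R) ^ (1 / q) * windowNorm p R c t := by
  have h := ENNReal.lintegral_mul_le_Lp_mul_Lq (volume.restrict (Metric.closedBall t R)) hpq
    hc.aemeasurable (aemeasurable_const (b := (1 : ℝ≥0∞)))
  simp only [Pi.mul_apply, mul_one, ENNReal.one_rpow, lintegral_const, one_mul,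
    Measure.restrict_apply_univ, Real.volume_closedBall] at h
  rw [mul_comm]
  exact h

include hq in
/-- Hölder's inequality in time; since `p ≤ q`, the `L^q` norm in `t` of the window norm of `c` is at
most a power of the window length times the `L^p` norm of `c`. -/
theorem lintegral_windowNorm_mul_le {R : ℝ} {c c' : ℝ → ℝ≥0∞} (hc : Measurable c)
    (hc' : Measurable c') :
    ∫⁻ t, windowNorm p R c t * c' t
      ≤ ENNReal.ofReal (2 * R) ^ (1 / q) * lpTime p c * lpTime p c' := by
  have hp0 : 0 < p := hpq.pos
  have hq0 : 0 < q := hpq.symm.pos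
  have hqp : 0 ≤ q / p - 1 := by
    have : q / p = q - 1 := by rw [div_eq_iff hp0.ne']; linarith [hpq.mul_eq_add]
    linarith
  have hcp : Measurable fun t => c t ^ p := hc.pow_const p
  have hm : Measurable fun t => windowNorm p R c t :=
    (measurable_setLIntegral_closedBall R hcp).pow_const _
  have h := ENNReal.lintegral_mul_le_Lp_mul_Lq volume hpq.symm hm.aemeasurable hc'.aemeasurable
  refine h.trans ?_
  refine mul_le_mul_left ?_ _
  have h1 : ∫⁻ t, windowNorm p R c t ^ q
      ≤ ENNReal.ofReal (2 * R) * (∫⁻ t, c t ^ p) ^ (q / p) := by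
    calc ∫⁻ t, windowNorm p R c t ^ q
        ≤ ∫⁻ t, (∫⁻ s, c s ^ p) ^ (q / p - 1) * ∫⁻ s in Metric.closedBall t R, c s ^ p := by
          refine lintegral_mono fun t => ?_
          rw [windowNorm, ← ENNReal.rpow_mul,
            show 1 / p * q = (q / p - 1) + 1 by ring,
            ENNReal.rpow_add_of_nonneg _ _ hqp zero_le_one, ENNReal.rpow_one]
          gcongr
          exact Measure.restrict_le_self
      _ = _ := by
          rw [lintegral_const_mul _ (measurable_setLIntegral_closedBall R hcp),
            lintegral_setLIntegral_closedBall _ hcp, mul_left_comm]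
          congr 1
          nth_rewrite 2 [← ENNReal.rpow_one (∫⁻ s, c s ^ p)]
          rw [← ENNReal.rpow_add_of_nonneg _ _ hqp zero_le_one]
          congr 1; ring
  refine (ENNReal.rpow_le_rpow h1 (by positivity)).trans (le_of_eq ?_)
  rw [ENNReal.mul_rpow_of_nonneg _ _ (by positivity), ← ENNReal.rpow_mul, lpTime]
  congr 2
  field_simp

end Window

/-- The geometric weight `2 ^ x`. -/
local notation "𝟚^" x:max => (2 : ℝ≥0∞) ^ (x : ℝ)

theorem two_rpow_add (x y : ℝ) : 𝟚^(x + y) = 𝟚^x * 𝟚^y :=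
  ENNReal.rpow_add x y (by norm_num) (by norm_num)

theorem two_rpow_mono {x y : ℝ} (h : x ≤ y) : 𝟚^x ≤ 𝟚^y :=
  ENNReal.rpow_le_rpow_of_exponent_le (by norm_num) h

theorem ofReal_two_rpow (x : ℝ) : ENNReal.ofReal ((2 : ℝ) ^ x) = 𝟚^x := by
  rw [← ENNReal.ofReal_rpow_of_pos (by norm_num)]; norm_num

theorem ofReal_two_mul_rpow {σ a q : ℝ} (hσ : 0 < σ) (hqa : 1 / q = σ * a) (j : ℤ) :
    ENNReal.ofReal (2 * (2 : ℝ) ^ ((j + 1) / σ)) ^ (1 / q) = 𝟚^(1 / q + a) * 𝟚^(j * a) := by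
  have : (2 : ℝ) * (2 : ℝ) ^ (((j : ℝ) + 1) / σ) = (2 : ℝ) ^ (1 + ((j : ℝ) + 1) / σ) := by
    rw [Real.rpow_add (by norm_num), Real.rpow_one]
  rw [this, ofReal_two_rpow, ← ENNReal.rpow_mul, ← two_rpow_add]
  congr 1
  rw [hqa]
  field_simp
  ring

/-- Localisation to time separations `2 ^ (j / σ)` turns the product of the `L¹` norms into that of the
`L^p` norms, at the price of the length of the window to the power `2 / q`. -/
theorem setLIntegral_timeAnnulus_mul_le {σ a p q : ℝ} (hσ : 0 < σ) (hq : 2 ≤ q)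
    (hpq : p.HolderConjugate q) (hqa : 1 / q = σ * a) (j : ℤ) {c c' : ℝ → ℝ≥0∞}
    (hc : Measurable c) (hc' : Measurable c') :
    ∫⁻ z in timeAnnulus σ j, c z.1 * c' z.2
      ≤ (𝟚^(1 / q + a)) ^ 2 * 𝟚^(2 * j * a) * (lpTime p c * lpTime p c') := by
  set R : ℝ := (2 : ℝ) ^ (((j : ℝ) + 1) / σ) with hR
  have hsub : timeAnnulus σ j ⊆ {z : ℝ × ℝ | z.1 ∈ Metric.closedBall z.2 R} := by
    intro z hz
    rw [Set.mem_ofPred_eq, Metric.mem_closedBall, Real.dist_eq]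
    exact hz.2.le
  calc ∫⁻ z in timeAnnulus σ j, c z.1 * c' z.2
      ≤ ∫⁻ z in {z : ℝ × ℝ | z.1 ∈ Metric.closedBall z.2 R}, c z.1 * c' z.2 :=
        lintegral_mono_set hsub
    _ = ∫⁻ t, (∫⁻ s in Metric.closedBall t R, c s) * c' t := by
        rw [← lintegral_indicator (measurableSet_closedBall_prod R), Measure.volume_eq_prod,
          lintegral_prod_symm]
        · refine lintegral_congr fun t => ?_
          rw [← lintegral_mul_const _ hc,
            ← lintegral_indicator Metric.isClosed_closedBall.measurableSet]
          rfl
        · exact (((hc.comp measurable_fst).mul (hc'.comp measurable_snd)).indicator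
            (measurableSet_closedBall_prod R)).aemeasurable
    _ ≤ ∫⁻ t, ENNReal.ofReal (2 * R) ^ (1 / q) * (windowNorm p R c t * c' t) := by
        refine lintegral_mono fun t => ?_
        rw [← mul_assoc]
        gcongr
        exact setLIntegral_closedBall_le_windowNorm hpq hc t
    _ ≤ ENNReal.ofReal (2 * R) ^ (1 / q) *
          (ENNReal.ofReal (2 * R) ^ (1 / q) * lpTime p c * lpTime p c') := by
        have hm : Measurable fun t => windowNorm p R c t :=
          (measurable_setLIntegral_closedBall R (hc.pow_const p)).pow_const _
        have hmc : Measurable fun t => windowNorm p R c t * c' t := hm.mul hc'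
        rw [lintegral_const_mul _ hmc]
        gcongr
        exact lintegral_windowNorm_mul_le hq hpq hc hc'
    _ = _ := by
        rw [hR, ofReal_two_mul_rpow hσ hqa, show 2 * (j : ℝ) * a = j * a + j * a by ring,
          two_rpow_add (j * a) (j * a)]
        ring

theorem volume_diagonal_real : volume {z : ℝ × ℝ | z.1 = z.2} = 0 := by
  have hm : MeasurableSet {z : ℝ × ℝ | z.1 = z.2} := measurableSet_eq_fun measurable_fst measurable_snd
  rw [Measure.volume_eq_prod, Measure.measure_prod_null hm]
  refine Filter.Eventually.of_forall fun s => ?_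
  have : Prod.mk s ⁻¹' {z : ℝ × ℝ | z.1 = z.2} = {s} := by
    ext t; simp [eq_comm]
  simp [this]

theorem pairwise_disjoint_timeAnnulus {σ : ℝ} (hσ : 0 < σ) :
    Pairwise (Function.onFun Disjoint (timeAnnulus σ)) := by
  have key : ∀ i j : ℤ, i < j → Disjoint (timeAnnulus σ i) (timeAnnulus σ j) := by
    intro i j hij
    refine Set.disjoint_left.2 fun z hi hj => ?_
    have h : (2 : ℝ) ^ (((i : ℝ) + 1) / σ) ≤ (2 : ℝ) ^ ((j : ℝ) / σ) := by
      refine Real.rpow_le_rpow_of_exponent_le (by norm_num) ?_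
      gcongr
      exact_mod_cast hij
    exact absurd (hi.2.trans_le h) (not_lt.2 hj.1)
  intro i j hij
  rcases lt_or_gt_of_ne hij with h | h
  · exact key i j h
  · exact (key j i h).symm

theorem iUnion_timeAnnulus_ae {σ : ℝ} (hσ : 0 < σ) :
    (⋃ j, timeAnnulus σ j) =ᵐ[volume] Set.univ := by
  rw [Filter.eventuallyEq_univ]
  have : ∀ᵐ z : ℝ × ℝ, z.1 ≠ z.2 := by
    rw [ae_iff]; simpa using volume_diagonal_real
  filter_upwards [this] with z hz
  have hpos : 0 < |z.1 - z.2| := abs_pos.2 (sub_ne_zero.2 hz)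
  obtain ⟨n, hn, hn'⟩ := exists_mem_Ico_zpow (y := (2 : ℝ) ^ (1 / σ)) hpos
    (Real.one_lt_rpow (by norm_num) (by positivity))
  have e : ∀ m : ℤ, ((2 : ℝ) ^ (1 / σ)) ^ m = (2 : ℝ) ^ ((m : ℝ) / σ) := fun m => by
    rw [← Real.rpow_intCast, ← Real.rpow_mul (by norm_num)]
    congr 1; ring
  rw [e] at hn hn'
  push_cast at hn'
  exact Set.mem_iUnion.2 ⟨n, hn, hn'⟩

theorem enorm_integral_le_tsum_timeAnnulus {σ : ℝ} (hσ : 0 < σ) {F : ℝ × ℝ → ℂ}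
    (hF : Integrable F) : ‖∫ z, F z‖ₑ ≤ ∑' j, ‖∫ z in timeAnnulus σ j, F z‖ₑ := by
  have h := hasSum_integral_iUnion (measurableSet_timeAnnulus σ) (pairwise_disjoint_timeAnnulus hσ)
    hF.integrableOn
  rw [setIntegral_congr_set (iUnion_timeAnnulus_ae hσ), setIntegral_univ] at h
  rw [← h.tsum_eq]
  exact enorm_tsum_le_tsum_enorm

section Hilbert

variable {H : Type*} [NormedAddCommGroup H] [InnerProductSpace ℂ H] [CompleteSpace H]

omit [CompleteSpace H] in
theorem enorm_inner_le (v w : H) : ‖inner ℂ v w‖ₑ ≤ ‖v‖ₑ * ‖w‖ₑ := by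
  rw [← ofReal_norm, ← ofReal_norm, ← ofReal_norm, ← ENNReal.ofReal_mul (norm_nonneg _)]
  exact ENNReal.ofReal_le_ofReal (norm_inner_le_norm v w)

theorem integral_inner_right {α : Type*} [MeasurableSpace α] {μ : Measure α} {w : α → H}
    (hw : Integrable w μ) (v : H) :
    ∫ s, inner ℂ (w s) v ∂μ = inner ℂ (∫ s, w s ∂μ) v := by
  rw [← inner_conj_symm, ← integral_inner hw, ← integral_conj]
  simp_rw [inner_conj_symm]

omit [CompleteSpace H] in
theorem integrable_inner_prod {w w' : ℝ → H} (hw : Integrable w) (hw' : Integrable w') :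
    Integrable fun z : ℝ × ℝ => inner ℂ (w z.1) (w' z.2) := by
  refine (hw.norm.mul_prod hw'.norm).mono ?_ ?_
  · exact hw.1.comp_fst.inner hw'.1.comp_snd
  · refine Filter.Eventually.of_forall fun z => ?_
    rw [norm_mul, norm_norm, norm_norm]
    exact norm_inner_le_norm _ _

theorem inner_integral_integral {w w' : ℝ → H} (hw : Integrable w) (hw' : Integrable w') :
    inner ℂ (∫ s, w s) (∫ t, w' t) = ∫ z : ℝ × ℝ, inner ℂ (w z.1) (w' z.2) := by
  rw [Measure.volume_eq_prod, integral_prod _ (integrable_inner_prod hw hw')]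
  simp_rw [integral_inner hw']
  rw [integral_inner_right hw]

theorem enorm_inner_integral_le {σ : ℝ} (hσ : 0 < σ) {w w' : ℝ → H} (hw : Integrable w)
    (hw' : Integrable w') :
    ‖inner ℂ (∫ s, w s) (∫ t, w' t)‖ₑ
      ≤ ∑' j, ‖∫ z in timeAnnulus σ j, inner ℂ (w z.1) (w' z.2)‖ₑ := by
  rw [inner_integral_integral hw hw']
  exact enorm_integral_le_tsum_timeAnnulus hσ (integrable_inner_prod hw hw')

omit [CompleteSpace H] in
theorem enorm_setIntegral_timeAnnulus_comm (σ : ℝ) (j : ℤ) (w w' : ℝ → H) :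
    ‖∫ z in timeAnnulus σ j, inner ℂ (w z.1) (w' z.2)‖ₑ
      = ‖∫ z in timeAnnulus σ j, inner ℂ (w' z.1) (w z.2)‖ₑ := by
  have h : ∫ z in timeAnnulus σ j, inner ℂ (w z.1) (w' z.2)
      = (starRingEnd ℂ) (∫ z in timeAnnulus σ j, inner ℂ (w' z.1) (w z.2)) := by
    rw [← integral_conj, ← integral_indicator (measurableSet_timeAnnulus σ j),
      ← integral_indicator (measurableSet_timeAnnulus σ j), Measure.volume_eq_prod,
      ← integral_prod_swap]
    refine integral_congr_ae (Filter.Eventually.of_forall fun z => ?_)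
    simp only [Set.indicator, timeAnnulus, Set.mem_ofPred_eq, Prod.fst_swap, Prod.snd_swap,
      inner_conj_symm, abs_sub_comm z.2 z.1]
  rw [h, RCLike.enorm_conj]

/-- Slicing in the second time variable. -/
theorem enorm_setIntegral_timeAnnulus_le (σ : ℝ) (j : ℤ) {w w' : ℝ → H} (hw : Integrable w)
    (hw' : Integrable w') :
    ‖∫ z in timeAnnulus σ j, inner ℂ (w z.1) (w' z.2)‖ₑ
      ≤ ∫⁻ t, ‖∫ s, {s | (s, t) ∈ timeAnnulus σ j}.indicator w s‖ₑ * ‖w' t‖ₑ := by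
  have hA := measurableSet_timeAnnulus σ j
  have hslice : ∀ t, MeasurableSet {s | (s, t) ∈ timeAnnulus σ j} := fun t =>
    hA.preimage measurable_prodMk_right
  rw [← integral_indicator hA, Measure.volume_eq_prod,
    integral_prod_symm _ ((integrable_inner_prod hw hw').indicator hA)]
  refine (enorm_integral_le_lintegral_enorm _).trans (lintegral_mono fun t => ?_)
  have : ∫ s, (timeAnnulus σ j).indicator (fun z : ℝ × ℝ => inner ℂ (w z.1) (w' z.2)) (s, t)
      = inner ℂ (∫ s, {s | (s, t) ∈ timeAnnulus σ j}.indicator w s) (w' t) := by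
    rw [← integral_inner_right (hw.indicator (hslice t))]
    refine integral_congr_ae (Filter.Eventually.of_forall fun s => ?_)
    simp only [Set.indicator, Set.mem_ofPred_eq]
    split_ifs <;> simp
  simp only [this]
  exact enorm_inner_le _ _

end Hilbert

/-! ### The Keel–Tao argument for vectors decomposed into atoms -/

/-- Exponents of the abstract Strichartz estimate: decay rate `σ`, spatial exponent encoded by
`b = 1/r` and `a = 1/2 - 1/r`, time exponent `q ≥ 2` with conjugate exponent `p`, linked by the
scaling relation `1/q = σ (1/2 - 1/r)`. -/
structure StrichartzExponents (σ a b p q : ℝ) : Prop where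
  σ_pos : 0 < σ
  a_pos : 0 < a
  b_pos : 0 < b
  add_eq : a + b = 1 / 2
  two_le : 2 ≤ q
  conj : p.HolderConjugate q
  scaling : 1 / q = σ * a

theorem tsum_int_two_rpow_lt_top {ε : ℝ} (hε : 0 < ε) :
    ∑' i : ℤ, 𝟚^(-(ε * |(i : ℝ)|)) < ⊤ := by
  have hr : 𝟚^(-ε) < 1 := ENNReal.rpow_lt_one_of_one_lt_of_neg (by norm_num) (by linarith)
  have hpow : ∀ n : ℕ, 𝟚^(-(ε * (n : ℝ))) = (𝟚^(-ε)) ^ n := fun n => by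
    rw [← ENNReal.rpow_natCast, ← ENNReal.rpow_mul]; congr 1; ring
  have hgeo : ∑' n : ℕ, (𝟚^(-ε)) ^ n < ⊤ := by
    rw [ENNReal.tsum_geometric]
    exact ENNReal.inv_lt_top.2 (tsub_pos_of_lt hr)
  have h1 : HasSum (fun n : ℕ => 𝟚^(-(ε * |((n : ℤ) : ℝ)|))) (∑' n : ℕ, (𝟚^(-ε)) ^ n) := by
    have : (fun n : ℕ => 𝟚^(-(ε * |((n : ℤ) : ℝ)|))) = fun n : ℕ => (𝟚^(-ε)) ^ n := by
      ext n
      rw [← hpow]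
      simp
    rw [this]
    exact ENNReal.summable.hasSum
  have h2 : HasSum (fun n : ℕ => 𝟚^(-(ε * |((-((n : ℤ) + 1) : ℤ) : ℝ)|)))
      (∑' n : ℕ, (𝟚^(-ε)) ^ (n + 1)) := by
    have : (fun n : ℕ => 𝟚^(-(ε * |((-((n : ℤ) + 1) : ℤ) : ℝ)|)))
        = fun n : ℕ => (𝟚^(-ε)) ^ (n + 1) := by
      ext n
      rw [← hpow]
      have : |((-((n : ℤ) + 1) : ℤ) : ℝ)| = ((n + 1 : ℕ) : ℝ) := by
        push_cast
        rw [abs_neg, abs_of_nonneg (by positivity)]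
      rw [this]
    rw [this]
    exact ENNReal.summable.hasSum
  rw [(HasSum.of_nat_of_neg_add_one (f := fun i : ℤ => 𝟚^(-(ε * |(i : ℝ)|))) h1 h2).tsum_eq]
  refine ENNReal.add_lt_top.2 ⟨hgeo, lt_of_le_of_lt ?_ hgeo⟩
  exact ENNReal.tsum_le_tsum fun n => pow_le_pow_right_of_le_one' hr.le (Nat.le_succ n)

/-- Of the three exponents produced by the dispersive bound and by the energy bound in either slot,
at least one decays in both `|x|` and `|y|`. -/
theorem exponent_trichotomy {a b ε x y : ℝ} (hε : 0 < ε) (ha : 3 * ε ≤ a) (hb : 3 * ε ≤ b) :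
    (x + y) * b ≤ -(ε * |x|) + -(ε * |y|) ∨ -(x * a) ≤ -(ε * |x|) + -(ε * |y|) ∨
      -(y * a) ≤ -(ε * |x|) + -(ε * |y|) := by
  set S := |x| + |y| with hS
  have hS0 : 0 ≤ S := by positivity
  have e : -(ε * |x|) + -(ε * |y|) = -(ε * S) := by rw [hS]; ring
  rw [e]
  by_cases hx : S ≤ 3 * x
  · right; left
    nlinarith
  by_cases hy : S ≤ 3 * y
  · right; right
    nlinarith
  left
  have h : 3 * (x + y) ≤ -S := by
    rcases abs_cases x with ⟨h1, h1'⟩ | ⟨h1, h1'⟩ <;> rcases abs_cases y with ⟨h2, h2'⟩ | ⟨h2, h2'⟩ <;>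
      rw [h1, h2] at hS <;> linarith
  nlinarith

section Atoms

variable {H : Type*} [NormedAddCommGroup H] [InnerProductSpace ℂ H]
variable {σ a b p q : ℝ}

/-- The energy bound for a vector-valued function of time, with profile `c` at scale `2 ^ k`. -/
def EnergyBound (a : ℝ) (k : ℤ) (w : ℝ → H) (c : ℝ → ℝ≥0∞) : Prop :=
  ∀ s, ‖w s‖ₑ ≤ 𝟚^(-(k * a)) * c s

/-- The dispersive bound between two vector-valued functions of time, with profiles `c`, `c'` at the
scales `2 ^ k`, `2 ^ l`. -/
def DispersiveBound (σ b : ℝ) (D : ℝ≥0∞) (k l : ℤ) (w w' : ℝ → H) (c c' : ℝ → ℝ≥0∞) : Prop :=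
  ∀ s t, s ≠ t → ‖inner ℂ (w s) (w' t)‖ₑ
    ≤ D * ENNReal.ofReal (|s - t| ^ (-σ)) * 𝟚^((k + l) * b) * (c s * c' t)

/-- On the annulus `j` the dispersive bound gains `2 ^ (-j)`; the remaining powers of two combine by the
scaling relation. -/
theorem DispersiveBound.timeAnnulus_le (hX : StrichartzExponents σ a b p q) {D : ℝ≥0∞} {k l : ℤ}
    {w w' : ℝ → H} {c c' : ℝ → ℝ≥0∞} (hc : Measurable c) (hc' : Measurable c')
    (h : DispersiveBound σ b D k l w w' c c') (j : ℤ) :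
    ‖∫ z in timeAnnulus σ j, inner ℂ (w z.1) (w' z.2)‖ₑ
      ≤ D * (𝟚^(1 / q + a)) ^ 2 * 𝟚^(((k - j : ℝ) + (l - j)) * b) * (lpTime p c * lpTime p c') := by
  have h1 : ∀ z ∈ timeAnnulus σ j, ‖inner ℂ (w z.1) (w' z.2)‖ₑ
      ≤ (D * 𝟚^(-(j : ℝ)) * 𝟚^((k + l) * b)) * (c z.1 * c' z.2) := by
    intro z hz
    have h2 : (0 : ℝ) < (2 : ℝ) ^ ((j : ℝ) / σ) := by positivity
    have hpos : 0 < |z.1 - z.2| := h2.trans_le hz.1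
    refine (h z.1 z.2 (sub_ne_zero.1 (abs_pos.1 hpos))).trans ?_
    gcongr
    rw [← ofReal_two_rpow]
    refine ENNReal.ofReal_le_ofReal ?_
    refine (Real.rpow_le_rpow_of_nonpos h2 hz.1 (by linarith [hX.σ_pos])).trans (le_of_eq ?_)
    rw [← Real.rpow_mul (by norm_num)]
    congr 1
    have := hX.σ_pos.ne'
    field_simp
  calc ‖∫ z in timeAnnulus σ j, inner ℂ (w z.1) (w' z.2)‖ₑ
      ≤ ∫⁻ z in timeAnnulus σ j, ‖inner ℂ (w z.1) (w' z.2)‖ₑ := enorm_integral_le_lintegral_enorm _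
    _ ≤ ∫⁻ z in timeAnnulus σ j, (D * 𝟚^(-(j : ℝ)) * 𝟚^((k + l) * b)) * (c z.1 * c' z.2) :=
        setLIntegral_mono' (measurableSet_timeAnnulus σ j) h1
    _ = (D * 𝟚^(-(j : ℝ)) * 𝟚^((k + l) * b)) * ∫⁻ z in timeAnnulus σ j, c z.1 * c' z.2 :=
        lintegral_const_mul _ ((hc.comp measurable_fst).mul (hc'.comp measurable_snd))
    _ ≤ (D * 𝟚^(-(j : ℝ)) * 𝟚^((k + l) * b)) *
        ((𝟚^(1 / q + a)) ^ 2 * 𝟚^(2 * j * a) * (lpTime p c * lpTime p c')) := by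
        gcongr
        exact setLIntegral_timeAnnulus_mul_le hX.σ_pos hX.two_le hX.conj hX.scaling j hc hc'
    _ = _ := by
        have : ((k - j : ℝ) + (l - j)) * b = -(j : ℝ) + (k + l) * b + 2 * j * a := by
          have := hX.add_eq
          have : b = 1 / 2 - a := by linarith
          rw [this]; ring
        rw [this, two_rpow_add (_ + _) (2 * j * a), two_rpow_add (-(j : ℝ))]
        ring

theorem EnergyBound.timeAnnulus_le (hX : StrichartzExponents σ a b p q) {k l : ℤ}
    {w w' : ℝ → H} {c c' : ℝ → ℝ≥0∞} (hc : Measurable c) (hc' : Measurable c')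
    (h : EnergyBound a k w c) (h' : EnergyBound a l w' c') (j : ℤ) :
    ‖∫ z in timeAnnulus σ j, inner ℂ (w z.1) (w' z.2)‖ₑ
      ≤ (𝟚^(1 / q + a)) ^ 2 * 𝟚^(-(((k - j : ℝ) + (l - j)) * a)) *
        (lpTime p c * lpTime p c') := by
  calc ‖∫ z in timeAnnulus σ j, inner ℂ (w z.1) (w' z.2)‖ₑ
      ≤ ∫⁻ z in timeAnnulus σ j, ‖inner ℂ (w z.1) (w' z.2)‖ₑ := enorm_integral_le_lintegral_enorm _
    _ ≤ ∫⁻ z in timeAnnulus σ j, (𝟚^(-(k * a)) * 𝟚^(-(l * a))) * (c z.1 * c' z.2) := by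
        refine lintegral_mono fun z => ?_
        refine (enorm_inner_le _ _).trans ((mul_le_mul' (h z.1) (h' z.2)).trans (le_of_eq ?_))
        ring
    _ = (𝟚^(-(k * a)) * 𝟚^(-(l * a))) * ∫⁻ z in timeAnnulus σ j, c z.1 * c' z.2 :=
        lintegral_const_mul _ ((hc.comp measurable_fst).mul (hc'.comp measurable_snd))
    _ ≤ (𝟚^(-(k * a)) * 𝟚^(-(l * a))) *
        ((𝟚^(1 / q + a)) ^ 2 * 𝟚^(2 * j * a) * (lpTime p c * lpTime p c')) := by
        gcongr
        exact setLIntegral_timeAnnulus_mul_le hX.σ_pos hX.two_le hX.conj hX.scaling j hc hc'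
    _ = _ := by
        have : -(((k - j : ℝ) + (l - j)) * a) = -(k * a) + -(l * a) + 2 * j * a := by ring
        rw [this, two_rpow_add (_ + _) (2 * j * a), two_rpow_add (-(k * a))]
        ring

variable [CompleteSpace H]

/-- The estimate for a single scale: both bounds are summable over the dyadic time separations, since
the dispersive bound decays for large ones and the energy bound for small ones. -/
theorem enorm_integral_atom_sq_le (hX : StrichartzExponents σ a b p q) {D : ℝ≥0∞} {ε : ℝ}
    (hε : 0 < ε) (hεa : 3 * ε ≤ a) (hεb : 3 * ε ≤ b) {k : ℤ} {w : ℝ → H} {c : ℝ → ℝ≥0∞}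
    (hc : Measurable c) (hE : EnergyBound a k w c) (hD : DispersiveBound σ b D k k w w c c) :
    ‖∫ s, w s‖ₑ ^ 2 ≤ (D + 1) * (𝟚^(1 / q + a)) ^ 2 * (∑' i : ℤ, 𝟚^(-(ε * |(i : ℝ)|))) *
      lpTime p c ^ 2 := by
  by_cases hw : Integrable w
  swap
  · simp [integral_undef hw]
  have h1 : ‖∫ s, w s‖ₑ ^ 2 = ‖inner ℂ (∫ s, w s) (∫ s, w s)‖ₑ := by
    rw [inner_self_eq_norm_sq_to_K, enorm_pow]
    simp [← ofReal_norm]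
  rw [h1]
  refine (enorm_inner_integral_le hX.σ_pos hw hw).trans ?_
  have h2 : ∀ j : ℤ, ‖∫ z in timeAnnulus σ j, inner ℂ (w z.1) (w z.2)‖ₑ
      ≤ ((D + 1) * (𝟚^(1 / q + a)) ^ 2 * lpTime p c ^ 2) * 𝟚^(-(ε * |((k - j : ℤ) : ℝ)|)) := by
    intro j
    have hcast : ((k - j : ℤ) : ℝ) = k - j := by push_cast; ring
    rw [hcast]
    rcases le_total ((k : ℝ) - j) 0 with hk | hk
    · refine (hD.timeAnnulus_le hX hc hc j).trans ?_
      rw [abs_of_nonpos hk]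
      have : 𝟚^(((k - j : ℝ) + (k - j)) * b) ≤ 𝟚^(-(ε * -(k - j : ℝ))) :=
        two_rpow_mono (by nlinarith)
      calc _ ≤ (D + 1) * (𝟚^(1 / q + a)) ^ 2 * 𝟚^(-(ε * -(k - j : ℝ))) *
            (lpTime p c * lpTime p c) := by gcongr; exact le_self_add
        _ = _ := by ring
    · refine (hE.timeAnnulus_le hX hc hc hE j).trans ?_
      rw [abs_of_nonneg hk]
      have : 𝟚^(-(((k - j : ℝ) + (k - j)) * a)) ≤ 𝟚^(-(ε * (k - j : ℝ))) :=
        two_rpow_mono (by nlinarith)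
      calc _ ≤ ((D + 1) * (𝟚^(1 / q + a)) ^ 2) * 𝟚^(-(ε * (k - j : ℝ))) *
            (lpTime p c * lpTime p c) := by
              gcongr
              exact le_mul_of_one_le_left' le_add_self
        _ = _ := by ring
  refine (ENNReal.tsum_le_tsum h2).trans ?_
  have h3 : ∑' j : ℤ, 𝟚^(-(ε * |((k - j : ℤ) : ℝ)|)) = ∑' i : ℤ, 𝟚^(-(ε * |(i : ℝ)|)) :=
    (Equiv.subLeft k).tsum_eq (fun i : ℤ => 𝟚^(-(ε * |(i : ℝ)|)))
  rw [ENNReal.tsum_mul_left, h3]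
  exact le_of_eq (by ring)

/-- The estimate with the energy bound in the second slot: for fixed second time, the integral in the
first slot is that of a time-truncated atom, controlled by the single-scale estimate. -/
theorem enorm_setIntegral_timeAnnulus_le_energy (hX : StrichartzExponents σ a b p q) {D : ℝ≥0∞}
    {ε : ℝ} (hε : 0 < ε) (hεa : 3 * ε ≤ a) (hεb : 3 * ε ≤ b) {k l : ℤ} {w w' : ℝ → H}
    {c c' : ℝ → ℝ≥0∞} (hc : Measurable c) (hc' : Measurable c') (hw : Integrable w)
    (hw' : Integrable w') (hE : EnergyBound a k w c) (hE' : EnergyBound a l w' c')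
    (hD : DispersiveBound σ b D k k w w c c) (j : ℤ) :
    ‖∫ z in timeAnnulus σ j, inner ℂ (w z.1) (w' z.2)‖ₑ
      ≤ ((D + 1) * (𝟚^(1 / q + a)) ^ 2 * ∑' i : ℤ, 𝟚^(-(ε * |(i : ℝ)|))) ^ (1 / 2 : ℝ) *
        𝟚^(1 / q + a) * 𝟚^(-((l - j : ℝ) * a)) * (lpTime p c * lpTime p c') := by
  set CA := (D + 1) * (𝟚^(1 / q + a)) ^ 2 * ∑' i : ℤ, 𝟚^(-(ε * |(i : ℝ)|)) with hCA
  set R : ℝ := (2 : ℝ) ^ (((j : ℝ) + 1) / σ) with hR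
  have hp0 : 0 < p := hX.conj.pos
  refine (enorm_setIntegral_timeAnnulus_le σ j hw hw').trans ?_
  have h1 : ∀ t, ‖∫ s, {s | (s, t) ∈ timeAnnulus σ j}.indicator w s‖ₑ
      ≤ CA ^ (1 / 2 : ℝ) * windowNorm p R c t := by
    intro t
    set A := {s | (s, t) ∈ timeAnnulus σ j} with hA
    have hAm : MeasurableSet A := (measurableSet_timeAnnulus σ j).preimage measurable_prodMk_right
    have hsub : A ⊆ Metric.closedBall t R := fun s hs => by
      rw [Metric.mem_closedBall, Real.dist_eq]; exact hs.2.le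
    have h2 := enorm_integral_atom_sq_le hX hε hεa hεb (w := A.indicator w) (c := A.indicator c)
      (D := D) (k := k) (hc.indicator hAm)
      (by
        intro s
        by_cases hs : s ∈ A
        · simpa [hs] using hE s
        · simp [hs])
      (by
        intro s t hst
        by_cases hs : s ∈ A
        · by_cases ht : t ∈ A
          · simpa [hs, ht] using hD s t hst
          · simp [ht]
        · simp [hs])
    have h3 : lpTime p (A.indicator c) ≤ windowNorm p R c t := by
      rw [lpTime, windowNorm]
      refine ENNReal.rpow_le_rpow ?_ (by positivity)
      rw [← lintegral_indicator Metric.isClosed_closedBall.measurableSet]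
      refine lintegral_mono fun s => ?_
      by_cases hs : s ∈ A
      · simp [hs, hsub hs]
      · simp [hs, hp0]
    have h4 : ‖∫ s, A.indicator w s‖ₑ ^ (2 : ℝ) ≤ CA * windowNorm p R c t ^ (2 : ℝ) := by
      rw [ENNReal.rpow_two, ENNReal.rpow_two]
      exact h2.trans (by gcongr)
    have h5 := ENNReal.rpow_le_rpow h4 (show (0 : ℝ) ≤ 1 / 2 by norm_num)
    rw [ENNReal.mul_rpow_of_nonneg _ _ (by norm_num), ← ENNReal.rpow_mul, ← ENNReal.rpow_mul] at h5
    norm_num at h5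
    convert h5 using 2
  calc ∫⁻ t, ‖∫ s, {s | (s, t) ∈ timeAnnulus σ j}.indicator w s‖ₑ * ‖w' t‖ₑ
      ≤ ∫⁻ t, (CA ^ (1 / 2 : ℝ) * 𝟚^(-(l * a))) * (windowNorm p R c t * c' t) := by
        refine lintegral_mono fun t => ?_
        refine (mul_le_mul' (h1 t) (hE' t)).trans (le_of_eq ?_)
        ring
    _ = (CA ^ (1 / 2 : ℝ) * 𝟚^(-(l * a))) * ∫⁻ t, windowNorm p R c t * c' t := by
        have hm : Measurable fun t => windowNorm p R c t :=
          (measurable_setLIntegral_closedBall R (hc.pow_const p)).pow_const _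
        have hm' : Measurable fun t => windowNorm p R c t * c' t := hm.mul hc'
        exact lintegral_const_mul _ hm'
    _ ≤ (CA ^ (1 / 2 : ℝ) * 𝟚^(-(l * a))) *
        (ENNReal.ofReal (2 * R) ^ (1 / q) * lpTime p c * lpTime p c') := by
        gcongr
        exact lintegral_windowNorm_mul_le hX.two_le hX.conj hc hc'
    _ = _ := by
        rw [hR, ofReal_two_mul_rpow hX.σ_pos hX.scaling,
          show -((l - j : ℝ) * a) = -(l * a) + j * a by ring,
          two_rpow_add (-(l * a))]
        ring

/-- The abstract Strichartz estimate in dual form, endpoint included. Interactions of the scales `k`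
and `l` at time separation `2^{j/σ}` decay geometrically in `|k - j| + |l - j|`; the triple sum is
then estimated by Schur's test. -/
theorem exists_enorm_sum_integral_sq_le (hX : StrichartzExponents σ a b p q) {D : ℝ≥0∞}
    (hD' : D ≠ ⊤) : ∃ C : ℝ≥0∞, C ≠ ⊤ ∧ ∀ (S : Finset ℤ) (w : ℤ → ℝ → H) (c : ℤ → ℝ → ℝ≥0∞),
      (∀ k ∈ S, Measurable (c k)) → (∀ k ∈ S, Integrable (w k)) →
      (∀ k ∈ S, EnergyBound a k (w k) (c k)) →
      (∀ k ∈ S, ∀ l ∈ S, DispersiveBound σ b D k l (w k) (w l) (c k) (c l)) →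
      ‖∑ k ∈ S, ∫ s, w k s‖ₑ ^ 2 ≤ C * ∑ k ∈ S, lpTime p (c k) ^ 2 := by
  have ha := hX.a_pos
  have hb := hX.b_pos
  set ε := min a b / 3 with hε'
  have hε : 0 < ε := by positivity
  have hεa : 3 * ε ≤ a := by rw [hε']; linarith [min_le_left a b]
  have hεb : 3 * ε ≤ b := by rw [hε']; linarith [min_le_right a b]
  set M := ∑' i : ℤ, 𝟚^(-(ε * |(i : ℝ)|)) with hM
  have hMtop : M < ⊤ := tsum_int_two_rpow_lt_top hε
  set W := 𝟚^(1 / q + a) with hW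
  have hWtop : W ≠ ⊤ := ENNReal.rpow_ne_top_of_nonneg
    (by have := hX.conj.symm.pos; positivity) (by norm_num)
  set CB := D * W ^ 2 + ((D + 1) * W ^ 2 * M) ^ (1 / 2 : ℝ) * W with hCB
  have hCBtop : CB ≠ ⊤ := by
    refine ENNReal.add_ne_top.2 ⟨ENNReal.mul_ne_top hD' (ENNReal.pow_ne_top hWtop),
      ENNReal.mul_ne_top (ENNReal.rpow_ne_top_of_nonneg (by norm_num) ?_) hWtop⟩
    exact ENNReal.mul_ne_top (ENNReal.mul_ne_top (ENNReal.add_ne_top.2 ⟨hD', by simp⟩)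
      (ENNReal.pow_ne_top hWtop)) hMtop.ne
  refine ⟨CB * (2 * M ^ 2), ENNReal.mul_ne_top hCBtop (ENNReal.mul_ne_top (by norm_num)
    (ENNReal.pow_ne_top hMtop.ne)), fun S w c hc hw hE hD => ?_⟩
  set u : ℤ → ℝ≥0∞ := fun i => 𝟚^(-(ε * |(i : ℝ)|)) with hu
  set x : ℤ → ℝ≥0∞ := fun k => lpTime p (c k) with hx
  have hpair : ∀ k ∈ S, ∀ l ∈ S, ∀ j : ℤ,
      ‖∫ z in timeAnnulus σ j, inner ℂ (w k z.1) (w l z.2)‖ₑ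
        ≤ CB * (u (k - j) * u (l - j) * (x k * x l)) := by
    intro k hk l hl j
    have hcast : ∀ m : ℤ, ((m - j : ℤ) : ℝ) = m - j := fun m => by push_cast; ring
    have huu : u (k - j) * u (l - j) = 𝟚^(-(ε * |(k : ℝ) - j|) + -(ε * |(l : ℝ) - j|)) := by
      rw [two_rpow_add, hu]; simp only [hcast]
    rw [huu, ← mul_assoc CB]
    rcases exponent_trichotomy (x := (k : ℝ) - j) (y := (l : ℝ) - j) hε hεa hεb with h | h | h
    · refine ((hD k hk l hl).timeAnnulus_le hX (hc k hk) (hc l hl) j).trans ?_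
      exact mul_le_mul' (mul_le_mul' le_self_add (two_rpow_mono h)) le_rfl
    · rw [enorm_setIntegral_timeAnnulus_comm]
      refine (enorm_setIntegral_timeAnnulus_le_energy hX hε hεa hεb (hc l hl) (hc k hk) (hw l hl)
        (hw k hk) (hE l hl) (hE k hk) (hD l hl l hl) j).trans ?_
      rw [mul_comm (lpTime p (c l))]
      exact mul_le_mul' (mul_le_mul' le_add_self (two_rpow_mono h)) le_rfl
    · refine (enorm_setIntegral_timeAnnulus_le_energy hX hε hεa hεb (hc k hk) (hc l hl) (hw k hk)
        (hw l hl) (hE k hk) (hE l hl) (hD k hk k hk) j).trans ?_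
      exact mul_le_mul' (mul_le_mul' le_add_self (two_rpow_mono h)) le_rfl
  have h1 : ‖∑ k ∈ S, ∫ s, w k s‖ₑ ^ 2
      = ‖inner ℂ (∑ k ∈ S, ∫ s, w k s) (∑ k ∈ S, ∫ s, w k s)‖ₑ := by
    rw [inner_self_eq_norm_sq_to_K, enorm_pow]
    simp [← ofReal_norm]
  rw [h1, sum_inner]
  simp_rw [inner_sum]
  have hMj : ∀ j : ℤ, ∑ k ∈ S, u (k - j) ≤ M := fun j => by
    refine (ENNReal.sum_le_tsum S).trans (le_of_eq ?_)
    exact (Equiv.subRight j).tsum_eq u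
  have hMk : ∀ k : ℤ, ∑' j : ℤ, u (k - j) = M := fun k => (Equiv.subLeft k).tsum_eq u
  have hprod : ∀ k l : ℤ, x k * x l ≤ x k ^ 2 + x l ^ 2 := fun k l => by
    rcases le_total (x k) (x l) with h | h
    · exact (mul_le_mul_left h _).trans ((sq (x l)).symm.le.trans le_add_self)
    · exact (mul_le_mul_right h _).trans ((sq (x k)).symm.le.trans le_self_add)
  have hhalf : ∀ y : ℤ → ℝ≥0∞, ∑' j : ℤ, ∑ k ∈ S, ∑ l ∈ S, u (k - j) * u (l - j) * y k
      ≤ M ^ 2 * ∑ k ∈ S, y k := by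
    intro y
    calc ∑' j : ℤ, ∑ k ∈ S, ∑ l ∈ S, u (k - j) * u (l - j) * y k
        ≤ ∑' j : ℤ, ∑ k ∈ S, u (k - j) * (M * y k) := by
          refine ENNReal.tsum_le_tsum fun j => Finset.sum_le_sum fun k _ => ?_
          simp_rw [mul_assoc]
          rw [← Finset.mul_sum, ← Finset.sum_mul]
          gcongr
          exact hMj j
      _ = ∑ k ∈ S, ∑' j : ℤ, u (k - j) * (M * y k) :=
          Summable.tsum_finsetSum fun _ _ => ENNReal.summable
      _ = M ^ 2 * ∑ k ∈ S, y k := by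
          simp_rw [ENNReal.tsum_mul_right, hMk]
          rw [Finset.mul_sum]
          exact Finset.sum_congr rfl fun k _ => by ring
  calc ‖∑ k ∈ S, ∑ l ∈ S, inner ℂ (∫ s, w k s) (∫ s, w l s)‖ₑ
      ≤ ∑ k ∈ S, ∑ l ∈ S, ‖inner ℂ (∫ s, w k s) (∫ s, w l s)‖ₑ :=
        (enorm_sum_le _ _).trans (Finset.sum_le_sum fun k _ => enorm_sum_le _ _)
    _ ≤ ∑ k ∈ S, ∑ l ∈ S, ∑' j : ℤ, CB * (u (k - j) * u (l - j) * (x k * x l)) := by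
        refine Finset.sum_le_sum fun k hk => Finset.sum_le_sum fun l hl => ?_
        exact (enorm_inner_integral_le hX.σ_pos (hw k hk) (hw l hl)).trans
          (ENNReal.tsum_le_tsum (hpair k hk l hl))
    _ = CB * ∑' j : ℤ, ∑ k ∈ S, ∑ l ∈ S, u (k - j) * u (l - j) * (x k * x l) := by
        simp_rw [ENNReal.tsum_mul_left, ← Finset.mul_sum]
        congr 1
        rw [Summable.tsum_finsetSum fun _ _ => ENNReal.summable]
        refine Finset.sum_congr rfl fun k _ => ?_
        rw [Summable.tsum_finsetSum fun _ _ => ENNReal.summable]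
    _ ≤ CB * ∑' j : ℤ, (∑ k ∈ S, ∑ l ∈ S, u (k - j) * u (l - j) * x k ^ 2
          + ∑ k ∈ S, ∑ l ∈ S, u (k - j) * u (l - j) * x k ^ 2) := by
        gcongr with j
        have hswap : ∑ k ∈ S, ∑ l ∈ S, u (k - j) * u (l - j) * x k ^ 2
            = ∑ k ∈ S, ∑ l ∈ S, u (k - j) * u (l - j) * x l ^ 2 := by
          rw [Finset.sum_comm]
          refine Finset.sum_congr rfl fun k _ => Finset.sum_congr rfl fun l _ => by ring
        nth_rewrite 2 [hswap]
        simp_rw [← Finset.sum_add_distrib, ← mul_add]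
        gcongr
        exact hprod _ _
    _ ≤ CB * (M ^ 2 * ∑ k ∈ S, x k ^ 2 + M ^ 2 * ∑ k ∈ S, x k ^ 2) := by
        rw [ENNReal.tsum_add]
        gcongr <;> exact hhalf fun k => x k ^ 2
    _ = _ := by ring

end Atoms

/-! ### The Fourier transform on `L¹ ∩ L²` -/

section Fourier

variable {d : ℕ}

theorem integral_fourier_mul_eq_flip {f g : Space d → ℂ} (hf : Integrable f) (hg : Integrable g) :
    ∫ ξ, 𝓕 f ξ * g ξ = ∫ x, f x * 𝓕 g x := by
  have h := VectorFourier.integral_fourierIntegral_smul_eq_flip (L := innerₗ (Space d)) (μ := volume)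
    (ν := volume) Real.continuous_fourierChar continuous_inner hf hg
  simp only [smul_eq_mul, flip_innerₗ] at h
  exact h

theorem continuous_fourier {f : Space d → ℂ} (hf : Integrable f) : Continuous (𝓕 f) :=
  VectorFourier.fourierIntegral_continuous Real.continuous_fourierChar continuous_inner hf

theorem norm_fourier_le (f : Space d → ℂ) (ξ : Space d) : ‖𝓕 f ξ‖ ≤ ∫ x, ‖f x‖ :=
  VectorFourier.norm_fourierIntegral_le_integral_norm _ _ _ _ _

theorem norm_fourierInv_le (f : Space d → ℂ) (x : Space d) : ‖𝓕⁻ f x‖ ≤ ∫ ξ, ‖f ξ‖ := by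
  rw [Real.fourierInv_eq_fourier_neg]
  exact norm_fourier_le f _

/-- The Fourier transform on `L²` is given by the Fourier integral on `L¹ ∩ L²`: both define the same
tempered distribution. -/
theorem coeFn_fourier_toLp {g : Space d → ℂ} (h1 : Integrable g) (h2 : MemLp g 2 volume) :
    ⇑(𝓕 (h2.toLp g : L2 d) : L2 d) =ᵐ[volume] 𝓕 g := by
  refine ae_eq_of_integral_contDiff_smul_eq
    ((Lp.memLp (𝓕 (h2.toLp g : L2 d) : L2 d)).locallyIntegrable (by norm_num))
    (continuous_fourier h1).locallyIntegrable fun χ hχ hχc => ?_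
  have hg₁ : HasCompactSupport (Complex.ofRealCLM ∘ χ) := hχc.comp_left rfl
  have hg₂ : ContDiff ℝ (⊤ : ℕ∞) (Complex.ofRealCLM ∘ χ) := by fun_prop
  set θ : 𝓢(Space d, ℂ) := hg₁.toSchwartzMap hg₂ with hθ
  have hθa : ∀ x, θ x = (χ x : ℂ) := fun x => by simp [hθ]
  have h3 := congrArg (fun T : 𝓢'(Space d, ℂ) => T θ)
    (Lp.fourier_toTemperedDistribution_eq (h2.toLp g : L2 d))
  simp only [TemperedDistribution.fourier_apply, Lp.toTemperedDistribution_apply] at h3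
  calc ∫ x, χ x • (𝓕 (h2.toLp g : L2 d) : L2 d) x
      = ∫ x, θ x • (𝓕 (h2.toLp g : L2 d) : L2 d) x := by simp [hθa]
    _ = ∫ x, (𝓕 θ) x • (h2.toLp g : L2 d) x := h3.symm
    _ = ∫ x, 𝓕 (⇑θ) x * g x := by
        refine integral_congr_ae ?_
        filter_upwards [h2.coeFn_toLp] with x hx
        rw [hx, smul_eq_mul, SchwartzMap.fourier_coe]
    _ = ∫ x, θ x * 𝓕 g x := integral_fourier_mul_eq_flip θ.integrable h1
    _ = ∫ x, χ x • 𝓕 g x := by simp [hθa]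

theorem coeFn_fourierInv_toLp {g : Space d → ℂ} (h1 : Integrable g) (h2 : MemLp g 2 volume) :
    ⇑(𝓕⁻ (h2.toLp g : L2 d) : L2 d) =ᵐ[volume] 𝓕⁻ g := by
  have hflip : ∀ {f h : Space d → ℂ}, Integrable f → Integrable h →
      ∫ ξ, 𝓕⁻ f ξ * h ξ = ∫ x, f x * 𝓕⁻ h x := by
    intro f h hf hh
    rw [Real.fourierInv_eq_fourier_comp_neg, Real.fourierInv_eq_fourier_comp_neg,
      integral_fourier_mul_eq_flip hf.comp_neg hh, ← integral_neg_eq_self]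
    refine integral_congr_ae (Filter.Eventually.of_forall fun x => ?_)
    simp only [neg_neg]
    rw [← Real.fourierInv_eq_fourier_comp_neg, Real.fourierInv_eq_fourier_neg]
  have hcont : Continuous (𝓕⁻ g) := by
    rw [Real.fourierInv_eq_fourier_comp_neg]
    exact continuous_fourier h1.comp_neg
  refine ae_eq_of_integral_contDiff_smul_eq
    ((Lp.memLp (𝓕⁻ (h2.toLp g : L2 d) : L2 d)).locallyIntegrable (by norm_num))
    hcont.locallyIntegrable fun χ hχ hχc => ?_
  have hg₁ : HasCompactSupport (Complex.ofRealCLM ∘ χ) := hχc.comp_left rfl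
  have hg₂ : ContDiff ℝ (⊤ : ℕ∞) (Complex.ofRealCLM ∘ χ) := by fun_prop
  set θ : 𝓢(Space d, ℂ) := hg₁.toSchwartzMap hg₂ with hθ
  have hθa : ∀ x, θ x = (χ x : ℂ) := fun x => by simp [hθ]
  have h3 := congrArg (fun T : 𝓢'(Space d, ℂ) => T θ)
    (Lp.fourierInv_toTemperedDistribution_eq (h2.toLp g : L2 d))
  simp only [TemperedDistribution.fourierInv_apply, Lp.toTemperedDistribution_apply] at h3
  calc ∫ x, χ x • (𝓕⁻ (h2.toLp g : L2 d) : L2 d) x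
      = ∫ x, θ x • (𝓕⁻ (h2.toLp g : L2 d) : L2 d) x := by simp [hθa]
    _ = ∫ x, (𝓕⁻ θ) x • (h2.toLp g : L2 d) x := h3.symm
    _ = ∫ x, 𝓕⁻ (⇑θ) x * g x := by
        refine integral_congr_ae ?_
        filter_upwards [h2.coeFn_toLp] with x hx
        rw [hx, smul_eq_mul, SchwartzMap.fourierInv_coe]
    _ = ∫ x, θ x * 𝓕⁻ g x := hflip θ.integrable h1
    _ = ∫ x, χ x • 𝓕⁻ g x := by simp [hθa]

theorem memLp_fourier {g : Space d → ℂ} (h1 : Integrable g) (h2 : MemLp g 2 volume) :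
    MemLp (𝓕 g) 2 volume :=
  (memLp_congr_ae (coeFn_fourier_toLp h1 h2)).1 (Lp.memLp _)

/-- Plancherel's theorem for `L¹ ∩ L²`. -/
theorem eLpNorm_fourier_eq {g : Space d → ℂ} (h1 : Integrable g) (h2 : MemLp g 2 volume) :
    eLpNorm (𝓕 g) 2 volume = eLpNorm g 2 volume := by
  rw [← eLpNorm_congr_ae (coeFn_fourier_toLp h1 h2), ← Lp.enorm_def, ← ofReal_norm,
    Lp.norm_fourier_eq, ofReal_norm, Lp.enorm_def, eLpNorm_congr_ae h2.coeFn_toLp]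

/-! ### The Schrödinger symbol and the dispersive estimate -/

theorem schrodingerSymbol_eq (t : ℝ) (ξ : Space d) :
    schrodingerSymbol t ξ = Complex.exp (((-(t * (4 * Real.pi ^ 2 * ‖ξ‖ ^ 2)) : ℝ) : ℂ) * Complex.I) := by
  rw [schrodingerSymbol]
  congr 1
  push_cast
  ring

theorem norm_schrodingerSymbol (t : ℝ) (ξ : Space d) : ‖schrodingerSymbol t ξ‖ = 1 := by
  rw [schrodingerSymbol_eq, Complex.norm_exp_ofReal_mul_I]

theorem continuous_schrodingerSymbol :
    Continuous fun z : ℝ × Space d => schrodingerSymbol z.1 z.2 := by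
  unfold schrodingerSymbol
  fun_prop

theorem conj_schrodingerSymbol (t : ℝ) (ξ : Space d) :
    (starRingEnd ℂ) (schrodingerSymbol t ξ) = schrodingerSymbol (-t) ξ := by
  rw [schrodingerSymbol_eq, schrodingerSymbol_eq, ← Complex.exp_conj, map_mul, Complex.conj_I,
    Complex.conj_ofReal]
  congr 1
  push_cast
  ring

theorem schrodingerSymbol_add (s t : ℝ) (ξ : Space d) :
    schrodingerSymbol (s + t) ξ = schrodingerSymbol s ξ * schrodingerSymbol t ξ := by
  rw [schrodingerSymbol, schrodingerSymbol, schrodingerSymbol, ← Complex.exp_add]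
  congr 1
  push_cast
  ring

theorem conj_fourier (f : Space d → ℂ) (ξ : Space d) :
    (starRingEnd ℂ) (𝓕 f ξ) = 𝓕 (fun x => (starRingEnd ℂ) (f (-x))) ξ := by
  have h : 𝓕 (fun x => (starRingEnd ℂ) (f (-x))) ξ = 𝓕⁻ (fun x => (starRingEnd ℂ) (f x)) ξ := by
    rw [Real.fourierInv_eq_fourier_comp_neg]
  rw [h, Real.fourier_eq', Real.fourierInv_eq', ← integral_conj]
  refine integral_congr_ae (Filter.Eventually.of_forall fun x => ?_)
  simp only [smul_eq_mul, map_mul, ← Complex.exp_conj, Complex.conj_I, Complex.conj_ofReal]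
  congr 2
  push_cast
  ring

/-- The Fourier transform of a complex gaussian, bounded uniformly in the regularisation `ε > 0`. -/
theorem norm_gaussian_fourier_le {ε τ : ℝ} (hε : 0 < ε) (hτ : τ ≠ 0) (y w : Space d) :
    ‖𝓕 (fun v : Space d => Complex.exp (-((ε : ℂ) + 4 * Real.pi ^ 2 * τ * Complex.I) * ‖v‖ ^ 2
        + 2 * Real.pi * Complex.I * (inner ℝ y v : ℝ))) w‖
      ≤ (4 * Real.pi * |τ|) ^ (-((d : ℝ) / 2)) := by
  set b : ℂ := (ε : ℂ) + 4 * Real.pi ^ 2 * τ * Complex.I with hb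
  have hbre : b.re = ε := by
    have : b = (ε : ℂ) + ((4 * Real.pi ^ 2 * τ : ℝ) : ℂ) * Complex.I := by rw [hb]; push_cast; ring
    rw [this]
    simp only [Complex.add_re, Complex.ofReal_re, Complex.re_ofReal_mul, Complex.I_re, mul_zero,
      add_zero]
  have hbim : b.im = 4 * Real.pi ^ 2 * τ := by
    have : b = (ε : ℂ) + ((4 * Real.pi ^ 2 * τ : ℝ) : ℂ) * Complex.I := by rw [hb]; push_cast; ring
    rw [this]
    simp only [Complex.add_im, Complex.ofReal_im, Complex.im_ofReal_mul, Complex.I_im, mul_one,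
      zero_add]
  have hbpos : 0 < b.re := hbre ▸ hε
  have hπ := Real.pi_pos
  rw [fourier_gaussian_innerProductSpace' hbpos, norm_mul]
  have hexp : ‖Complex.exp (-Real.pi ^ 2 * ‖y - w‖ ^ 2 / b)‖ ≤ 1 := by
    rw [Complex.norm_exp, Real.exp_le_one_iff]
    have : (-Real.pi ^ 2 * ‖y - w‖ ^ 2 / b : ℂ) = ((-(Real.pi ^ 2 * ‖y - w‖ ^ 2) : ℝ) : ℂ) * b⁻¹ := by
      push_cast; ring
    rw [this, Complex.re_ofReal_mul, Complex.inv_re]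
    have : 0 ≤ b.re / Complex.normSq b := div_nonneg hbpos.le (Complex.normSq_nonneg _)
    nlinarith [mul_nonneg (sq_nonneg Real.pi) (sq_nonneg ‖y - w‖)]
  have hpow : ‖((Real.pi : ℂ) / b) ^ ((Module.finrank ℝ (Space d) : ℂ) / 2)‖
      ≤ (4 * Real.pi * |τ|) ^ (-((d : ℝ) / 2)) := by
    have e : ((Module.finrank ℝ (Space d) : ℂ) / 2) = (((d : ℝ) / 2 : ℝ) : ℂ) := by
      simp
    have hτ' : 0 < |τ| := abs_pos.2 hτ
    rw [e, Complex.norm_cpow_real, Real.rpow_neg (by positivity), ← Real.inv_rpow (by positivity)]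
    refine Real.rpow_le_rpow (norm_nonneg _) ?_ (by positivity)
    have h1 : 4 * Real.pi ^ 2 * |τ| ≤ ‖b‖ := by
      have := Complex.abs_im_le_norm b
      rwa [hbim, abs_mul, abs_of_pos (by positivity : 0 < 4 * Real.pi ^ 2)] at this
    rw [norm_div, Complex.norm_real, Real.norm_eq_abs, abs_of_pos hπ, inv_eq_one_div,
      div_le_div_iff₀ (lt_of_lt_of_le (by positivity) h1) (by positivity)]
    nlinarith
  calc _ ≤ (4 * Real.pi * |τ|) ^ (-((d : ℝ) / 2)) * 1 :=
        mul_le_mul hpow hexp (norm_nonneg _) (by positivity)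
    _ = _ := mul_one _

/-- The dispersive estimate with a gaussian regularisation, which makes Fubini's theorem applicable. -/
theorem norm_integral_gaussian_mul_le {ε τ : ℝ} (hε : 0 < ε) (hτ : τ ≠ 0) {f h : Space d → ℂ}
    (hf : Integrable f) (hh : Integrable h) :
    ‖∫ ξ, 𝓕 h ξ * (𝓕 f ξ *
        Complex.exp (-((ε : ℂ) + 4 * Real.pi ^ 2 * τ * Complex.I) * ‖ξ‖ ^ 2))‖
      ≤ (4 * Real.pi * |τ|) ^ (-((d : ℝ) / 2)) * (∫ x, ‖f x‖) * ∫ x, ‖h x‖ := by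
  set b : ℂ := (ε : ℂ) + 4 * Real.pi ^ 2 * τ * Complex.I with hb
  set B : ℝ := (4 * Real.pi * |τ|) ^ (-((d : ℝ) / 2)) with hB
  have hB0 : 0 ≤ B := by positivity
  have hbre : 0 < b.re := by
    have : b = (ε : ℂ) + ((4 * Real.pi ^ 2 * τ : ℝ) : ℂ) * Complex.I := by rw [hb]; push_cast; ring
    rw [this]
    simpa only [Complex.add_re, Complex.ofReal_re, Complex.re_ofReal_mul, Complex.I_re, mul_zero,
      add_zero] using hε
  have hG : ∀ y : Space d, Integrable fun ξ : Space d =>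
      Complex.exp (-b * ‖ξ‖ ^ 2 + 2 * Real.pi * Complex.I * (inner ℝ y ξ : ℝ)) := fun y =>
    GaussianFourier.integrable_cexp_neg_mul_sq_norm_add hbre (2 * Real.pi * Complex.I) y
  have hG0 : Integrable fun ξ : Space d => Complex.exp (-b * ‖ξ‖ ^ 2) := by
    simpa using hG 0
  have hfG : Integrable fun ξ => 𝓕 f ξ * Complex.exp (-b * ‖ξ‖ ^ 2) :=
    hG0.bdd_mul (continuous_fourier hf).aestronglyMeasurable
      (Filter.Eventually.of_forall (norm_fourier_le f))
  have hbound : ∀ y, ‖𝓕 (fun ξ => 𝓕 f ξ * Complex.exp (-b * ‖ξ‖ ^ 2)) y‖ ≤ B * ∫ x, ‖f x‖ := by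
    intro y
    have h1 : 𝓕 (fun ξ => 𝓕 f ξ * Complex.exp (-b * ‖ξ‖ ^ 2)) y
        = ∫ ξ, 𝓕 f ξ * Complex.exp (-b * ‖ξ‖ ^ 2 + 2 * Real.pi * Complex.I * (inner ℝ (-y) ξ : ℝ)) := by
      rw [Real.fourier_eq']
      refine integral_congr_ae (Filter.Eventually.of_forall fun ξ => ?_)
      simp only [smul_eq_mul, inner_neg_left, real_inner_comm y ξ]
      rw [mul_left_comm, ← Complex.exp_add]
      congr 2
      push_cast
      ring
    rw [h1, integral_fourier_mul_eq_flip hf (hG (-y)), mul_comm B, ← integral_mul_const]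
    refine norm_integral_le_of_norm_le (hf.norm.mul_const _)
      (Filter.Eventually.of_forall fun x => ?_)
    rw [norm_mul]
    exact mul_le_mul_of_nonneg_left (norm_gaussian_fourier_le hε hτ (-y) x) (norm_nonneg _)
  rw [integral_fourier_mul_eq_flip hh hfG, mul_comm (B * _), ← integral_mul_const]
  refine norm_integral_le_of_norm_le (hh.norm.mul_const _)
    (Filter.Eventually.of_forall fun x => ?_)
  rw [norm_mul]
  exact mul_le_mul_of_nonneg_left (hbound x) (norm_nonneg _)

/-- The dispersive estimate `‖e^{iτΔ}‖_{L¹ → L^∞} ≤ (4π|τ|)^{-d/2}` in bilinear form. -/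
theorem norm_integral_schrodingerSymbol_mul_le {τ : ℝ} (hτ : τ ≠ 0) {f h : Space d → ℂ}
    (hf : Integrable f) (hf2 : MemLp f 2 volume) (hh : Integrable h) (hh2 : MemLp h 2 volume) :
    ‖∫ ξ, 𝓕 h ξ * ((starRingEnd ℂ) (𝓕 f ξ) * schrodingerSymbol τ ξ)‖
      ≤ (4 * Real.pi * |τ|) ^ (-((d : ℝ) / 2)) * (∫ x, ‖f x‖) * ∫ x, ‖h x‖ := by
  set f' : Space d → ℂ := fun x => (starRingEnd ℂ) (f (-x)) with hf'
  have hf'1 : Integrable f' :=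
    (LinearIsometryEquiv.integrable_comp_iff (Complex.conjLIE)).2 hf.comp_neg
  have hf'n : ∫ x, ‖f' x‖ = ∫ x, ‖f x‖ := by
    simp only [hf', RCLike.norm_conj]
    exact integral_neg_eq_self (fun x => ‖f x‖) volume
  have hint : Integrable fun ξ => 𝓕 h ξ * (starRingEnd ℂ) (𝓕 f ξ) := by
    have := (memLp_fourier hf hf2).star
    exact MemLp.integrable_mul (memLp_fourier hh hh2) this
  have hexp : ∀ (ε : ℝ) (ξ : Space d),
      Complex.exp (-((ε : ℂ) + 4 * Real.pi ^ 2 * τ * Complex.I) * ‖ξ‖ ^ 2)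
        = (Real.exp (-ε * ‖ξ‖ ^ 2) : ℂ) * schrodingerSymbol τ ξ := by
    intro ε ξ
    rw [schrodingerSymbol, Complex.ofReal_exp, ← Complex.exp_add]
    congr 1
    push_cast
    ring
  have hlim : Filter.Tendsto (fun ε : ℝ => ∫ ξ, 𝓕 h ξ * (𝓕 f' ξ *
        Complex.exp (-((ε : ℂ) + 4 * Real.pi ^ 2 * τ * Complex.I) * ‖ξ‖ ^ 2)))
      (nhdsWithin 0 (Set.Ioi 0))
      (nhds (∫ ξ, 𝓕 h ξ * ((starRingEnd ℂ) (𝓕 f ξ) * schrodingerSymbol τ ξ))) := by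
    refine tendsto_integral_filter_of_dominated_convergence
      (fun ξ => ‖𝓕 h ξ * (starRingEnd ℂ) (𝓕 f ξ)‖) ?_ ?_ hint.norm ?_
    · refine Filter.Eventually.of_forall fun ε => ?_
      have h1 := continuous_fourier hh
      have h2 := continuous_fourier hf'1
      exact Continuous.aestronglyMeasurable (by fun_prop)
    · filter_upwards [self_mem_nhdsWithin] with ε hε
      refine Filter.Eventually.of_forall fun ξ => ?_
      rw [← conj_fourier, hexp, ← mul_assoc, norm_mul, norm_mul _ (schrodingerSymbol τ ξ),
        norm_schrodingerSymbol, mul_one]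
      refine mul_le_of_le_one_right (norm_nonneg _) ?_
      rw [Complex.norm_real, Real.norm_eq_abs, Real.abs_exp, Real.exp_le_one_iff]
      have : 0 < ε := hε
      nlinarith [sq_nonneg ‖ξ‖]
    · refine Filter.Eventually.of_forall fun ξ => ?_
      refine Filter.Tendsto.mono_left ?_ nhdsWithin_le_nhds
      have hc : Continuous fun ε : ℝ => 𝓕 h ξ * (𝓕 f' ξ *
        Complex.exp (-((ε : ℂ) + 4 * Real.pi ^ 2 * τ * Complex.I) * ‖ξ‖ ^ 2)) := by fun_prop
      convert hc.tendsto 0 using 2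
      rw [hexp, conj_fourier]
      simp [hf']
  refine le_of_tendsto hlim.norm ?_
  filter_upwards [self_mem_nhdsWithin] with ε hε
  exact (norm_integral_gaussian_mul_le hε hτ hf'1 hh).trans (by rw [hf'n])

/-! ### The Schrödinger evolution of functions with integrable Fourier transform -/

/-- The function `e^{itΔ} 𝓕⁻ g`, evaluated pointwise; meaningful for integrable `g`. -/
noncomputable def evolution (g : Space d → ℂ) (t : ℝ) (x : Space d) : ℂ :=
  𝓕⁻ (fun ξ => schrodingerSymbol t ξ * g ξ) x

theorem evolution_eq (g : Space d → ℂ) (t : ℝ) (x : Space d) :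
    evolution g t x = ∫ ξ, Complex.exp ((↑(2 * Real.pi * inner ℝ ξ x) * Complex.I)) *
      (schrodingerSymbol t ξ * g ξ) := by
  rw [evolution, Real.fourierInv_eq']
  simp only [smul_eq_mul]

theorem integrable_schrodingerSymbol_mul {g : Space d → ℂ} (hg : Integrable g) (t : ℝ) :
    Integrable fun ξ => schrodingerSymbol t ξ * g ξ :=
  hg.bdd_mul (c := 1) (continuous_schrodingerSymbol.comp
    (Continuous.prodMk_right t)).aestronglyMeasurable
    (Filter.Eventually.of_forall fun ξ => (norm_schrodingerSymbol t ξ).le)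

theorem memLp_schrodingerSymbol_mul {g : Space d → ℂ} (hg : MemLp g 2 volume) (t : ℝ) :
    MemLp (fun ξ => schrodingerSymbol t ξ * g ξ) 2 volume := by
  refine hg.of_le ((continuous_schrodingerSymbol.comp
    (Continuous.prodMk_right t)).aestronglyMeasurable.mul hg.1)
    (Filter.Eventually.of_forall fun ξ => ?_)
  rw [norm_mul, norm_schrodingerSymbol, one_mul]

theorem continuous_evolution {g : Space d → ℂ} (hg : Integrable g) :
    Continuous fun z : ℝ × Space d => evolution g z.1 z.2 := by
  simp_rw [evolution_eq]
  refine continuous_of_dominated (bound := fun ξ => ‖g ξ‖) (fun z => ?_) (fun z => ?_) hg.norm ?_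
  · exact (Continuous.aestronglyMeasurable (by fun_prop)).mul
      (integrable_schrodingerSymbol_mul hg z.1).1
  · refine Filter.Eventually.of_forall fun ξ => ?_
    rw [norm_mul, norm_mul, norm_schrodingerSymbol, Complex.norm_exp_ofReal_mul_I, one_mul, one_mul]
  · refine Filter.Eventually.of_forall fun ξ => ?_
    have : Continuous fun z : ℝ × Space d => schrodingerSymbol z.1 ξ :=
      continuous_schrodingerSymbol.comp (continuous_fst.prodMk continuous_const)
    fun_prop

theorem enorm_evolution_le (g : Space d → ℂ) (t : ℝ) (x : Space d) :
    ‖evolution g t x‖ₑ ≤ ENNReal.ofReal (∫ ξ, ‖g ξ‖) := by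
  rw [← ofReal_norm]
  refine ENNReal.ofReal_le_ofReal ((norm_fourierInv_le _ _).trans (le_of_eq ?_))
  simp_rw [norm_mul, norm_schrodingerSymbol, one_mul]

/-- A Fourier multiplier acts on the Fourier side by multiplication with its symbol. -/
theorem coeFn_fourier_fourierMultiplier {m : Space d → ℂ} (hm : MemLp m ∞ volume) (f : L2 d) :
    ⇑(𝓕 (fourierMultiplier m hm f) : L2 d) =ᵐ[volume] fun ξ => m ξ * (𝓕 f : L2 d) ξ := by
  rw [fourierMultiplier, FourierTransform.fourier_fourierInv_eq]
  exact MemLp.coeFn_toLp _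

theorem coeFn_fourierMultiplier {m : Space d → ℂ} (hm : MemLp m ∞ volume) {f : L2 d}
    {g : Space d → ℂ} (hfg : ⇑(𝓕 f : L2 d) =ᵐ[volume] g)
    (hmg : Integrable fun ξ => m ξ * g ξ) :
    ⇑(fourierMultiplier m hm f) =ᵐ[volume] 𝓕⁻ (fun ξ => m ξ * g ξ) := by
  have hae : m • ⇑(𝓕 f : L2 d) =ᵐ[volume] fun ξ => m ξ * g ξ := by
    filter_upwards [hfg] with ξ hξ
    simp [hξ]
  have h2 : MemLp (fun ξ => m ξ * g ξ) 2 volume :=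
    (memLp_congr_ae hae).1 ((Lp.memLp (𝓕 f : L2 d)).smul (r := 2) hm)
  rw [fourierMultiplier, (MemLp.toLp_eq_toLp_iff _ h2).2 hae]
  exact coeFn_fourierInv_toLp hmg h2

/-- When `𝓕 f` is integrable, `S(t) f` is represented by a jointly continuous function. -/
theorem coeFn_schrodinger {f : L2 d} {g : Space d → ℂ} (hfg : ⇑(𝓕 f : L2 d) =ᵐ[volume] g)
    (hg : Integrable g) (t : ℝ) : ⇑(schrodinger t f) =ᵐ[volume] evolution g t :=
  coeFn_fourierMultiplier _ hfg (integrable_schrodingerSymbol_mul hg t)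

theorem eLpNorm_evolution_two {g : Space d → ℂ} (hg : Integrable g) (hg2 : MemLp g 2 volume)
    (t : ℝ) : eLpNorm (evolution g t) 2 volume = eLpNorm g 2 volume := by
  have h1 := integrable_schrodingerSymbol_mul hg t
  have h2 := memLp_schrodingerSymbol_mul hg2 t
  have h3 : evolution g t = 𝓕⁻ (fun ξ => schrodingerSymbol t ξ * g ξ) := rfl
  have h4 : ‖(𝓕⁻ (h2.toLp _ : L2 d) : L2 d)‖ = ‖(h2.toLp _ : L2 d)‖ := by
    rw [← Lp.norm_fourier_eq, FourierTransform.fourier_fourierInv_eq]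
  rw [h3, ← eLpNorm_congr_ae (coeFn_fourierInv_toLp h1 h2), ← Lp.enorm_def, ← ofReal_norm, h4,
    ofReal_norm, Lp.enorm_def, eLpNorm_congr_ae h2.coeFn_toLp]
  refine eLpNorm_congr_norm_ae (Filter.Eventually.of_forall fun ξ => ?_)
  rw [norm_mul, norm_schrodingerSymbol, one_mul]

end Fourier

/-! ### Weak measurability -/

/-- A weakly measurable map into a separable Hilbert space is strongly measurable: closed balls are
countable intersections of the sets `{v | ‖⟪e, v - y⟫‖ ≤ r ‖e‖}`. -/
theorem stronglyMeasurable_of_measurable_inner {α H : Type*} [MeasurableSpace α]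
    [NormedAddCommGroup H] [InnerProductSpace ℂ H] [SecondCountableTopology H] {f : α → H}
    (hf : ∀ v : H, Measurable fun s => inner ℂ v (f s)) : StronglyMeasurable f := by
  borelize H
  have hclosed : ∀ (y : H) (r : ℝ), MeasurableSet (f ⁻¹' Metric.closedBall y r) := by
    intro y r
    rcases lt_or_ge r 0 with hr | hr
    · simp [Metric.closedBall_eq_empty.2 hr]
    have : f ⁻¹' Metric.closedBall y r
        = ⋂ n : ℕ, {s | ‖inner ℂ (TopologicalSpace.denseSeq H n) (f s)
            - inner ℂ (TopologicalSpace.denseSeq H n) y‖ ≤ r * ‖TopologicalSpace.denseSeq H n‖} := by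
      ext s
      simp only [Set.mem_preimage, mem_closedBall_iff_norm, Set.mem_iInter, Set.mem_ofPred_eq,
        ← inner_sub_right]
      constructor
      · intro h n
        rw [mul_comm]
        exact (norm_inner_le_norm _ _).trans (mul_le_mul_of_nonneg_left h (norm_nonneg _))
      · intro h
        have hall : ∀ e : H, ‖inner ℂ e (f s - y)‖ ≤ r * ‖e‖ := by
          intro e
          have hcl : IsClosed {e : H | ‖inner ℂ e (f s - y)‖ ≤ r * ‖e‖} :=
            isClosed_le (by fun_prop) (by fun_prop)
          refine hcl.closure_subset_iff.2 ?_ ((TopologicalSpace.denseRange_denseSeq H) e)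
          rintro _ ⟨n, rfl⟩
          exact h n
        have h0 := hall (f s - y)
        rw [inner_self_eq_norm_sq_to_K, norm_pow, RCLike.norm_ofReal, abs_norm] at h0
        rcases (norm_nonneg (f s - y)).eq_or_lt with h1 | h1
        · rwa [← h1]
        · nlinarith
    rw [this]
    refine MeasurableSet.iInter fun n => measurableSet_le ?_ measurable_const
    exact ((hf _).sub_const _).norm
  have hball : ∀ (y : H) (r : ℝ), MeasurableSet (f ⁻¹' Metric.ball y r) := by
    intro y r
    have : Metric.ball y r = ⋃ n : ℕ, Metric.closedBall y (r - 1 / (n + 1)) := by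
      ext v
      simp only [Metric.mem_ball, Set.mem_iUnion, Metric.mem_closedBall]
      constructor
      · intro h
        obtain ⟨n, hn⟩ := exists_nat_one_div_lt (sub_pos.2 h)
        exact ⟨n, by linarith⟩
      · rintro ⟨n, hn⟩
        have : (0 : ℝ) < 1 / (n + 1) := by positivity
        linarith
    rw [this, Set.preimage_iUnion]
    exact MeasurableSet.iUnion fun n => hclosed _ _
  refine (measurable_of_isOpen fun U hU => ?_).stronglyMeasurable
  have hr : ∀ x : U, ∃ r > 0, Metric.ball (x : H) r ⊆ U := fun x => Metric.isOpen_iff.1 hU x x.2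
  choose r hr0 hrU using hr
  obtain ⟨T, hTc, hT⟩ := TopologicalSpace.isOpen_iUnion_countable
    (fun x : U => Metric.ball (x : H) (r x)) fun _ => Metric.isOpen_ball
  have hUeq : U = ⋃ x ∈ T, Metric.ball (x : H) (r x) := by
    rw [hT]
    refine Set.Subset.antisymm (fun x hx => ?_) (Set.iUnion_subset hrU)
    exact Set.mem_iUnion.2 ⟨⟨x, hx⟩, Metric.mem_ball_self (hr0 _)⟩
  rw [hUeq, Set.preimage_iUnion₂]
  exact MeasurableSet.biUnion hTc fun x _ => hball _ _

/-! ### Atomic decomposition -/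

section AtomicDecomposition

variable {α : Type*} [MeasurableSpace α] {μ : Measure α} {H : α → ℝ≥0∞}

/-- The set on which `H` lies between its rearrangements at `2 ^ (k + 1)` and at `2 ^ k`. -/
def levelSet (μ : Measure α) (H : α → ℝ≥0∞) (k : ℤ) : Set α :=
  {x | dyadicLevel μ H (k + 1) < H x ∧ H x ≤ dyadicLevel μ H k}

/-- For a function `G` with `H = |G| ^ s`, the size of the atom of `G` at scale `2 ^ k`. -/
noncomputable def atomProfile (s : ℝ) (μ : Measure α) (H : α → ℝ≥0∞) (k : ℤ) : ℝ≥0∞ :=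
  2 * (2 ^ k * dyadicLevel μ H k) ^ (1 / s)

theorem measurableSet_levelSet (hH : Measurable H) (k : ℤ) : MeasurableSet (levelSet μ H k) :=
  (measurableSet_lt measurable_const hH).inter (measurableSet_le hH measurable_const)

theorem measure_levelSet_le (k : ℤ) : μ (levelSet μ H k) ≤ 𝟚^((k : ℝ) + 1) := by
  refine (measure_mono fun x hx => hx.1).trans ((measure_dyadicLevel_lt (k + 1)).trans ?_)
  rw [← ENNReal.rpow_intCast]
  push_cast
  exact le_rfl

/-- The level sets exhaust the set where `H` does not vanish: `k` is the greatest index with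
`H x ≤ dyadicLevel μ H k`. -/
theorem ae_exists_mem_levelSet [SFinite μ] (hH : Measurable H) (hint : ∫⁻ x, H x ∂μ ≠ ⊤) :
    ∀ᵐ x ∂μ, H x ≠ 0 → ∃ k, x ∈ levelSet μ H k := by
  filter_upwards [ae_exists_le_dyadicLevel (μ := μ) (H := H)] with x ⟨K₁, h₁⟩ hx
  obtain ⟨K₂, h₂⟩ := exists_dyadicLevel_lt hH hint hx
  obtain ⟨k, hk, hmax⟩ := Int.exists_greatest_of_bdd (P := fun k => H x ≤ dyadicLevel μ H k)
    ⟨K₂, fun z hz => by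
      by_contra! h
      exact absurd (hz.trans (dyadicLevel_antitone h.le)) (not_le.2 h₂)⟩ ⟨_, h₁⟩
  refine ⟨k, ?_, hk⟩
  by_contra! h
  exact absurd (hmax _ h) (by omega)

/-- The `ℓ^s` norm of the atom sizes is controlled by the `L^s` norm of `G`. -/
theorem tsum_atomProfile_rpow_le [SFinite μ] (hH : Measurable H) {s : ℝ} (hs : 0 < s) :
    ∑' k : ℤ, atomProfile s μ H k ^ s ≤ 2 ^ s * (2 * ∫⁻ x, H x ∂μ) := by
  have : ∀ k : ℤ, atomProfile s μ H k ^ s = 2 ^ s * (2 ^ k * dyadicLevel μ H k) := fun k => by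
    rw [atomProfile, ENNReal.mul_rpow_of_nonneg _ _ hs.le, ← ENNReal.rpow_mul,
      one_div_mul_cancel hs.ne', ENNReal.rpow_one]
  simp_rw [this]
  rw [ENNReal.tsum_mul_left]
  gcongr
  exact tsum_two_zpow_mul_dyadicLevel_le hH

theorem atomProfile_ne_top [SFinite μ] (hH : Measurable H) (hint : ∫⁻ x, H x ∂μ ≠ ⊤) {s : ℝ}
    (hs : 0 < s) (k : ℤ) : atomProfile s μ H k ≠ ⊤ := by
  refine ENNReal.mul_ne_top (by norm_num) (ENNReal.rpow_ne_top_of_nonneg (by positivity) ?_)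
  exact ne_top_of_le_ne_top (ENNReal.mul_ne_top (by norm_num) hint)
    ((ENNReal.le_tsum k).trans (tsum_two_zpow_mul_dyadicLevel_le hH))

theorem dyadicLevel_rpow_mul_le {s : ℝ} (hs : 0 < s) (k : ℤ) {e : ℝ} (he : e ≤ 1) :
    dyadicLevel μ H k ^ (1 / s) * (𝟚^((k : ℝ) + 1)) ^ e
      ≤ 𝟚^(k * (e - 1 / s)) * atomProfile s μ H k := by
  have h1 : atomProfile s μ H k = 2 * (𝟚^(k * (1 / s)) * dyadicLevel μ H k ^ (1 / s)) := by
    rw [atomProfile, ENNReal.mul_rpow_of_nonneg _ _ (by positivity), ← ENNReal.rpow_intCast,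
      ← ENNReal.rpow_mul]
  have h2 : (𝟚^((k : ℝ) + 1)) ^ e ≤ 𝟚^(k * e) * 2 := by
    rw [← ENNReal.rpow_mul, add_mul, two_rpow_add, one_mul]
    gcongr
    calc 𝟚^e ≤ 𝟚^1 := two_rpow_mono he
      _ = 2 := ENNReal.rpow_one 2
  have h3 : 𝟚^(k * e) = 𝟚^(k * (e - 1 / s)) * 𝟚^(k * (1 / s)) := by
    rw [← two_rpow_add]; congr 1; ring
  rw [h1]
  calc _ ≤ dyadicLevel μ H k ^ (1 / s) * (𝟚^(k * e) * 2) := by gcongr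
    _ = _ := by rw [h3]; ring

variable {E : Type*} [NormedAddCommGroup E] {G : α → E} {s : ℝ}

theorem enorm_indicator_levelSet_le (hs : 0 < s) (hGH : ∀ x, ‖G x‖ₑ ^ s = H x) (k : ℤ) (x : α) :
    ‖(levelSet μ H k).indicator G x‖ₑ
      ≤ (levelSet μ H k).indicator (fun _ => dyadicLevel μ H k ^ (1 / s)) x := by
  by_cases hx : x ∈ levelSet μ H k
  · rw [Set.indicator_of_mem hx, Set.indicator_of_mem hx]
    have := ENNReal.rpow_le_rpow hx.2 (show 0 ≤ 1 / s by positivity)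
    rwa [← hGH, ← ENNReal.rpow_mul, mul_one_div_cancel hs.ne', ENNReal.rpow_one] at this
  · simp [hx]

/-- The `L¹` norm of an atom; with `b = 1 - 1/s`, the size occurring in the dispersive bound. -/
theorem lintegral_enorm_indicator_levelSet_le (hs : 0 < s) (hH : Measurable H)
    (hGH : ∀ x, ‖G x‖ₑ ^ s = H x) (k : ℤ) :
    ∫⁻ x, ‖(levelSet μ H k).indicator G x‖ₑ ∂μ ≤ 𝟚^(k * (1 - 1 / s)) * atomProfile s μ H k := by
  calc ∫⁻ x, ‖(levelSet μ H k).indicator G x‖ₑ ∂μ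
      ≤ ∫⁻ x, (levelSet μ H k).indicator (fun _ => dyadicLevel μ H k ^ (1 / s)) x ∂μ :=
        lintegral_mono (enorm_indicator_levelSet_le hs hGH k)
    _ = dyadicLevel μ H k ^ (1 / s) * μ (levelSet μ H k) :=
        lintegral_indicator_const (measurableSet_levelSet hH k) _
    _ ≤ dyadicLevel μ H k ^ (1 / s) * (𝟚^((k : ℝ) + 1)) ^ (1 : ℝ) := by
        rw [ENNReal.rpow_one]
        gcongr
        exact measure_levelSet_le k
    _ ≤ _ := dyadicLevel_rpow_mul_le hs k le_rfl

/-- The `L²` norm of an atom; with `a = 1/s - 1/2`, the size occurring in the energy bound. -/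
theorem eLpNorm_two_indicator_levelSet_le (hs : 0 < s) (hH : Measurable H)
    (hGH : ∀ x, ‖G x‖ₑ ^ s = H x) (k : ℤ) :
    eLpNorm ((levelSet μ H k).indicator G) 2 μ
      ≤ 𝟚^(k * (1 / 2 - 1 / s)) * atomProfile s μ H k := by
  have hA := measurableSet_levelSet (μ := μ) hH k
  calc eLpNorm ((levelSet μ H k).indicator G) 2 μ
      ≤ eLpNorm ((levelSet μ H k).indicator (fun _ => dyadicLevel μ H k ^ (1 / s))) 2 μ :=
        eLpNorm_mono_enorm fun x => by
          simpa using enorm_indicator_levelSet_le hs hGH k x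
    _ = dyadicLevel μ H k ^ (1 / s) * μ (levelSet μ H k) ^ (1 / 2 : ℝ) := by
        rw [eLpNorm_indicator_const hA (by norm_num) (by norm_num)]
        simp
    _ ≤ dyadicLevel μ H k ^ (1 / s) * (𝟚^((k : ℝ) + 1)) ^ (1 / 2 : ℝ) := by
        gcongr
        exact measure_levelSet_le k
    _ ≤ _ := dyadicLevel_rpow_mul_le hs k (by norm_num)

end AtomicDecomposition

section Measurability

variable {α β : Type*} [MeasurableSpace α] [MeasurableSpace β] {μ : Measure α} [SFinite μ]

omit [SFinite μ] in
theorem lt_dyadicLevel_iff {H : α → ℝ≥0∞} {k : ℤ} {l : ℝ≥0∞} :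
    l < dyadicLevel μ H k ↔ 2 ^ k < μ {x | l < H x} := by
  refine ⟨lt_measure_of_lt_dyadicLevel, fun h => ?_⟩
  by_contra! hl
  exact absurd h (not_lt.2 ((measure_mono fun x hx => hl.trans_lt hx).trans
    (measure_dyadicLevel_lt k)))

theorem measurable_dyadicLevel {H : β → α → ℝ≥0∞} (hH : Measurable (Function.uncurry H)) (k : ℤ) :
    Measurable fun t => dyadicLevel μ (H t) k := by
  refine measurable_of_Ioi fun l => ?_
  have : (fun t => dyadicLevel μ (H t) k) ⁻¹' Set.Ioi l = {t | 2 ^ k < μ {x | l < H t x}} := by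
    ext t; exact lt_dyadicLevel_iff
  rw [this]
  refine measurableSet_lt measurable_const ?_
  have hs : MeasurableSet {z : β × α | l < H z.1 z.2} := measurableSet_lt measurable_const hH
  exact measurable_measure_prodMk_left hs

theorem measurable_atomProfile {H : β → α → ℝ≥0∞} (hH : Measurable (Function.uncurry H)) (s : ℝ)
    (k : ℤ) : Measurable fun t => atomProfile s μ (H t) k :=
  (((measurable_dyadicLevel hH k).const_mul _).pow_const _).const_mul _

theorem measurable_indicator_levelSet {H : β → α → ℝ≥0∞} (hH : Measurable (Function.uncurry H))
    {G : β → α → ℂ} (hG : Measurable (Function.uncurry G)) (k : ℤ) :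
    Measurable (Function.uncurry fun t => (levelSet μ (H t) k).indicator (G t)) := by
  have hA : MeasurableSet {z : β × α | z.2 ∈ levelSet μ (H z.1) k} :=
    (measurableSet_lt ((measurable_dyadicLevel hH (k + 1)).comp measurable_fst) hH).inter
      (measurableSet_le hH ((measurable_dyadicLevel hH k).comp measurable_fst))
  exact hG.indicator hA

end Measurability

/-! ### Dual waves -/

section DualWave

variable {d : ℕ}

/-- The Fourier transform of `e^{-isΔ} f`, as an element of `L²`. -/
noncomputable def dualWave (s : ℝ) (f : Space d → ℂ) (h1 : Integrable f) (h2 : MemLp f 2 volume) :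
    L2 d :=
  (memLp_schrodingerSymbol_mul (memLp_fourier h1 h2) (-s)).toLp _

theorem enorm_dualWave (s : ℝ) {f : Space d → ℂ} (h1 : Integrable f) (h2 : MemLp f 2 volume) :
    ‖dualWave s f h1 h2‖ₑ = eLpNorm f 2 volume := by
  rw [dualWave, Lp.enorm_toLp, ← eLpNorm_fourier_eq h1 h2]
  refine eLpNorm_congr_norm_ae (Filter.Eventually.of_forall fun ξ => ?_)
  rw [norm_mul, norm_schrodingerSymbol, one_mul]

theorem inner_dualWave_dualWave (s t : ℝ) {f h : Space d → ℂ} (f1 : Integrable f)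
    (f2 : MemLp f 2 volume) (h1 : Integrable h) (h2 : MemLp h 2 volume) :
    inner ℂ (dualWave s f f1 f2) (dualWave t h h1 h2)
      = ∫ ξ, 𝓕 h ξ * ((starRingEnd ℂ) (𝓕 f ξ) * schrodingerSymbol (s - t) ξ) := by
  rw [L2.inner_def]
  refine integral_congr_ae ?_
  filter_upwards [MemLp.coeFn_toLp (memLp_schrodingerSymbol_mul (memLp_fourier f1 f2) (-s)),
    MemLp.coeFn_toLp (memLp_schrodingerSymbol_mul (memLp_fourier h1 h2) (-t))] with ξ e1 e2
  rw [dualWave, dualWave, e1, e2, RCLike.inner_apply, map_mul, conj_schrodingerSymbol, neg_neg,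
    sub_eq_add_neg, schrodingerSymbol_add]
  ring

theorem enorm_inner_dualWave_le {s t : ℝ} (hst : s ≠ t) {f h : Space d → ℂ} (f1 : Integrable f)
    (f2 : MemLp f 2 volume) (h1 : Integrable h) (h2 : MemLp h 2 volume) :
    ‖inner ℂ (dualWave s f f1 f2) (dualWave t h h1 h2)‖ₑ
      ≤ ENNReal.ofReal ((4 * Real.pi) ^ (-((d : ℝ) / 2))) *
        ENNReal.ofReal (|s - t| ^ (-((d : ℝ) / 2))) * ((∫⁻ x, ‖f x‖ₑ) * ∫⁻ x, ‖h x‖ₑ) := by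
  rw [inner_dualWave_dualWave, ← ofReal_norm]
  refine (ENNReal.ofReal_le_ofReal
    (norm_integral_schrodingerSymbol_mul_le (sub_ne_zero.2 hst) f1 f2 h1 h2)).trans (le_of_eq ?_)
  have hπ := Real.pi_pos
  rw [Real.mul_rpow (by positivity) (abs_nonneg _), mul_assoc,
    ENNReal.ofReal_mul (by positivity), ENNReal.ofReal_mul (by positivity),
    ENNReal.ofReal_mul (by positivity), ofReal_integral_norm_eq_lintegral_enorm f1,
    ofReal_integral_norm_eq_lintegral_enorm h1]

/-- Dual waves represent, by pairing, the map taking a Fourier transform `g` to the wave at time `s`. -/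
theorem inner_dualWave_toLp (s : ℝ) {f g : Space d → ℂ} (f1 : Integrable f) (f2 : MemLp f 2 volume)
    (g1 : Integrable g) (g2 : MemLp g 2 volume) :
    inner ℂ (dualWave s f f1 f2) (g2.toLp g) = ∫ x, (starRingEnd ℂ) (f x) * evolution g s x := by
  have hf' : Integrable fun x => (starRingEnd ℂ) (f (-x)) :=
    (LinearIsometryEquiv.integrable_comp_iff (Complex.conjLIE)).2 f1.comp_neg
  calc inner ℂ (dualWave s f f1 f2) (g2.toLp g)
      = ∫ ξ, 𝓕 (fun x => (starRingEnd ℂ) (f (-x))) ξ * (schrodingerSymbol s ξ * g ξ) := by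
        rw [L2.inner_def]
        refine integral_congr_ae ?_
        filter_upwards [MemLp.coeFn_toLp (memLp_schrodingerSymbol_mul (memLp_fourier f1 f2) (-s)),
          g2.coeFn_toLp] with ξ e1 e2
        rw [dualWave, e1, e2, RCLike.inner_apply, map_mul, conj_schrodingerSymbol, neg_neg,
          conj_fourier]
        ring
    _ = ∫ x, (starRingEnd ℂ) (f (-x)) * 𝓕 (fun ξ => schrodingerSymbol s ξ * g ξ) x :=
        integral_fourier_mul_eq_flip hf' (integrable_schrodingerSymbol_mul g1 s)
    _ = _ := by
        rw [← integral_neg_eq_self]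
        refine integral_congr_ae (Filter.Eventually.of_forall fun x => ?_)
        simp only [neg_neg, evolution, Real.fourierInv_eq_fourier_neg]

instance : SecondCountableTopology (L2 d) := by
  have : Fact ((2 : ℝ≥0∞) ≠ ⊤) := ⟨by norm_num⟩
  infer_instance

theorem stronglyMeasurable_dualWave {F : ℝ → Space d → ℂ} (hF : Measurable (Function.uncurry F))
    (h1 : ∀ s, Integrable (F s)) (h2 : ∀ s, MemLp (F s) 2 volume) :
    StronglyMeasurable fun s => dualWave s (F s) (h1 s) (h2 s) := by
  refine stronglyMeasurable_of_measurable_inner fun v => ?_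
  have hfour : StronglyMeasurable fun z : ℝ × Space d => 𝓕 (F z.1) z.2 := by
    simp_rw [Real.fourier_eq']
    have hm : Measurable fun y : (ℝ × Space d) × Space d =>
        Complex.exp (((-2 * Real.pi * inner ℝ y.2 y.1.2 : ℝ) : ℂ) * Complex.I) • F y.1.1 y.2 := by
      have hc : Continuous fun y : (ℝ × Space d) × Space d =>
          Complex.exp (((-2 * Real.pi * inner ℝ y.2 y.1.2 : ℝ) : ℂ) * Complex.I) := by fun_prop
      refine hc.measurable.smul ?_
      exact hF.comp ((measurable_fst.comp measurable_fst).prodMk measurable_snd)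
    exact hm.stronglyMeasurable.integral_prod_right'
  have hsym : Measurable fun z : ℝ × Space d => schrodingerSymbol (-z.1) z.2 :=
    (continuous_schrodingerSymbol.comp (by fun_prop :
      Continuous fun z : ℝ × Space d => ((-z.1, z.2) : ℝ × Space d))).measurable
  have hv : Measurable fun z : ℝ × Space d => (starRingEnd ℂ) (v z.2) := by
    have : Measurable (⇑v) := (Lp.stronglyMeasurable v).measurable
    exact Complex.continuous_conj.measurable.comp (this.comp measurable_snd)
  have hall : StronglyMeasurable fun s => ∫ ξ, (starRingEnd ℂ) (v ξ) *
      (schrodingerSymbol (-s) ξ * 𝓕 (F s) ξ) :=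
    ((hv.mul (hsym.mul hfour.measurable)).stronglyMeasurable).integral_prod_right'
  have heq : (fun s => inner ℂ v (dualWave s (F s) (h1 s) (h2 s))) = fun s => ∫ ξ,
      (starRingEnd ℂ) (v ξ) * (schrodingerSymbol (-s) ξ * 𝓕 (F s) ξ) := by
    ext s
    rw [L2.inner_def]
    refine integral_congr_ae ?_
    filter_upwards [MemLp.coeFn_toLp
      (memLp_schrodingerSymbol_mul (memLp_fourier (h1 s) (h2 s)) (-s))] with ξ e1
    rw [dualWave, e1, RCLike.inner_apply, mul_comm]
  rw [heq]
  exact hall.measurable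

end DualWave

/-! ### The Strichartz estimate -/

/-- The embedding `ℓ¹ ⊂ ℓ^θ`. -/
theorem tsum_rpow_le_rpow_tsum {ι : Type*} (x : ι → ℝ≥0∞) {θ : ℝ} (hθ : 1 ≤ θ) :
    ∑' k, x k ^ θ ≤ (∑' k, x k) ^ θ := by
  have hsplit : ∀ y : ℝ≥0∞, y ^ θ = y * y ^ (θ - 1) := fun y => by
    nth_rewrite 2 [← ENNReal.rpow_one y]
    rw [← ENNReal.rpow_add_of_nonneg _ _ zero_le_one (by linarith)]
    congr 1; ring
  calc ∑' k, x k ^ θ = ∑' k, x k * x k ^ (θ - 1) := tsum_congr fun k => hsplit _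
    _ ≤ ∑' k, x k * (∑' k, x k) ^ (θ - 1) := by
        refine ENNReal.tsum_le_tsum fun k => ?_
        exact mul_le_mul_right (ENNReal.rpow_le_rpow (ENNReal.le_tsum k) (by linarith)) _
    _ = (∑' k, x k) ^ θ := by rw [ENNReal.tsum_mul_right, ← hsplit]

/-- `ℓ² L^p ≤ L^p ℓ^s` for `p, s ≤ 2`: Minkowski's inequality and the embedding `ℓ^s ⊂ ℓ²`. -/
theorem tsum_lpTime_sq_le {p s : ℝ} (hp : 0 < p) (hp2 : p ≤ 2) (hs : 0 < s) (hs2 : s ≤ 2)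
    {c : ℤ → ℝ → ℝ≥0∞} (hc : ∀ k, Measurable (c k)) :
    ∑' k, lpTime p (c k) ^ 2 ≤ (∫⁻ t, (∑' k, c k t ^ s) ^ (p / s)) ^ (2 / p) := by
  have hm : Measurable (Function.uncurry fun (k : ℤ) (t : ℝ) => c k t ^ p) :=
    measurable_from_prod_countable_right fun k => (hc k).pow_const p
  have h := lintegral_rpow_lintegral_le Measure.count (volume : Measure ℝ) hm
    (s := 2 / p) (by rw [le_div_iff₀ hp]; linarith)
  simp only [lintegral_count] at h
  have e1 : ∀ k, lpTime p (c k) ^ 2 = (∫⁻ t, c k t ^ p) ^ (2 / p) := fun k => by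
    rw [lpTime, ← ENNReal.rpow_two, ← ENNReal.rpow_mul]; congr 1; ring
  simp_rw [e1]
  have h' := ENNReal.rpow_le_rpow h (show 0 ≤ 2 / p by positivity)
  rw [← ENNReal.rpow_mul, one_div_mul_cancel (by positivity), ENNReal.rpow_one] at h'
  refine h'.trans (ENNReal.rpow_le_rpow (lintegral_mono fun t => ?_) (by positivity))
  have e2 : ∀ k, (c k t ^ p) ^ (2 / p) = (c k t ^ s) ^ (2 / s) := fun k => by
    rw [← ENNReal.rpow_mul, ← ENNReal.rpow_mul]; congr 1; field_simp
  simp_rw [e2]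
  refine (ENNReal.rpow_le_rpow (tsum_rpow_le_rpow_tsum _ (by rw [le_div_iff₀ hs]; linarith))
    (by positivity)).trans (le_of_eq ?_)
  rw [← ENNReal.rpow_mul]
  congr 1
  field_simp

theorem measurable_slice {α β γ : Type*} [MeasurableSpace α] [MeasurableSpace β]
    [MeasurableSpace γ] {f : β → α → γ} (hf : Measurable (Function.uncurry f)) (t : β) :
    Measurable (f t) :=
  hf.comp measurable_prodMk_left

section Strichartz

variable {d : ℕ} {a b p q : ℝ}

/-- The dual Strichartz estimate, for functions `G` aligned in phase with the wave they are tested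
against. The atoms of `G(t)` at the scales `2 ^ k` satisfy the hypotheses of the abstract estimate. -/
theorem exists_lintegral_mul_evolution_le (hX : StrichartzExponents ((d : ℝ) / 2) a b p q) {s : ℝ}
    (hsb : 1 / s = 1 - b) : ∃ C : ℝ≥0∞, C ≠ ⊤ ∧ ∀ (G : ℝ → Space d → ℂ) (T : ℝ) (B : ℝ≥0∞),
      Measurable (Function.uncurry G) → B ≠ ⊤ → (∀ t, ∫⁻ x, ‖G t x‖ₑ ^ s ≤ B) →
      (∀ t ∉ Set.Icc (-T) T, G t = 0) →
      ∀ g : Space d → ℂ, Integrable g → MemLp g 2 volume →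
      (∀ t x, (starRingEnd ℂ) (G t x) * evolution g t x
        = ((‖G t x‖ * ‖evolution g t x‖ : ℝ) : ℂ)) →
      ∫⁻ t, ∫⁻ x, ‖G t x‖ₑ * ‖evolution g t x‖ₑ
        ≤ C * (∫⁻ t, (∫⁻ x, ‖G t x‖ₑ ^ s) ^ (p / s)) ^ (1 / p) * eLpNorm g 2 volume := by
  have ha := hX.a_pos
  have hb := hX.b_pos
  have hab := hX.add_eq
  have hp0 : 0 < p := hX.conj.pos
  have hp2 : p ≤ 2 := by
    have h1 := hX.conj.inv_add_inv_eq_one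
    have h2 : q⁻¹ ≤ 2⁻¹ := inv_anti₀ (by norm_num) hX.two_le
    have h3 : (2 : ℝ)⁻¹ ≤ p⁻¹ := by linarith
    exact (inv_le_inv₀ (by norm_num) hp0).1 h3
  have hs0 : 0 < s := one_div_pos.1 (by rw [hsb]; linarith)
  have hs2 : s ≤ 2 := by
    have h3 : (2 : ℝ)⁻¹ ≤ s⁻¹ := by rw [← one_div s, hsb]; linarith
    exact (inv_le_inv₀ (by norm_num) hs0).1 h3
  obtain ⟨C₀, hC₀, hmain⟩ := exists_enorm_sum_integral_sq_le (H := L2 d) hX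
    (D := ENNReal.ofReal ((4 * Real.pi) ^ (-((d : ℝ) / 2)))) ENNReal.ofReal_ne_top
  have hκ : (𝟚^s * 2) ≠ ⊤ :=
    ENNReal.mul_ne_top (ENNReal.rpow_ne_top_of_nonneg hs0.le (by norm_num)) (by norm_num)
  refine ⟨C₀ ^ (1 / 2 : ℝ) * (𝟚^s * 2) ^ (1 / s), ENNReal.mul_ne_top
    (ENNReal.rpow_ne_top_of_nonneg (by norm_num) hC₀)
    (ENNReal.rpow_ne_top_of_nonneg (by positivity) hκ), ?_⟩
  intro G T B hG hB hGB hGT g g1 g2 hphase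
  obtain ⟨H, hHdef⟩ : ∃ H : ℝ → Space d → ℝ≥0∞, H = fun t x => ‖G t x‖ₑ ^ s := ⟨_, rfl⟩
  have hGH : ∀ t x, ‖G t x‖ₑ ^ s = H t x := fun t x => by rw [hHdef]
  simp only [hGH] at hGB
  simp only [hGH]
  have hH : Measurable (Function.uncurry H) := by
    rw [hHdef]; exact hG.enorm.pow_const s
  have hHt : ∀ t, Measurable (H t) := fun t => measurable_slice hH t
  have hHint : ∀ t, ∫⁻ x, H t x ≠ ⊤ := fun t => ne_top_of_le_ne_top hB (hGB t)
  set F : ℤ → ℝ → Space d → ℂ := fun k t => (levelSet volume (H t) k).indicator (G t) with hF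
  have hFm : ∀ k, Measurable (Function.uncurry (F k)) := fun k => measurable_indicator_levelSet hH hG k
  have hFt : ∀ k t, Measurable (F k t) := fun k t => measurable_slice (hFm k) t
  set c : ℤ → ℝ → ℝ≥0∞ := fun k t => atomProfile s volume (H t) k with hc
  have hcm : ∀ k, Measurable (c k) := fun k => measurable_atomProfile hH s k
  have hcfin : ∀ k t, c k t ≠ ⊤ := fun k t => atomProfile_ne_top (hHt t) (hHint t) hs0 k
  have hFL1 : ∀ k t, ∫⁻ x, ‖F k t x‖ₑ ≤ 𝟚^(k * b) * c k t := fun k t => by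
    have := lintegral_enorm_indicator_levelSet_le (μ := volume) hs0 (hHt t) (G := G t)
      (hGH t) k
    rwa [show 1 - 1 / s = b by rw [hsb]; ring] at this
  have hFL2 : ∀ k t, eLpNorm (F k t) 2 volume ≤ 𝟚^(-(k * a)) * c k t := fun k t => by
    have := eLpNorm_two_indicator_levelSet_le (μ := volume) hs0 (hHt t) (G := G t)
      (hGH t) k
    rwa [show (k : ℝ) * (1 / 2 - 1 / s) = -(k * a) by
      rw [hsb, show a = 1 / 2 - b by linarith]; ring] at this
  have h2pow : ∀ x : ℝ, 𝟚^x ≠ ⊤ := fun x => by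
    simp [ENNReal.rpow_eq_top_iff]
  have F1 : ∀ k t, Integrable (F k t) := fun k t =>
    ⟨(hFt k t).aestronglyMeasurable, (hFL1 k t).trans_lt
      (ENNReal.mul_lt_top (h2pow _).lt_top (hcfin k t).lt_top)⟩
  have F2 : ∀ k t, MemLp (F k t) 2 volume := fun k t =>
    ⟨(hFt k t).aestronglyMeasurable, (hFL2 k t).trans_lt
      (ENNReal.mul_lt_top (h2pow _).lt_top (hcfin k t).lt_top)⟩
  set w : ℤ → ℝ → L2 d := fun k t => dualWave t (F k t) (F1 k t) (F2 k t) with hw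
  have hwn : ∀ k t, ‖w k t‖ₑ = eLpNorm (F k t) 2 volume := fun k t => enorm_dualWave t _ _
  have hwm : ∀ k, StronglyMeasurable (w k) := fun k => stronglyMeasurable_dualWave (hFm k) _ _
  have hcB : ∀ k t, c k t ≤ (𝟚^s * (2 * B)) ^ (1 / s) := fun k t => by
    have h1 : c k t ^ s ≤ 𝟚^s * (2 * B) :=
      (ENNReal.le_tsum k).trans ((tsum_atomProfile_rpow_le (hHt t) hs0).trans (by
        gcongr; exact hGB t))
    have h2 := ENNReal.rpow_le_rpow h1 (show 0 ≤ 1 / s by positivity)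
    rwa [← ENNReal.rpow_mul, mul_one_div_cancel hs0.ne', ENNReal.rpow_one] at h2
  have hwint : ∀ k, Integrable (w k) := fun k => by
    refine ⟨(hwm k).aestronglyMeasurable, ?_⟩
    have : ∀ t, ‖w k t‖ₑ ≤ (Set.Icc (-T) T).indicator
        (fun _ => 𝟚^(-(k * a)) * (𝟚^s * (2 * B)) ^ (1 / s)) t := fun t => by
      by_cases ht : t ∈ Set.Icc (-T) T
      · rw [Set.indicator_of_mem ht, hwn]
        exact (hFL2 k t).trans (by gcongr; exact hcB k t)
      · have : F k t = 0 := by simp only [hF, hGT t ht, Set.indicator_zero']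
        rw [hwn, this]
        simp
    refine (lintegral_mono this).trans_lt ?_
    rw [lintegral_indicator_const measurableSet_Icc]
    refine ENNReal.mul_lt_top (ENNReal.mul_lt_top (h2pow _).lt_top
      (ENNReal.rpow_lt_top_of_nonneg (by positivity) ?_)) (by simp)
    exact ENNReal.mul_ne_top (h2pow _) (ENNReal.mul_ne_top (by norm_num) hB)
  have hinner : ∀ k t, ENNReal.ofReal (∫ x, ‖F k t x‖ * ‖evolution g t x‖)
        = ∫⁻ x, ‖F k t x‖ₑ * ‖evolution g t x‖ₑ ∧
      inner ℂ (w k t) (g2.toLp g) = ((∫ x, ‖F k t x‖ * ‖evolution g t x‖ : ℝ) : ℂ) := by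
    intro k t
    constructor
    · have hi : Integrable fun x => F k t x * evolution g t x := by
        refine (F1 k t).mul_bdd (c := ∫ ξ, ‖g ξ‖) ?_ ?_
        · exact ((continuous_evolution g1).comp (Continuous.prodMk_right t)).aestronglyMeasurable
        · refine Filter.Eventually.of_forall fun x => ?_
          have := enorm_evolution_le g t x
          rwa [← ofReal_norm, ENNReal.ofReal_le_ofReal_iff (by positivity)] at this
      have := ofReal_integral_norm_eq_lintegral_enorm hi
      simpa only [norm_mul, enorm_mul] using this
    · rw [hw]
      simp only
      rw [inner_dualWave_toLp t (F1 k t) (F2 k t) g1 g2, ← integral_complex_ofReal]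
      refine integral_congr_ae (Filter.Eventually.of_forall fun x => ?_)
      simp only [hF]
      by_cases hx : x ∈ levelSet volume (H t) k
      · simp only [Set.indicator_of_mem hx, hphase]
      · simp [Set.indicator_of_notMem hx]
  have hsum : ∀ S : Finset ℤ, ∑ k ∈ S, ∫⁻ t, ∫⁻ x, ‖F k t x‖ₑ * ‖evolution g t x‖ₑ
      = ‖inner ℂ (∑ k ∈ S, ∫ t, w k t) (g2.toLp g)‖ₑ := by
    intro S
    have hy : ∀ k, Integrable fun t => ∫ x, ‖F k t x‖ * ‖evolution g t x‖ := fun k => by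
      have := ((hwint k).inner_const (𝕜 := ℂ) (g2.toLp g)).re
      refine this.congr (Filter.Eventually.of_forall fun t => ?_)
      simp only [(hinner k t).2]
      exact Complex.ofReal_re _
    have hy0 : ∀ k t, 0 ≤ ∫ x, ‖F k t x‖ * ‖evolution g t x‖ := fun k t =>
      integral_nonneg fun x => by positivity
    have e1 : inner ℂ (∑ k ∈ S, ∫ t, w k t) (g2.toLp g)
        = ((∑ k ∈ S, ∫ t, ∫ x, ‖F k t x‖ * ‖evolution g t x‖ : ℝ) : ℂ) := by
      rw [sum_inner]
      push_cast
      refine Finset.sum_congr rfl fun k _ => ?_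
      refine (integral_inner_right (hwint k) (g2.toLp g)).symm.trans ?_
      rw [← integral_complex_ofReal]
      exact integral_congr_ae (Filter.Eventually.of_forall fun t => (hinner k t).2)
    rw [e1, ← ofReal_norm, Complex.norm_real, Real.norm_eq_abs, abs_of_nonneg
      (Finset.sum_nonneg fun k _ => integral_nonneg (hy0 k)),
      ENNReal.ofReal_sum_of_nonneg fun k _ => integral_nonneg (hy0 k)]
    refine Finset.sum_congr rfl fun k _ => ?_
    rw [ofReal_integral_eq_lintegral_ofReal (hy k) (Filter.Eventually.of_forall (hy0 k))]
    exact lintegral_congr fun t => (hinner k t).1.symm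
  have hum : Measurable (Function.uncurry (evolution g)) := (continuous_evolution g1).measurable
  have hFum : ∀ k, Measurable (Function.uncurry fun t x => ‖F k t x‖ₑ * ‖evolution g t x‖ₑ) :=
    fun k => (hFm k).enorm.mul hum.enorm
  have hcover : ∫⁻ t, ∫⁻ x, ‖G t x‖ₑ * ‖evolution g t x‖ₑ
      ≤ ∑' k, ∫⁻ t, ∫⁻ x, ‖F k t x‖ₑ * ‖evolution g t x‖ₑ := by
    have hin : ∀ k, Measurable fun t => ∫⁻ x, ‖F k t x‖ₑ * ‖evolution g t x‖ₑ := fun k =>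
      (hFum k).lintegral_prod_right'
    rw [← lintegral_tsum fun k => (hin k).aemeasurable]
    refine lintegral_mono fun t => ?_
    simp only
    rw [← lintegral_tsum fun k => (measurable_slice (hFum k) t).aemeasurable]
    refine lintegral_mono_ae ?_
    filter_upwards [ae_exists_mem_levelSet (μ := volume) (hHt t) (hHint t)] with x hx
    by_cases h0 : H t x = 0
    · have : G t x = 0 := by
        simpa [← hGH, ENNReal.rpow_eq_zero_iff, hs0, hs0.not_gt] using h0
      simp [this]
    · obtain ⟨k, hk⟩ := hx h0
      refine le_trans (le_of_eq ?_) (ENNReal.le_tsum k)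
      simp [hF, Set.indicator_of_mem hk]
  -- Finite sums of atoms pair with `g` to a norm, to which the abstract estimate applies.
  refine hcover.trans (ENNReal.summable.tsum_le_of_sum_le fun S => ?_)
  rw [hsum S]
  set Y := ∫⁻ t, (∫⁻ x, H t x) ^ (p / s) with hY
  have hsq : ‖∑ k ∈ S, ∫ t, w k t‖ₑ ^ 2 ≤ C₀ * ((𝟚^s * 2) ^ (p / s) * Y) ^ (2 / p) := by
    refine (hmain S w c (fun k _ => hcm k) (fun k _ => hwint k) (fun k _ t => ?_)
      fun k _ l _ t t' htt' => ?_).trans ?_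
    · rw [hwn]; exact hFL2 k t
    · refine (enorm_inner_dualWave_le htt' _ _ _ _).trans ?_
      rw [mul_assoc (ENNReal.ofReal _ * ENNReal.ofReal _)]
      refine mul_le_mul_right ?_ _
      refine (mul_le_mul' (hFL1 k t) (hFL1 l t')).trans (le_of_eq ?_)
      rw [add_mul, two_rpow_add]
      ring
    · refine mul_le_mul_right ?_ _
      refine (ENNReal.sum_le_tsum S).trans
        ((tsum_lpTime_sq_le hp0 hp2 hs0 hs2 hcm).trans ?_)
      refine ENNReal.rpow_le_rpow ?_ (by positivity)
      have hmI : Measurable fun t => (∫⁻ x, H t x) ^ (p / s) :=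
        (hH.lintegral_prod_right' (ν := volume)).pow_const _
      rw [hY, ← lintegral_const_mul _ hmI]
      refine lintegral_mono fun t => ?_
      simp only
      rw [← ENNReal.mul_rpow_of_nonneg _ _ (by positivity), mul_assoc]
      exact ENNReal.rpow_le_rpow (tsum_atomProfile_rpow_le (hHt t) hs0) (by positivity)
  have hroot : ‖∑ k ∈ S, ∫ t, w k t‖ₑ ≤ C₀ ^ (1 / 2 : ℝ) * (𝟚^s * 2) ^ (1 / s) * Y ^ (1 / p) := by
    rw [← ENNReal.rpow_two] at hsq
    have h1 := ENNReal.rpow_le_rpow hsq (show (0 : ℝ) ≤ 1 / 2 by norm_num)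
    rw [← ENNReal.rpow_mul, mul_one_div_cancel two_ne_zero, ENNReal.rpow_one] at h1
    refine h1.trans (le_of_eq ?_)
    rw [ENNReal.mul_rpow_of_nonneg _ _ (by positivity), ← ENNReal.rpow_mul,
      ENNReal.mul_rpow_of_nonneg _ _ (by positivity), ← ENNReal.rpow_mul, ← mul_assoc]
    have e1 : 2 / p * (1 / 2) = 1 / p := by field_simp
    have e2 : p / s * (1 / p) = 1 / s := by field_simp
    rw [e1, e2]
  refine (enorm_inner_le _ _).trans ?_
  rw [Lp.enorm_toLp]
  gcongr

/-- The Strichartz estimate, endpoint included: the dual estimate is tested against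
`G = |u|^{r-2} u ‖u(t)‖_r^{q-r}` on a bounded time interval. -/
theorem exists_strichartz (hX : StrichartzExponents ((d : ℝ) / 2) a b p q) {r : ℝ} (hr : b = 1 / r) :
    ∃ C : ℝ≥0∞, C ≠ ⊤ ∧ ∀ g : Space d → ℂ, Integrable g → MemLp g 2 volume →
      (∫⁻ t, (∫⁻ x, ‖evolution g t x‖ₑ ^ r) ^ (q / r)) ^ (1 / q) ≤ C * eLpNorm g 2 volume := by
  have hr2 : 2 < r := by
    have h1 : 0 < 1 / r := hr ▸ hX.b_pos
    have h2 : 1 / r < 1 / 2 := by have := hX.add_eq; have := hX.a_pos; linarith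
    exact lt_of_one_div_lt_one_div (one_div_pos.1 h1) h2
  have hr0 : 0 < r := by linarith
  have hq2 := hX.two_le
  have hq0 : 0 < q := by linarith
  set s := r / (r - 1) with hs
  have hs0 : 0 < s := div_pos hr0 (by linarith)
  have hsb : 1 / s = 1 - b := by
    rw [hs, hr]; field_simp
  obtain ⟨C, hC, hdual⟩ := exists_lintegral_mul_evolution_le hX hsb
  refine ⟨C, hC, fun g g1 g2 => ?_⟩
  obtain ⟨u, hu⟩ : ∃ u : ℝ → Space d → ℂ, u = evolution g := ⟨_, rfl⟩
  simp only [← hu]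
  have hum : Measurable (Function.uncurry u) := by
    rw [hu]; exact (continuous_evolution g1).measurable
  set I : ℝ → ℝ≥0∞ := fun t => ∫⁻ x, ‖u t x‖ₑ ^ r with hI
  have hIm : Measurable I := (hum.enorm.pow_const r).lintegral_prod_right'
  -- `L²` conservation and the trivial `L^∞` bound control `‖u(t)‖_r` uniformly in time.
  set M : ℝ≥0∞ := ENNReal.ofReal (∫ ξ, ‖g ξ‖) ^ (r - 2) * eLpNorm g 2 volume ^ (2 : ℝ) with hM
  have hMtop : M ≠ ⊤ := ENNReal.mul_ne_top
    (ENNReal.rpow_ne_top_of_nonneg (by linarith) ENNReal.ofReal_ne_top)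
    (ENNReal.rpow_ne_top_of_nonneg (by norm_num) g2.2.ne)
  have hIM : ∀ t, I t ≤ M := fun t => by
    have hut : Measurable (u t) := measurable_slice hum t
    calc I t ≤ ∫⁻ x, ENNReal.ofReal (∫ ξ, ‖g ξ‖) ^ (r - 2) * ‖u t x‖ₑ ^ (2 : ℝ) := by
          refine lintegral_mono fun x => ?_
          have : ‖u t x‖ₑ ^ r = ‖u t x‖ₑ ^ (r - 2) * ‖u t x‖ₑ ^ (2 : ℝ) := by
            rw [← ENNReal.rpow_add_of_nonneg _ _ (by linarith) (by norm_num)]; congr 1; ring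
          simp only [this]
          exact mul_le_mul_left (ENNReal.rpow_le_rpow (by rw [hu]; exact enorm_evolution_le g t x)
            (by linarith)) _
      _ = M := by
          rw [lintegral_const_mul _ (hut.enorm.pow_const _), hM, ← eLpNorm_evolution_two g1 g2 t,
            eLpNorm_eq_lintegral_rpow_enorm_toReal (by norm_num) (by norm_num), ← ENNReal.rpow_mul]
          simp [hu]
  have hItop : ∀ t, I t ≠ ⊤ := fun t => ne_top_of_le_ne_top hMtop (hIM t)
  -- On a bounded time interval the left-hand side is finite, so a power of it can be divided out.
  have key : ∀ T : ℕ, (∫⁻ t in Set.Icc (-(T : ℝ)) T, I t ^ (q / r)) ^ (1 / q)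
      ≤ C * eLpNorm g 2 volume := by
    intro T
    set E := ∫⁻ t in Set.Icc (-(T : ℝ)) T, I t ^ (q / r) with hE
    have hEtop : E ≠ ⊤ := by
      have : E ≤ ∫⁻ t in Set.Icc (-(T : ℝ)) T, M ^ (q / r) :=
        lintegral_mono fun t => ENNReal.rpow_le_rpow (hIM t) (by positivity)
      refine ne_top_of_le_ne_top ?_ this
      rw [setLIntegral_const]
      exact ENNReal.mul_ne_top (ENNReal.rpow_ne_top_of_nonneg (by positivity) hMtop) (by simp)
    rcases eq_or_ne E 0 with hE0 | hE0
    · rw [hE0, ENNReal.zero_rpow_of_pos (by positivity)]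
      exact zero_le
    -- The weight in time makes both sides of the dual estimate powers of `E`.
    set ρ : ℝ → Space d → ℝ := fun t x =>
      (Set.Icc (-(T : ℝ)) T).indicator (fun t => (I t).toReal ^ ((q - r) / r)) t
        * ‖u t x‖ ^ (r - 2) with hρ
    have hρ0 : ∀ t x, 0 ≤ ρ t x := fun t x =>
      mul_nonneg (Set.indicator_nonneg (fun t _ => by positivity) t) (by positivity)
    set G : ℝ → Space d → ℂ := fun t x => (ρ t x : ℂ) * u t x with hG
    have hGm : Measurable (Function.uncurry G) := by
      have h1 : Measurable ((Set.Icc (-(T : ℝ)) T).indicator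
          (fun t => (I t).toReal ^ ((q - r) / r))) :=
        (hIm.ennreal_toReal.pow_const _).indicator measurableSet_Icc
      have h2 : Measurable (Function.uncurry ρ) :=
        (h1.comp measurable_fst).mul (hum.norm.pow_const _)
      exact (Complex.measurable_ofReal.comp h2).mul hum
    have hGnorm : ∀ t ∈ Set.Icc (-(T : ℝ)) T, I t ≠ 0 → ∀ x,
        ‖G t x‖ₑ = I t ^ ((q - r) / r) * ‖u t x‖ₑ ^ (r - 1) := by
      intro t ht hIt x
      have hIpos : 0 < (I t).toReal := ENNReal.toReal_pos hIt (hItop t)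
      rw [hG]
      simp only
      rw [enorm_mul, ← ofReal_norm (ρ t x : ℂ), Complex.norm_real, Real.norm_eq_abs,
        abs_of_nonneg (hρ0 t x), hρ]
      simp only [Set.indicator_of_mem ht]
      rw [ENNReal.ofReal_mul (by positivity), ← ENNReal.ofReal_rpow_of_pos hIpos,
        ENNReal.ofReal_toReal (hItop t), ← ENNReal.ofReal_rpow_of_nonneg (norm_nonneg _) (by linarith),
        ofReal_norm, mul_assoc]
      congr 1
      nth_rewrite 2 [← ENNReal.rpow_one ‖u t x‖ₑ]
      rw [← ENNReal.rpow_add_of_nonneg _ _ (by linarith) zero_le_one]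
      congr 1; ring
    have hzero : ∀ t, I t = 0 → ∀ᵐ x, u t x = 0 := by
      intro t ht
      have hut : Measurable (u t) := measurable_slice hum t
      rw [hI, lintegral_eq_zero_iff (hut.enorm.pow_const r)] at ht
      filter_upwards [ht] with x hx
      simpa [ENNReal.rpow_eq_zero_iff, hr0, hr0.not_gt] using hx
    have hGs : ∀ t ∈ Set.Icc (-(T : ℝ)) T,
        ∫⁻ x, ‖G t x‖ₑ ^ s = I t ^ ((q - 1) / (r - 1)) := by
      intro t ht
      have hut : Measurable (u t) := measurable_slice hum t
      rcases eq_or_ne (I t) 0 with h0 | h0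
      · rw [h0, ENNReal.zero_rpow_of_pos (div_pos (by linarith) (by linarith))]
        rw [lintegral_eq_zero_iff (((measurable_slice hGm t).enorm).pow_const s)]
        filter_upwards [hzero t h0] with x hx
        simp [hG, hx, hs0]
      · simp_rw [hGnorm t ht h0, ENNReal.mul_rpow_of_nonneg _ _ hs0.le]
        rw [lintegral_const_mul _ ((hut.enorm.pow_const _).pow_const _)]
        have : ∀ x, (‖u t x‖ₑ ^ (r - 1)) ^ s = ‖u t x‖ₑ ^ r := fun x => by
          rw [← ENNReal.rpow_mul, hs]
          congr 1
          have : r - 1 ≠ 0 := by linarith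
          field_simp
        simp_rw [this]
        change (I t ^ ((q - r) / r)) ^ s * I t = _
        nth_rewrite 2 [← ENNReal.rpow_one (I t)]
        rw [← ENNReal.rpow_mul, ← ENNReal.rpow_add _ _ h0 (hItop t)]
        congr 1
        have : r - 1 ≠ 0 := by linarith
        rw [hs]
        field_simp
        ring
    have hGout : ∀ t ∉ Set.Icc (-(T : ℝ)) T, G t = 0 := by
      intro t ht
      ext x
      simp [hG, hρ, ht]
    have hexp : 0 < (q - 1) / (r - 1) := div_pos (by linarith) (by linarith)
    have hbd := hdual G T (M ^ ((q - 1) / (r - 1))) hGm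
      (ENNReal.rpow_ne_top_of_nonneg hexp.le hMtop)
      (by
        intro t
        by_cases ht : t ∈ Set.Icc (-(T : ℝ)) T
        · rw [hGs t ht]
          exact ENNReal.rpow_le_rpow (hIM t) hexp.le
        · simp [hGout t ht, hs0])
      hGout g g1 g2
      (by
        intro t x
        simp only [hG, ← hu, norm_mul, Complex.norm_real, Real.norm_eq_abs, abs_of_nonneg (hρ0 t x),
          map_mul, Complex.conj_ofReal]
        rw [mul_assoc, Complex.conj_mul']
        push_cast
        ring)
    have hps : p / s = q / (q - 1) * ((r - 1) / r) := by
      have hp : p = q / (q - 1) := hX.conj.symm.conjugate_eq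
      rw [hp, hs]
      have : r - 1 ≠ 0 := by linarith
      field_simp
    have hlhs : ∫⁻ t, ∫⁻ x, ‖G t x‖ₑ * ‖u t x‖ₑ = E := by
      rw [hE, ← lintegral_indicator measurableSet_Icc]
      refine lintegral_congr fun t => ?_
      by_cases ht : t ∈ Set.Icc (-(T : ℝ)) T
      · have hut : Measurable (u t) := measurable_slice hum t
        have hGu : Measurable fun x => ‖G t x‖ₑ * ‖u t x‖ₑ :=
          (measurable_slice hGm t).enorm.mul hut.enorm
        have huu : Measurable fun x => ‖u t x‖ₑ ^ (r - 1) * ‖u t x‖ₑ :=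
          (hut.enorm.pow_const _).mul hut.enorm
        rw [Set.indicator_of_mem ht]
        rcases eq_or_ne (I t) 0 with h0 | h0
        · rw [h0, ENNReal.zero_rpow_of_pos (by positivity), lintegral_eq_zero_iff hGu]
          filter_upwards [hzero t h0] with x hx
          simp [hG, hx]
        · simp_rw [hGnorm t ht h0, mul_assoc]
          rw [lintegral_const_mul _ huu]
          have : ∀ x, ‖u t x‖ₑ ^ (r - 1) * ‖u t x‖ₑ = ‖u t x‖ₑ ^ r := fun x => by
            nth_rewrite 2 [← ENNReal.rpow_one ‖u t x‖ₑ]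
            rw [← ENNReal.rpow_add_of_nonneg _ _ (by linarith) zero_le_one]
            congr 1; ring
          simp_rw [this]
          change I t ^ ((q - r) / r) * I t = _
          nth_rewrite 2 [← ENNReal.rpow_one (I t)]
          rw [← ENNReal.rpow_add _ _ h0 (hItop t)]
          congr 1
          field_simp
          ring
      · simp [Set.indicator_of_notMem ht, hGout t ht]
    have hrhs : ∫⁻ t, (∫⁻ x, ‖G t x‖ₑ ^ s) ^ (p / s) = E := by
      have hps0 : 0 < p / s := div_pos hX.conj.pos hs0
      rw [hE, ← lintegral_indicator measurableSet_Icc]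
      refine lintegral_congr fun t => ?_
      by_cases ht : t ∈ Set.Icc (-(T : ℝ)) T
      · rw [Set.indicator_of_mem ht, hGs t ht, ← ENNReal.rpow_mul, hps]
        congr 1
        have : r - 1 ≠ 0 := by linarith
        have : q - 1 ≠ 0 := by linarith
        field_simp
      · simp [Set.indicator_of_notMem ht, hGout t ht, hs0, hps0]
    rw [← hu, hlhs, hrhs] at hbd
    have hpq : 1 / q = 1 - 1 / p := by
      have := hX.conj.inv_add_inv_eq_one
      rw [one_div, one_div]; linarith
    calc E ^ (1 / q) = E * E ^ (-(1 / p)) := by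
          rw [hpq, sub_eq_add_neg, ENNReal.rpow_add _ _ hE0 hEtop, ENNReal.rpow_one]
      _ ≤ (C * E ^ (1 / p) * eLpNorm g 2 volume) * E ^ (-(1 / p)) := by gcongr
      _ = C * eLpNorm g 2 volume * (E ^ (1 / p) * E ^ (-(1 / p))) := by ring
      _ = C * eLpNorm g 2 volume := by
          rw [← ENNReal.rpow_add _ _ hE0 hEtop]; simp
  have hmono : Monotone fun T : ℕ => Set.Icc (-(T : ℝ)) T := fun m n hmn => by
    have : (m : ℝ) ≤ n := by exact_mod_cast hmn
    exact Set.Icc_subset_Icc (by linarith) this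
  have hU : (⋃ T : ℕ, Set.Icc (-(T : ℝ)) T) = Set.univ := by
    refine Set.eq_univ_of_forall fun t => ?_
    obtain ⟨n, hn⟩ := exists_nat_ge |t|
    exact Set.mem_iUnion.2 ⟨n, abs_le.1 hn⟩
  have hlim : Filter.Tendsto (fun T : ℕ => ∫⁻ t in Set.Icc (-(T : ℝ)) T, I t ^ (q / r)) Filter.atTop
      (nhds (∫⁻ t, I t ^ (q / r))) := by
    have h := setLIntegral_iUnion_of_directed (μ := volume) (fun t => I t ^ (q / r))
      (s := fun T : ℕ => Set.Icc (-(T : ℝ)) T) (hmono.directed_le)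
    rw [hU, setLIntegral_univ] at h
    rw [h]
    exact tendsto_atTop_iSup fun m n hmn => lintegral_mono_set (hmono hmn)
  exact le_of_tendsto' ((ENNReal.continuous_rpow_const.tendsto _).comp hlim) key

end Strichartz

/-! ### Unit-scale frequency localisation -/

section Localisation

variable {d : ℕ}

/-- The unit-scale cube `n + [-1, 1]^d` around the lattice point `n`. -/
def latticeCube (n : Fin d → ℤ) : Set (Space d) := {ξ | ∀ i, |ξ i - n i| ≤ 1}

theorem isClosed_latticeCube (n : Fin d → ℤ) : IsClosed (latticeCube n) := by
  simp only [latticeCube, Set.ofPred_forall]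
  exact isClosed_iInter fun i => isClosed_le (by fun_prop) continuous_const

theorem volume_latticeCube_lt_top (n : Fin d → ℤ) : volume (latticeCube n) < ⊤ := by
  have h : latticeCube n ⊆ WithLp.ofLp ⁻¹'
      (Set.Icc (fun i => (n i : ℝ) - 1) (fun i => (n i : ℝ) + 1)) := by
    intro ξ hξ
    refine ⟨fun i => ?_, fun i => ?_⟩ <;> have := abs_le.1 (hξ i) <;> simp <;> linarith
  refine (measure_mono h).trans_lt ?_
  rw [(PiLp.volume_preserving_ofLp (Fin d)).measure_preimage measurableSet_Icc.nullMeasurableSet]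
  exact isCompact_Icc.measure_lt_top

/-- The finitely many lattice points whose cubes can contain `ξ`. -/
noncomputable def nearbyLattice (ξ : Space d) : Finset (Fin d → ℤ) :=
  Fintype.piFinset fun i => Finset.Icc (⌊ξ i⌋ - 1) (⌊ξ i⌋ + 1)

theorem card_nearbyLattice (ξ : Space d) : (nearbyLattice ξ).card = 3 ^ d := by
  have : ∀ z : ℤ, z + 1 + 1 - (z - 1) = 3 := fun z => by ring
  simp [nearbyLattice, this]

theorem mem_nearbyLattice {ξ : Space d} {n : Fin d → ℤ} (h : ξ ∈ latticeCube n) :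
    n ∈ nearbyLattice ξ := by
  rw [nearbyLattice, Fintype.mem_piFinset]
  intro i
  have := abs_le.1 (h i)
  rw [Finset.mem_Icc]
  constructor
  · have h1 : (⌊ξ i⌋ : ℝ) ≤ ξ i := Int.floor_le _
    have : ((⌊ξ i⌋ - 1 : ℤ) : ℝ) ≤ n i := by push_cast; linarith
    exact_mod_cast this
  · have h1 : ξ i < ⌊ξ i⌋ + 1 := Int.lt_floor_add_one _
    have : (n i : ℝ) < ((⌊ξ i⌋ + 2 : ℤ) : ℝ) := by push_cast; linarith
    have : n i < ⌊ξ i⌋ + 2 := by exact_mod_cast this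
    omega

theorem mem_latticeCube_of_window_ne_zero {ψ : 𝓢(Space d, ℂ)} (hψ : IsWienerWindow ψ)
    {n : Fin d → ℤ} {ξ : Space d} (h : ψ (ξ - latticePoint n) ≠ 0) : ξ ∈ latticeCube n := by
  intro i
  have := hψ.support_subset (subset_tsupport _ h) i
  simp [latticePoint] at this
  exact abs_le.2 ⟨by linarith, by linarith⟩

/-- Almost orthogonality: every frequency lies in at most `3 ^ d` cubes. -/
theorem tsum_lintegral_latticeCube_le (f : Space d → ℝ≥0∞) (hf : Measurable f) :
    ∑' n : Fin d → ℤ, ∫⁻ ξ in latticeCube n, f ξ ≤ 3 ^ d * ∫⁻ ξ, f ξ := by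
  have h1 : ∀ n : Fin d → ℤ, ∫⁻ ξ in latticeCube n, f ξ
      = ∫⁻ ξ, (latticeCube n).indicator f ξ := fun n =>
    (lintegral_indicator (isClosed_latticeCube n).measurableSet _).symm
  simp_rw [h1]
  rw [← lintegral_tsum fun n => (hf.indicator (isClosed_latticeCube n).measurableSet).aemeasurable,
    ← lintegral_const_mul _ hf]
  refine lintegral_mono fun ξ => ?_
  have h2 : ∑' n : Fin d → ℤ, (latticeCube n).indicator f ξ
      = ∑ n ∈ nearbyLattice ξ, (latticeCube n).indicator f ξ :=
    tsum_eq_sum fun n hn => Set.indicator_of_notMem (fun h => hn (mem_nearbyLattice h)) _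
  simp only [h2]
  refine (Finset.sum_le_card_nsmul _ _ (f ξ) fun n _ => Set.indicator_le_self _ _ _).trans ?_
  rw [card_nearbyLattice, nsmul_eq_mul]
  simp

/-- Frequency localisation by a translated window acts as convolution with a kernel whose modulus is
`‖𝓕⁻ ψ‖`, whatever the translation. -/
theorem enorm_evolution_window_mul_le (ψ : 𝓢(Space d, ℂ)) (ν : Space d) {g : Space d → ℂ}
    (hg : Integrable g) (t : ℝ) (x : Space d) :
    ‖evolution (fun ξ => ψ (ξ - ν) * g ξ) t x‖ₑ
      ≤ ∫⁻ y, ‖(𝓕⁻ ψ : 𝓢(Space d, ℂ)) y‖ₑ * ‖evolution g t (x - y)‖ₑ := by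
  set E : Space d → ℂ := fun ξ => Complex.exp (↑(2 * Real.pi * inner ℝ ξ x) * Complex.I) *
      (schrodingerSymbol t ξ * g ξ) with hE
  have hEi : Integrable E := by
    refine (integrable_schrodingerSymbol_mul hg t).bdd_mul (c := 1)
      (Continuous.aestronglyMeasurable (by fun_prop)) (Filter.Eventually.of_forall fun ξ => ?_)
    rw [Complex.norm_exp_ofReal_mul_I]
  have hEν : Integrable fun ξ => E (ξ + ν) := hEi.comp_add_right ν
  have h1 : evolution (fun ξ => ψ (ξ - ν) * g ξ) t x = ∫ ξ, ψ ξ * E (ξ + ν) := by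
    rw [evolution_eq, ← integral_add_right_eq_self _ ν]
    refine integral_congr_ae (Filter.Eventually.of_forall fun ξ => ?_)
    simp only [hE, add_sub_cancel_right]
    ring
  have h2 : ∀ ξ, ψ ξ = 𝓕 (⇑(𝓕⁻ ψ : 𝓢(Space d, ℂ))) ξ := fun ξ => by
    rw [← SchwartzMap.fourier_coe, FourierTransform.fourier_fourierInv_eq]
  have h3 : ∀ y, ‖𝓕 (fun ξ => E (ξ + ν)) y‖ₑ = ‖evolution g t (x - y)‖ₑ := by
    intro y
    have : 𝓕 (fun ξ => E (ξ + ν)) y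
        = Complex.exp (↑(2 * Real.pi * inner ℝ ν y) * Complex.I) * evolution g t (x - y) := by
      rw [Real.fourier_eq', evolution_eq,
        ← integral_add_right_eq_self (fun ξ => Complex.exp (↑(2 * Real.pi * inner ℝ ξ (x - y))
          * Complex.I) * (schrodingerSymbol t ξ * g ξ)) ν, ← integral_const_mul]
      refine integral_congr_ae (Filter.Eventually.of_forall fun ξ => ?_)
      simp only [hE, smul_eq_mul]
      rw [← mul_assoc, ← mul_assoc (Complex.exp _) (Complex.exp _), ← Complex.exp_add,
        ← Complex.exp_add]
      congr 2
      rw [inner_sub_right, inner_add_left, inner_add_left]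
      push_cast
      ring
    rw [this, enorm_mul, ← ofReal_norm, Complex.norm_exp_ofReal_mul_I, ENNReal.ofReal_one, one_mul]
  rw [h1]
  simp_rw [h2]
  rw [integral_fourier_mul_eq_flip (𝓕⁻ ψ : 𝓢(Space d, ℂ)).integrable hEν]
  refine (enorm_integral_le_lintegral_enorm _).trans (le_of_eq ?_)
  simp_rw [enorm_mul, h3]

/-- Bernstein's inequality `L^r → L^∞` at unit scale, uniformly in the position of the window. -/
theorem exists_enorm_evolution_window_le (ψ : 𝓢(Space d, ℂ)) {r : ℝ} (hr : 1 < r) :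
    ∃ C : ℝ≥0∞, C ≠ ⊤ ∧ ∀ (ν : Space d) (g : Space d → ℂ), Integrable g → ∀ t x,
      ‖evolution (fun ξ => ψ (ξ - ν) * g ξ) t x‖ₑ
        ≤ C * (∫⁻ y, ‖evolution g t y‖ₑ ^ r) ^ (1 / r) := by
  set s := r / (r - 1)
  have hc : s.HolderConjugate r := (Real.HolderConjugate.conjExponent hr).symm
  refine ⟨(∫⁻ y, ‖(𝓕⁻ ψ : 𝓢(Space d, ℂ)) y‖ₑ ^ s) ^ (1 / s), ?_, fun ν g hg t x => ?_⟩
  · have h := ((𝓕⁻ ψ : 𝓢(Space d, ℂ)).memLp (ENNReal.ofReal s) volume).2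
    rw [eLpNorm_eq_lintegral_rpow_enorm_toReal (by simpa using hc.pos) (by simp),
      ENNReal.toReal_ofReal hc.nonneg] at h
    exact h.ne
  · refine (enorm_evolution_window_mul_le ψ ν hg t x).trans ?_
    have hu : Measurable fun y => ‖evolution g t (x - y)‖ₑ :=
      (((continuous_evolution hg).comp (Continuous.prodMk_right t)).measurable.comp
        (measurable_const.sub measurable_id)).enorm
    refine (ENNReal.lintegral_mul_le_Lp_mul_Lq volume hc
      (𝓕⁻ ψ : 𝓢(Space d, ℂ)).continuous.measurable.enorm.aemeasurable hu.aemeasurable).trans ?_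
    rw [lintegral_sub_left_eq_self (fun y => ‖evolution g t y‖ₑ ^ r) x]

theorem exists_norm_schwartz_le (ψ : 𝓢(Space d, ℂ)) : ∃ M : ℝ, ∀ ξ, ‖ψ ξ‖ ≤ M := by
  obtain ⟨M, -, hM⟩ := ψ.decay 0 0
  exact ⟨M, fun ξ => by simpa using hM ξ⟩

/-- The space-time norm of a single frequency-localised wave. -/
theorem exists_lintegral_evolution_window_le (ψ : 𝓢(Space d, ℂ)) {a b p q r ρ : ℝ}
    (hX : StrichartzExponents ((d : ℝ) / 2) a b p q) (hr : b = 1 / r) (hρ : r ≤ ρ) :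
    ∃ C : ℝ≥0∞, C ≠ ⊤ ∧ ∀ (ν : Space d) (g : Space d → ℂ), Integrable g → MemLp g 2 volume →
      (∫⁻ t, (∫⁻ x, ‖evolution (fun ξ => ψ (ξ - ν) * g ξ) t x‖ₑ ^ ρ) ^ (q / ρ)) ^ (1 / q)
        ≤ C * eLpNorm g 2 volume := by
  have hr2 : 2 < r := by
    have h1 : 0 < 1 / r := hr ▸ hX.b_pos
    have h2 : 1 / r < 1 / 2 := by have := hX.add_eq; have := hX.a_pos; linarith
    exact lt_of_one_div_lt_one_div (one_div_pos.1 h1) h2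
  have hr0 : 0 < r := by linarith
  have hρ0 : 0 < ρ := by linarith
  have hq2 := hX.two_le
  have hq0 : 0 < q := by linarith
  obtain ⟨C₁, hC₁, hS⟩ := exists_strichartz hX hr
  obtain ⟨C₂, hC₂, hB⟩ := exists_enorm_evolution_window_le ψ (show 1 < r by linarith)
  obtain ⟨M, hM⟩ := exists_norm_schwartz_le ψ
  set C₃ := (1 + C₂) * (C₁ + C₁ * ENNReal.ofReal M) with hC₃
  refine ⟨C₃, by finiteness, fun ν g g1 g2 => ?_⟩
  set w : Space d → ℂ := fun ξ => ψ (ξ - ν) * g ξ with hw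
  have hψm : AEStronglyMeasurable (fun ξ => ψ (ξ - ν)) volume :=
    (ψ.continuous.comp (continuous_id.sub continuous_const)).aestronglyMeasurable
  have w1 : Integrable w := g1.bdd_mul hψm (Filter.Eventually.of_forall fun ξ => hM _)
  have hwle : ∀ ξ, ‖w ξ‖ ≤ M * ‖g ξ‖ := fun ξ => by
    rw [hw, norm_mul]
    exact mul_le_mul_of_nonneg_right (hM _) (norm_nonneg _)
  have w2 : MemLp w 2 volume :=
    g2.of_le_mul (hψm.mul g2.1) (Filter.Eventually.of_forall hwle)
  have hw2 : eLpNorm w 2 volume ≤ ENNReal.ofReal M * eLpNorm g 2 volume :=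
    eLpNorm_le_mul_eLpNorm_of_ae_le_mul (Filter.Eventually.of_forall hwle) 2
  set U : ℝ → ℝ≥0∞ := fun t => (∫⁻ x, ‖evolution g t x‖ₑ ^ r) ^ (1 / r) with hU
  set V : ℝ → ℝ≥0∞ := fun t => (∫⁻ x, ‖evolution w t x‖ₑ ^ r) ^ (1 / r) with hV
  have hUm : Measurable U := (((continuous_evolution g1).measurable.enorm.pow_const
    r).lintegral_prod_right').pow_const _
  have hVm : Measurable V := (((continuous_evolution w1).measurable.enorm.pow_const
    r).lintegral_prod_right').pow_const _
  have hpt : ∀ t, (∫⁻ x, ‖evolution w t x‖ₑ ^ ρ) ^ (1 / ρ) ≤ (1 + C₂) * (U t + V t) := by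
    intro t
    set N := (1 + C₂) * (U t + V t) with hN
    have h1 : ∀ x, ‖evolution w t x‖ₑ ≤ N := fun x =>
      (hB ν g g1 t x).trans (mul_le_mul' le_add_self le_self_add)
    have h2 : V t ≤ N := by
      calc V t ≤ U t + V t := le_add_self
        _ ≤ N := le_mul_of_one_le_left' le_self_add
    have h3 : ∫⁻ x, ‖evolution w t x‖ₑ ^ ρ ≤ N ^ (ρ - r) * V t ^ r := by
      have hwm : Measurable fun x => ‖evolution w t x‖ₑ ^ r :=
        (((continuous_evolution w1).comp (Continuous.prodMk_right t)).measurable.enorm).pow_const r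
      rw [hV]
      simp only
      rw [← ENNReal.rpow_mul, one_div_mul_cancel hr0.ne', ENNReal.rpow_one,
        ← lintegral_const_mul _ hwm]
      refine lintegral_mono fun x => ?_
      simp only
      rw [show ρ = (ρ - r) + r by ring, ENNReal.rpow_add_of_nonneg _ _ (by linarith) hr0.le,
        show ρ - r + r - r = ρ - r by ring]
      exact mul_le_mul_left (ENNReal.rpow_le_rpow (h1 x) (by linarith)) _
    calc (∫⁻ x, ‖evolution w t x‖ₑ ^ ρ) ^ (1 / ρ) ≤ (N ^ (ρ - r) * N ^ r) ^ (1 / ρ) :=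
          ENNReal.rpow_le_rpow (h3.trans (mul_le_mul_right
            (ENNReal.rpow_le_rpow h2 hr0.le) _)) (by positivity)
      _ = N := by
          rw [← ENNReal.rpow_add_of_nonneg _ _ (by linarith) hr0.le, ← ENNReal.rpow_mul,
            sub_add_cancel, mul_one_div_cancel hρ0.ne', ENNReal.rpow_one]
  have hUV : ∀ (Z : ℝ → Space d → ℂ), ∫⁻ t, (∫⁻ x, ‖Z t x‖ₑ ^ r) ^ (q / r)
      = ∫⁻ t, ((∫⁻ x, ‖Z t x‖ₑ ^ r) ^ (1 / r)) ^ q := fun Z =>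
    lintegral_congr fun t => by rw [← ENNReal.rpow_mul]; congr 1; ring
  have hSg := hS g g1 g2
  have hSw := (hS w w1 w2).trans (mul_le_mul_right hw2 C₁)
  rw [hUV] at hSg hSw
  calc (∫⁻ t, (∫⁻ x, ‖evolution w t x‖ₑ ^ ρ) ^ (q / ρ)) ^ (1 / q)
      ≤ (∫⁻ t, ((1 + C₂) * (U t + V t)) ^ q) ^ (1 / q) := by
        refine ENNReal.rpow_le_rpow (lintegral_mono fun t => ?_) (by positivity)
        refine le_trans (le_of_eq ?_) (ENNReal.rpow_le_rpow (hpt t) hq0.le)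
        rw [← ENNReal.rpow_mul]; congr 1; ring
    _ = (1 + C₂) * (∫⁻ t, (U + V) t ^ q) ^ (1 / q) := by
        simp_rw [ENNReal.mul_rpow_of_nonneg _ _ hq0.le]
        have hUVm : Measurable fun t => (U t + V t) ^ q := (hUm.add hVm).pow_const q
        rw [lintegral_const_mul _ hUVm,
          ENNReal.mul_rpow_of_nonneg _ _ (by positivity), ← ENNReal.rpow_mul,
          mul_one_div_cancel hq0.ne', ENNReal.rpow_one]
        rfl
    _ ≤ (1 + C₂) * ((∫⁻ t, U t ^ q) ^ (1 / q) + (∫⁻ t, V t ^ q) ^ (1 / q)) :=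
        mul_le_mul_right (ENNReal.lintegral_Lp_add_le hUm.aemeasurable hVm.aemeasurable
          (by linarith)) _
    _ ≤ (1 + C₂) * (C₁ * eLpNorm g 2 volume + C₁ * (ENNReal.ofReal M * eLpNorm g 2 volume)) :=
        mul_le_mul_right (add_le_add hSg hSw) _
    _ = C₃ * eLpNorm g 2 volume := by rw [hC₃]; ring

theorem integrable_indicator_latticeCube {g : Space d → ℂ} (hg : MemLp g 2 volume)
    (n : Fin d → ℤ) : Integrable ((latticeCube n).indicator g) := by
  have : IsFiniteMeasure (volume.restrict (latticeCube n)) :=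
    ⟨by simpa using volume_latticeCube_lt_top n⟩
  exact (integrable_indicator_iff (isClosed_latticeCube n).measurableSet).2
    (hg.restrict _ |>.integrable (by norm_num))

theorem window_mul_indicator {ψ : 𝓢(Space d, ℂ)} (hψ : IsWienerWindow ψ) (g : Space d → ℂ)
    (n : Fin d → ℤ) : (fun ξ => ψ (ξ - latticePoint n) * (latticeCube n).indicator g ξ)
      = fun ξ => ψ (ξ - latticePoint n) * g ξ := by
  ext ξ
  by_cases h : ψ (ξ - latticePoint n) = 0
  · simp [h]
  · rw [Set.indicator_of_mem (mem_latticeCube_of_window_ne_zero hψ h)]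

/-- The square sum over all frequency windows of the space-time norms of the localised waves. -/
theorem exists_tsum_evolution_window_le {ψ : 𝓢(Space d, ℂ)} (hψ : IsWienerWindow ψ)
    {a b p q r ρ : ℝ} (hX : StrichartzExponents ((d : ℝ) / 2) a b p q) (hr : b = 1 / r)
    (hρ : r ≤ ρ) : ∃ C : ℝ≥0∞, C ≠ ⊤ ∧ ∀ g : Space d → ℂ, Measurable g → MemLp g 2 volume →
      ∑' n : Fin d → ℤ, (∫⁻ t, (∫⁻ x, ‖evolution (fun ξ => ψ (ξ - latticePoint n) * g ξ) t x‖ₑ ^ ρ)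
        ^ (q / ρ)) ^ (2 / q) ≤ C * eLpNorm g 2 volume ^ 2 := by
  obtain ⟨C, hC, h⟩ := exists_lintegral_evolution_window_le ψ hX hr hρ
  refine ⟨C ^ 2 * 3 ^ d, by finiteness, fun g hgm hg => ?_⟩
  have hterm : ∀ n : Fin d → ℤ,
      (∫⁻ t, (∫⁻ x, ‖evolution (fun ξ => ψ (ξ - latticePoint n) * g ξ) t x‖ₑ ^ ρ)
        ^ (q / ρ)) ^ (2 / q) ≤ C ^ 2 * ∫⁻ ξ in latticeCube n, ‖g ξ‖ₑ ^ (2 : ℝ) := by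
    intro n
    have h1 := h (latticePoint n) _ (integrable_indicator_latticeCube hg n)
      (hg.indicator (isClosed_latticeCube n).measurableSet)
    rw [window_mul_indicator hψ] at h1
    have h2 := pow_le_pow_left' h1 2
    rw [← ENNReal.rpow_two, ← ENNReal.rpow_mul, show 1 / q * 2 = 2 / q by ring, mul_pow] at h2
    refine h2.trans (le_of_eq ?_)
    rw [eLpNorm_indicator_eq_eLpNorm_restrict (isClosed_latticeCube n).measurableSet,
      eLpNorm_eq_lintegral_rpow_enorm_toReal (by norm_num) (by norm_num),
      ← ENNReal.rpow_two (_ ^ _), ← ENNReal.rpow_mul]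
    simp
  refine (ENNReal.tsum_le_tsum hterm).trans ?_
  rw [ENNReal.tsum_mul_left, mul_assoc]
  refine mul_le_mul_right ((tsum_lintegral_latticeCube_le _ (hgm.enorm.pow_const _)).trans
    (le_of_eq ?_)) _
  rw [eLpNorm_eq_lintegral_rpow_enorm_toReal (by norm_num) (by norm_num),
      ← ENNReal.rpow_two (_ ^ _), ← ENNReal.rpow_mul]
  simp

end Localisation

/-! ### Moments of sums of subgaussian random variables -/

section Probability

variable {Ω : Type*} [MeasurableSpace Ω] {P : Measure Ω}

/-- Moments of real order of a subgaussian random variable: `x ^ k ≤ (k / γ) ^ k e^{γ x}` is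
integrated with the optimal `γ = √(k / v)`. -/
theorem lintegral_enorm_rpow_le_of_hasSubgaussianMGF [IsFiniteMeasure P] {X : Ω → ℝ} {v : NNReal}
    (hX : HasSubgaussianMGF X v P) {k : ℝ} (hk : 0 < k) :
    ∫⁻ ω, ‖X ω‖ₑ ^ k ∂P ≤ 2 * ENNReal.ofReal (Real.exp 1 * k * v) ^ (k / 2) := by
  rcases eq_or_ne v 0 with rfl | hv
  · have h0 := hX.ae_eq_zero_of_hasSubgaussianMGF_zero
    rw [lintegral_congr_ae (g := fun _ => 0) (by filter_upwards [h0] with ω hω; simp [hω, hk])]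
    simp
  have hv0 : (0 : ℝ) < v := by positivity
  set γ := Real.sqrt (k / v) with hγ
  have hγ0 : 0 < γ := Real.sqrt_pos.2 (by positivity)
  have hγ2 : γ ^ 2 = k / v := Real.sq_sqrt (by positivity)
  have hpt : ∀ x : ℝ, |x| ^ k ≤ (k / γ) ^ k * (Real.exp (γ * x) + Real.exp (-γ * x)) := by
    intro x
    have h1 : (γ * |x| / k) ^ k ≤ Real.exp (γ * |x|) := by
      calc (γ * |x| / k) ^ k ≤ (Real.exp (γ * |x| / k)) ^ k :=
            Real.rpow_le_rpow (by positivity)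
              (by linarith [Real.add_one_le_exp (γ * |x| / k)]) hk.le
        _ = Real.exp (γ * |x|) := by rw [← Real.exp_mul]; congr 1; field_simp
    have h2 : Real.exp (γ * |x|) ≤ Real.exp (γ * x) + Real.exp (-γ * x) := by
      rcases abs_cases x with ⟨h, -⟩ | ⟨h, -⟩ <;> rw [h]
      · linarith [Real.exp_pos (-γ * x)]
      · rw [show γ * -x = -γ * x by ring]
        linarith [Real.exp_pos (γ * x)]
    calc |x| ^ k = (k / γ) ^ k * (γ * |x| / k) ^ k := by
          rw [← Real.mul_rpow (by positivity) (by positivity)]; congr 1; field_simp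
      _ ≤ _ := mul_le_mul_of_nonneg_left (h1.trans h2) (by positivity)
  have hi : Integrable (fun ω => (k / γ) ^ k * (Real.exp (γ * X ω) + Real.exp (-γ * X ω))) P :=
    ((hX.integrable_exp_mul γ).add (hX.integrable_exp_mul (-γ))).const_mul _
  have h1 : ∫ ω, (k / γ) ^ k * (Real.exp (γ * X ω) + Real.exp (-γ * X ω)) ∂P
      ≤ (k / γ) ^ k * (2 * Real.exp (k / 2)) := by
    rw [integral_const_mul, integral_add (hX.integrable_exp_mul γ) (hX.integrable_exp_mul (-γ))]
    refine mul_le_mul_of_nonneg_left ?_ (by positivity)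
    have e1 := hX.mgf_le γ
    have e2 := hX.mgf_le (-γ)
    rw [neg_sq] at e2
    rw [hγ2, show (v : ℝ) * (k / v) / 2 = k / 2 by field_simp] at e1 e2
    rw [mgf] at e1 e2
    linarith
  have h2 : (k / γ) ^ k * (2 * Real.exp (k / 2)) = 2 * (Real.exp 1 * k * v) ^ (k / 2) := by
    have e1 : (k / γ) ^ k = (k * v) ^ (k / 2) := by
      have : (k / γ) ^ k = ((k / γ) ^ (2 : ℝ)) ^ (k / 2) := by
        rw [← Real.rpow_mul (by positivity)]; congr 1; ring
      rw [this, Real.rpow_two, div_pow, hγ2]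
      congr 1; field_simp
    rw [e1, mul_assoc (Real.exp 1), Real.mul_rpow (Real.exp_pos 1).le (by positivity),
      ← Real.exp_mul, one_mul]
    ring
  calc ∫⁻ ω, ‖X ω‖ₑ ^ k ∂P
      ≤ ∫⁻ ω, ENNReal.ofReal ((k / γ) ^ k * (Real.exp (γ * X ω) + Real.exp (-γ * X ω))) ∂P := by
        refine lintegral_mono fun ω => ?_
        rw [← ofReal_norm, ENNReal.ofReal_rpow_of_nonneg (norm_nonneg _) hk.le]
        exact ENNReal.ofReal_le_ofReal (hpt _)
    _ = ENNReal.ofReal (∫ ω, (k / γ) ^ k * (Real.exp (γ * X ω) + Real.exp (-γ * X ω)) ∂P) :=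
        (ofReal_integral_eq_lintegral_ofReal hi
          (Filter.Eventually.of_forall fun ω => by positivity)).symm
    _ ≤ ENNReal.ofReal (2 * (Real.exp 1 * k * v) ^ (k / 2)) :=
        ENNReal.ofReal_le_ofReal (h1.trans h2.le)
    _ = _ := by
        rw [ENNReal.ofReal_mul (by norm_num), ENNReal.ofReal_rpow_of_nonneg (by positivity)
          (by positivity)]
        simp

theorem hasSubgaussianMGF_of_expMomentBound {X : Ω → ℝ} (hX : Measurable X) {c : NNReal}
    (h : ExpMomentBound (P.map X) c) : HasSubgaussianMGF X (2 * c) P where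
  integrable_exp_mul t :=
    (integrable_map_measure (by fun_prop) hX.aemeasurable).1 (h t).1
  mgf_le t := by
    have h1 := (le_abs_self _).trans (h t).2
    rw [integral_map hX.aemeasurable (by fun_prop)] at h1
    refine h1.trans (le_of_eq ?_)
    congr 1
    push_cast
    ring

variable {d : ℕ} {g : (Fin d → ℤ) → Ω → ℂ} {c : NNReal}

/-- The real part of `g_n z` is subgaussian with variance proxy `2 c |z|²`; for the imaginary part,
apply this to `-i z`. -/
theorem IsRandomizer.hasSubgaussianMGF_re_mul (hg : IsRandomizer P g c) (n : Fin d → ℤ) (z : ℂ) :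
    HasSubgaussianMGF (fun ω => (g n ω * z).re) (‖z‖₊ ^ 2 * (2 * c)) P := by
  have hre := (hasSubgaussianMGF_of_expMomentBound (Complex.measurable_re.comp (hg.measurable n))
    (hg.bound_re n)).const_mul z.re
  have him := (hasSubgaussianMGF_of_expMomentBound (Complex.measurable_im.comp (hg.measurable n))
    (hg.bound_im n)).const_mul z.im
  have hind := (hg.indep_re_im n).comp (measurable_const_mul z.re) (measurable_const_mul z.im)
  have h := hre.sub_of_indepFun him hind
  convert h using 1
  · ext ω
    simp [Complex.mul_re]
    ring
  · ext
    change ‖z‖ ^ 2 * (2 * (c : ℝ)) = z.re ^ 2 * (2 * c) + z.im ^ 2 * (2 * c)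
    rw [← Complex.normSq_eq_norm_sq, Complex.normSq_apply]
    ring

variable [IsProbabilityMeasure P]

/-- Khintchine-type moment bound, with the growth `k^{k/2}` of gaussian moments. -/
theorem IsRandomizer.lintegral_enorm_sum_rpow_le (hg : IsRandomizer P g c)
    (F : Finset (Fin d → ℤ)) (z : (Fin d → ℤ) → ℂ) {k : ℝ} (hk : 0 < k) :
    ∫⁻ ω, ‖∑ n ∈ F, g n ω * z n‖ₑ ^ k ∂P
      ≤ 4 * (ENNReal.ofReal (4 * Real.exp 1 * c * k) * ∑ n ∈ F, ‖z n‖ₑ ^ 2) ^ (k / 2) := by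
  have hre : ∀ y : (Fin d → ℤ) → ℂ, ∫⁻ ω, ‖∑ n ∈ F, (g n ω * y n).re‖ₑ ^ k ∂P
      ≤ 2 * (ENNReal.ofReal (2 * Real.exp 1 * c * k) * ∑ n ∈ F, ‖y n‖ₑ ^ 2) ^ (k / 2) := by
    intro y
    have hind : iIndepFun (fun n ω => (g n ω * y n).re) P :=
      hg.indep.comp (fun n w => (w * y n).re) fun n => by fun_prop
    have hs := HasSubgaussianMGF.sum_of_iIndepFun hind (s := F)
      fun n _ => hg.hasSubgaussianMGF_re_mul n (y n)
    refine (lintegral_enorm_rpow_le_of_hasSubgaussianMGF hs hk).trans (le_of_eq ?_)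
    congr 2
    rw [← Finset.sum_mul]
    have : (∑ n ∈ F, ‖y n‖ₑ ^ 2) = ENNReal.ofReal ((∑ n ∈ F, ‖y n‖₊ ^ 2 : NNReal) : ℝ) := by
      rw [ENNReal.ofReal_coe_nnreal]
      push_cast
      rfl
    rw [this, ← ENNReal.ofReal_mul (by positivity)]
    congr 1
    push_cast
    ring
  have hpt : ∀ w : ℂ, ‖w‖ₑ ^ k ≤ 2 ^ (k / 2) * (‖w.re‖ₑ ^ k + ‖w.im‖ₑ ^ k) := by
    intro w
    have hsq : ∀ y : ℝ≥0∞, y ^ k = (y ^ 2) ^ (k / 2) := fun y => by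
      rw [← ENNReal.rpow_two, ← ENNReal.rpow_mul]; congr 1; ring
    have h1 : ‖w‖ₑ ^ 2 = ‖w.re‖ₑ ^ 2 + ‖w.im‖ₑ ^ 2 := by
      simp only [← ofReal_norm, ← ENNReal.ofReal_pow (norm_nonneg _)]
      rw [← ENNReal.ofReal_add (by positivity) (by positivity), ← Complex.normSq_eq_norm_sq,
        Complex.normSq_apply, Real.norm_eq_abs, Real.norm_eq_abs, sq_abs, sq_abs]
      congr 1; ring
    have h2 : ‖w‖ₑ ^ 2 ≤ 2 * max (‖w.re‖ₑ ^ 2) (‖w.im‖ₑ ^ 2) := by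
      rw [h1, two_mul]
      exact add_le_add (le_max_left _ _) (le_max_right _ _)
    rw [hsq]
    refine (ENNReal.rpow_le_rpow h2 (by positivity)).trans ?_
    rw [ENNReal.mul_rpow_of_nonneg _ _ (by positivity)]
    refine mul_le_mul_right ?_ _
    rcases max_cases (‖w.re‖ₑ ^ 2) (‖w.im‖ₑ ^ 2) with ⟨h, -⟩ | ⟨h, -⟩ <;> rw [h, ← hsq]
    · exact le_self_add
    · exact le_add_self
  have hI : ∀ ω, (∑ n ∈ F, g n ω * z n).im = ∑ n ∈ F, (g n ω * (-Complex.I * z n)).re := by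
    intro ω
    rw [Complex.im_sum]
    refine Finset.sum_congr rfl fun n _ => ?_
    simp [Complex.mul_re, Complex.mul_im]
    ring
  have hm : Measurable fun ω => ‖∑ n ∈ F, (g n ω * z n).re‖ₑ ^ k :=
    ((Finset.measurable_sum F fun n _ => Complex.measurable_re.comp
      ((hg.measurable n).mul_const _)).enorm).pow_const k
  calc ∫⁻ ω, ‖∑ n ∈ F, g n ω * z n‖ₑ ^ k ∂P
      ≤ ∫⁻ ω, 2 ^ (k / 2) * (‖∑ n ∈ F, (g n ω * z n).re‖ₑ ^ k
          + ‖∑ n ∈ F, (g n ω * (-Complex.I * z n)).re‖ₑ ^ k) ∂P := by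
        refine lintegral_mono fun ω => (hpt _).trans (le_of_eq ?_)
        rw [hI, Complex.re_sum]
    _ = 2 ^ (k / 2) * (∫⁻ ω, ‖∑ n ∈ F, (g n ω * z n).re‖ₑ ^ k ∂P
          + ∫⁻ ω, ‖∑ n ∈ F, (g n ω * (-Complex.I * z n)).re‖ₑ ^ k ∂P) := by
        rw [lintegral_const_mul' _ _ (ENNReal.rpow_ne_top_of_nonneg (by positivity) (by norm_num)),
          lintegral_add_left hm]
    _ ≤ 2 ^ (k / 2) * (2 * (ENNReal.ofReal (2 * Real.exp 1 * c * k)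
          * ∑ n ∈ F, ‖z n‖ₑ ^ 2) ^ (k / 2) + 2 * (ENNReal.ofReal (2 * Real.exp 1 * c * k)
          * ∑ n ∈ F, ‖z n‖ₑ ^ 2) ^ (k / 2)) := by
        refine mul_le_mul_right (add_le_add (hre z) ((hre _).trans (le_of_eq ?_))) _
        have hIn : ‖Complex.I‖ₑ = 1 := by rw [← ofReal_norm, Complex.norm_I, ENNReal.ofReal_one]
        simp [enorm_mul, hIn]
    _ = _ := by
        rw [← two_mul, ← mul_assoc 2 2, mul_left_comm, ← ENNReal.mul_rpow_of_nonneg _ _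
          (by positivity), ← mul_assoc 2 (ENNReal.ofReal _)]
        have : (2 : ℝ≥0∞) * ENNReal.ofReal (2 * Real.exp 1 * c * k)
            = ENNReal.ofReal (4 * Real.exp 1 * c * k) := by
          rw [show (2 : ℝ≥0∞) = ENNReal.ofReal 2 by simp, ← ENNReal.ofReal_mul (by norm_num)]
          congr 1; ring
        rw [this]
        norm_num

end Probability

/-! ### Minkowski's inequality for mixed norms -/

section MixedNorm

variable {α β γ : Type*} [MeasurableSpace α] [MeasurableSpace β] [MeasurableSpace γ]
  {μ : Measure α} {σ : Measure β} {ν : Measure γ}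

/-- The mixed norm `‖Z‖_{L^q(σ; L^ρ(ν))}` of a nonnegative function, for finite exponents. -/
noncomputable def mixedNorm (σ : Measure β) (ν : Measure γ) (q ρ : ℝ) (Z : β → γ → ℝ≥0∞) : ℝ≥0∞ :=
  (∫⁻ t, (∫⁻ x, Z t x ^ ρ ∂ν) ^ (q / ρ) ∂σ) ^ (1 / q)

theorem mixedNorm_mono {q ρ : ℝ} (hq : 0 < q) (hρ : 0 < ρ) {Y Z : β → γ → ℝ≥0∞}
    (h : ∀ t x, Y t x ≤ Z t x) : mixedNorm σ ν q ρ Y ≤ mixedNorm σ ν q ρ Z :=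
  ENNReal.rpow_le_rpow (lintegral_mono fun t => ENNReal.rpow_le_rpow (lintegral_mono fun x =>
    ENNReal.rpow_le_rpow (h t x) hρ.le) (by positivity)) (by positivity)

theorem mixedNorm_const_mul {q ρ : ℝ} (hq : 0 < q) (hρ : 0 < ρ) {Z : β → γ → ℝ≥0∞}
    {m : ℝ≥0∞} (hm : m ≠ ⊤) :
    mixedNorm σ ν q ρ (fun t x => m * Z t x) = m * mixedNorm σ ν q ρ Z := by
  have h1 : ∀ t, (∫⁻ x, (m * Z t x) ^ ρ ∂ν) ^ (q / ρ) = m ^ q * (∫⁻ x, Z t x ^ ρ ∂ν) ^ (q / ρ) := by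
    intro t
    simp_rw [ENNReal.mul_rpow_of_nonneg _ _ hρ.le]
    rw [lintegral_const_mul' _ _ (ENNReal.rpow_ne_top_of_nonneg hρ.le hm),
      ENNReal.mul_rpow_of_nonneg _ _ (by positivity), ← ENNReal.rpow_mul]
    congr 2
    field_simp
  simp_rw [mixedNorm, h1]
  rw [lintegral_const_mul' _ _ (ENNReal.rpow_ne_top_of_nonneg hq.le hm),
    ENNReal.mul_rpow_of_nonneg _ _ (by positivity), ← ENNReal.rpow_mul, mul_one_div_cancel hq.ne',
    ENNReal.rpow_one]

variable [SFinite μ] [SFinite σ] [SFinite ν]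

/-- Minkowski's inequality, moving a larger exponent inside a mixed norm. -/
theorem lintegral_mixedNorm_rpow_le {q ρ k : ℝ} (hq : 0 < q) (hρ : 0 < ρ) (hqk : q ≤ k)
    (hρk : ρ ≤ k) {Z : α → β → γ → ℝ≥0∞}
    (hZ : Measurable fun z : α × β × γ => Z z.1 z.2.1 z.2.2) :
    (∫⁻ a, mixedNorm σ ν q ρ (Z a) ^ k ∂μ) ^ (1 / k)
      ≤ mixedNorm σ ν q ρ fun t x => (∫⁻ a, Z a t x ^ k ∂μ) ^ (1 / k) := by
  have hk : 0 < k := hq.trans_le hqk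
  have hin : Measurable (Function.uncurry fun (a : α) (t : β) => ∫⁻ x, Z a t x ^ ρ ∂ν) := by
    have : Measurable fun z : (α × β) × γ => Z z.1.1 z.1.2 z.2 ^ ρ :=
      (hZ.comp (MeasurableEquiv.prodAssoc.measurable)).pow_const ρ
    exact this.lintegral_prod_right'
  have h1 := lintegral_rpow_lintegral_le μ σ
    (f := fun a t => (∫⁻ x, Z a t x ^ ρ ∂ν) ^ (q / ρ)) (hin.pow_const (q / ρ)) (s := k / q) (by rwa [le_div_iff₀ hq, one_mul])
  have h2 : ∀ t, (∫⁻ a, ((∫⁻ x, Z a t x ^ ρ ∂ν) ^ (q / ρ)) ^ (k / q) ∂μ) ^ (1 / (k / q))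
      ≤ (∫⁻ x, ((∫⁻ a, Z a t x ^ k ∂μ) ^ (1 / k)) ^ ρ ∂ν) ^ (q / ρ) := by
    intro t
    have hm : Measurable (Function.uncurry fun (a : α) (x : γ) => Z a t x ^ ρ) :=
      (hZ.comp (measurable_fst.prodMk (measurable_const.prodMk measurable_snd))).pow_const ρ
    have h3 := ENNReal.rpow_le_rpow (lintegral_rpow_lintegral_le μ ν hm (s := k / ρ)
      (by rwa [le_div_iff₀ hρ, one_mul])) (show 0 ≤ q / ρ by positivity)
    rw [← ENNReal.rpow_mul] at h3
    have e1 : ∀ a, ((∫⁻ x, Z a t x ^ ρ ∂ν) ^ (q / ρ)) ^ (k / q) = (∫⁻ x, Z a t x ^ ρ ∂ν) ^ (k / ρ) :=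
      fun a => by rw [← ENNReal.rpow_mul]; congr 1; field_simp
    have e2 : ∀ x, (∫⁻ a, (Z a t x ^ ρ) ^ (k / ρ) ∂μ) ^ (1 / (k / ρ))
        = ((∫⁻ a, Z a t x ^ k ∂μ) ^ (1 / k)) ^ ρ := fun x => by
      rw [← ENNReal.rpow_mul, one_div_div, one_div_mul_eq_div]
      congr 1
      refine lintegral_congr fun a => ?_
      rw [← ENNReal.rpow_mul]; congr 1; field_simp
    simp_rw [e1]
    simp_rw [e2] at h3
    refine le_trans (le_of_eq ?_) h3
    congr 1; field_simp
  have h4 := ENNReal.rpow_le_rpow (h1.trans (lintegral_mono h2)) (show 0 ≤ 1 / q by positivity)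
  refine le_trans (le_of_eq ?_) h4
  rw [← ENNReal.rpow_mul]
  have e3 : 1 / (k / q) * (1 / q) = 1 / k := by field_simp
  rw [e3]
  congr 1
  refine lintegral_congr fun a => ?_
  rw [mixedNorm, ← ENNReal.rpow_mul]
  congr 1; field_simp

/-- Minkowski's inequality, moving a smaller exponent outside a mixed norm. -/
theorem mixedNorm_lintegral_rpow_le {q ρ k : ℝ} (hk : 0 < k) (hqk : k ≤ q) (hρk : k ≤ ρ)
    {Z : α → β → γ → ℝ≥0∞} (hZ : Measurable fun z : α × β × γ => Z z.1 z.2.1 z.2.2) :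
    (mixedNorm σ ν q ρ fun t x => (∫⁻ a, Z a t x ^ k ∂μ) ^ (1 / k))
      ≤ (∫⁻ a, mixedNorm σ ν q ρ (Z a) ^ k ∂μ) ^ (1 / k) := by
  have hq : 0 < q := hk.trans_le hqk
  have hρ : 0 < ρ := hk.trans_le hρk
  have hin : Measurable (Function.uncurry fun (t : β) (a : α) => ∫⁻ x, Z a t x ^ ρ ∂ν) := by
    have : Measurable fun z : (β × α) × γ => Z z.1.2 z.1.1 z.2 ^ ρ :=
      (hZ.comp (measurable_fst.snd.prodMk (measurable_fst.fst.prodMk measurable_snd))).pow_const ρ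
    exact this.lintegral_prod_right'
  have h1 := lintegral_rpow_lintegral_le σ μ
    (f := fun t a => (∫⁻ x, Z a t x ^ ρ ∂ν) ^ (k / ρ)) (hin.pow_const (k / ρ)) (s := q / k) (by rwa [le_div_iff₀ hk, one_mul])
  have h2 : ∀ t, (∫⁻ x, ((∫⁻ a, Z a t x ^ k ∂μ) ^ (1 / k)) ^ ρ ∂ν) ^ (q / ρ)
      ≤ (∫⁻ a, (∫⁻ x, Z a t x ^ ρ ∂ν) ^ (k / ρ) ∂μ) ^ (q / k) := by
    intro t
    have hm : Measurable (Function.uncurry fun (x : γ) (a : α) => Z a t x ^ k) :=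
      (hZ.comp (measurable_snd.prodMk (measurable_const.prodMk measurable_fst))).pow_const k
    have h3 := ENNReal.rpow_le_rpow (lintegral_rpow_lintegral_le ν μ hm (s := ρ / k)
      (by rwa [le_div_iff₀ hk, one_mul])) (show 0 ≤ q / k by positivity)
    rw [← ENNReal.rpow_mul] at h3
    have e1 : ∀ x, ((∫⁻ a, Z a t x ^ k ∂μ) ^ (1 / k)) ^ ρ = (∫⁻ a, Z a t x ^ k ∂μ) ^ (ρ / k) :=
      fun a => by rw [← ENNReal.rpow_mul]; congr 1; field_simp
    have e2 : ∀ a, (∫⁻ x, (Z a t x ^ k) ^ (ρ / k) ∂ν) ^ (1 / (ρ / k))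
        = (∫⁻ x, Z a t x ^ ρ ∂ν) ^ (k / ρ) := fun a => by
      rw [one_div_div]
      congr 1
      refine lintegral_congr fun x => ?_
      rw [← ENNReal.rpow_mul]; congr 1; field_simp
    simp_rw [e1]
    simp_rw [e2] at h3
    refine le_trans (le_of_eq ?_) h3
    congr 1; field_simp
  have h4 := ENNReal.rpow_le_rpow h1 (show 0 ≤ 1 / k by positivity)
  rw [← ENNReal.rpow_mul] at h4
  have e3 : 1 / (q / k) * (1 / k) = 1 / q := by field_simp
  rw [e3] at h4
  refine (ENNReal.rpow_le_rpow (lintegral_mono h2) (by positivity)).trans (h4.trans (le_of_eq ?_))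
  congr 1
  refine lintegral_congr fun a => ?_
  rw [mixedNorm, ← ENNReal.rpow_mul, one_div_div, one_div_mul_eq_div]
  congr 1
  refine lintegral_congr fun t => ?_
  rw [← ENNReal.rpow_mul]
  congr 1; field_simp

end MixedNorm

/-! ### Randomised sums in `L²` -/

section Sums

variable {d : ℕ} {ψ : 𝓢(Space d, ℂ)}

/-- The Fourier transform of `ψ(D - n) φ`. -/
noncomputable def windowedFourier (ψ : 𝓢(Space d, ℂ)) (φ : L2 d) (n : Fin d → ℤ) (ξ : Space d) : ℂ :=
  ψ (ξ - latticePoint n) * (𝓕 φ : L2 d) ξ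

theorem measurable_coeFn_fourier (φ : L2 d) : Measurable ⇑(𝓕 φ : L2 d) :=
  (Lp.stronglyMeasurable _).measurable

theorem coeFn_fourier_windowProj (φ : L2 d) (n : Fin d → ℤ) :
    ⇑(𝓕 (windowProj ψ n φ) : L2 d) =ᵐ[volume] windowedFourier ψ φ n :=
  coeFn_fourier_fourierMultiplier _ _

theorem integrable_windowedFourier (hψ : IsWienerWindow ψ) (φ : L2 d) (n : Fin d → ℤ) :
    Integrable (windowedFourier ψ φ n) := by
  obtain ⟨M, hM⟩ := exists_norm_schwartz_le ψ
  have h := (integrable_indicator_latticeCube (Lp.memLp (𝓕 φ : L2 d)) n).bdd_mul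
    (f := fun ξ => ψ (ξ - latticePoint n)) (c := M)
    (ψ.continuous.comp (continuous_id.sub continuous_const)).aestronglyMeasurable
    (Filter.Eventually.of_forall fun ξ => hM _)
  rwa [window_mul_indicator hψ] at h

theorem coeFn_fourier_sum_windowProj (φ : L2 d) (F : Finset (Fin d → ℤ)) (c : (Fin d → ℤ) → ℂ) :
    ⇑(𝓕 (∑ n ∈ F, c n • windowProj ψ n φ) : L2 d)
      =ᵐ[volume] fun ξ => ∑ n ∈ F, c n * windowedFourier ψ φ n ξ := by
  rw [FourierTransform.fourier_sum]
  simp_rw [FourierTransform.fourier_smul]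
  refine (Lp.coeFn_finsetSum _ _).trans ?_
  have h : ∀ᵐ ξ, ∀ n ∈ F, (c n • (𝓕 (windowProj ψ n φ) : L2 d)) ξ = c n * windowedFourier ψ φ n ξ := by
    rw [Filter.eventually_all_finset]
    intro n _
    filter_upwards [Lp.coeFn_smul (c n) (𝓕 (windowProj ψ n φ) : L2 d),
      coeFn_fourier_windowProj (ψ := ψ) φ n] with ξ h1 h2
    rw [h1, Pi.smul_apply, h2, smul_eq_mul]
  filter_upwards [h] with ξ hξ
  rw [Finset.sum_apply]
  exact Finset.sum_congr rfl hξ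

theorem evolution_sum {ι : Type*} (F : Finset ι) (c : ι → ℂ) {w : ι → Space d → ℂ}
    (hw : ∀ n, Integrable (w n)) (t : ℝ) (x : Space d) :
    evolution (fun ξ => ∑ n ∈ F, c n * w n ξ) t x = ∑ n ∈ F, c n * evolution (w n) t x := by
  simp_rw [evolution_eq, Finset.mul_sum]
  rw [integral_finsetSum]
  · refine Finset.sum_congr rfl fun n _ => ?_
    rw [← integral_const_mul]
    refine integral_congr_ae (Filter.Eventually.of_forall fun ξ => ?_)
    simp only
    ring
  · intro n _
    refine (integrable_schrodingerSymbol_mul ((hw n).const_mul (c n)) t).bdd_mul (c := 1)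
      (Continuous.aestronglyMeasurable (by fun_prop)) (Filter.Eventually.of_forall fun ξ => ?_)
    rw [Complex.norm_exp_ofReal_mul_I]

theorem coeFn_schrodinger_sum (hψ : IsWienerWindow ψ) (φ : L2 d) (F : Finset (Fin d → ℤ))
    (c : (Fin d → ℤ) → ℂ) (t : ℝ) :
    ⇑(schrodinger t (∑ n ∈ F, c n • windowProj ψ n φ))
      =ᵐ[volume] fun x => ∑ n ∈ F, c n * evolution (windowedFourier ψ φ n) t x := by
  have h := coeFn_schrodinger (coeFn_fourier_sum_windowProj (ψ := ψ) φ F c)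
    (integrable_finsetSum F fun n _ => (integrable_windowedFourier hψ φ n).const_mul (c n)) t
  filter_upwards [h] with x hx
  rw [hx, evolution_sum F c (integrable_windowedFourier hψ φ)]

theorem enorm_sq_eq_lintegral (f : L2 d) : ‖f‖ₑ ^ 2 = ∫⁻ x, ‖f x‖ₑ ^ 2 := by
  rw [Lp.enorm_def, eLpNorm_eq_lintegral_rpow_enorm_toReal (by norm_num) (by norm_num),
    ← ENNReal.rpow_two (_ ^ _), ← ENNReal.rpow_mul]
  simp

theorem enorm_fourier_eq (f : L2 d) : ‖(𝓕 f : L2 d)‖ₑ = ‖f‖ₑ := by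
  rw [← ofReal_norm, ← ofReal_norm, Lp.norm_fourier_eq]

theorem enorm_windowProj_sq_eq (φ : L2 d) (n : Fin d → ℤ) :
    ‖windowProj ψ n φ‖ₑ ^ 2 = ∫⁻ ξ, ‖windowedFourier ψ φ n ξ‖ₑ ^ 2 := by
  rw [← enorm_fourier_eq, enorm_sq_eq_lintegral]
  refine lintegral_congr_ae ?_
  filter_upwards [coeFn_fourier_windowProj (ψ := ψ) φ n] with ξ hξ
  rw [hξ]

theorem measurable_windowedFourier (φ : L2 d) (n : Fin d → ℤ) :
    Measurable (windowedFourier ψ φ n) :=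
  (ψ.continuous.comp (continuous_id.sub continuous_const)).measurable.mul
    (measurable_coeFn_fourier φ)

/-- Almost orthogonality of the pieces `ψ(D - n) φ`. -/
theorem enorm_sum_windowProj_sq_le (hψ : IsWienerWindow ψ) (φ : L2 d) (F : Finset (Fin d → ℤ))
    (c : (Fin d → ℤ) → ℂ) :
    ‖∑ n ∈ F, c n • windowProj ψ n φ‖ₑ ^ 2
      ≤ 3 ^ d * ∑ n ∈ F, ‖c n‖ₑ ^ 2 * ‖windowProj ψ n φ‖ₑ ^ 2 := by
  have hpt : ∀ ξ, ‖∑ n ∈ F, c n * windowedFourier ψ φ n ξ‖ₑ ^ 2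
      ≤ 3 ^ d * ∑ n ∈ F, ‖c n‖ₑ ^ 2 * ‖windowedFourier ψ φ n ξ‖ₑ ^ 2 := by
    intro ξ
    have hsub : ∑ n ∈ F, c n * windowedFourier ψ φ n ξ
        = ∑ n ∈ F.filter (· ∈ nearbyLattice ξ), c n * windowedFourier ψ φ n ξ := by
      refine (Finset.sum_filter_of_ne fun n _ hn => mem_nearbyLattice
        (mem_latticeCube_of_window_ne_zero hψ fun h0 => hn ?_)).symm
      simp [windowedFourier, h0]
    have hcard : ((F.filter (· ∈ nearbyLattice ξ)).card : ℝ) ≤ 3 ^ d := by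
      have := Finset.card_le_card (show F.filter (· ∈ nearbyLattice ξ) ⊆ nearbyLattice ξ from
        fun n hn => (Finset.mem_filter.1 hn).2)
      rw [card_nearbyLattice] at this
      exact_mod_cast this
    have hreal : ‖∑ n ∈ F, c n * windowedFourier ψ φ n ξ‖ ^ 2
        ≤ 3 ^ d * ∑ n ∈ F, ‖c n‖ ^ 2 * ‖windowedFourier ψ φ n ξ‖ ^ 2 := by
      rw [hsub]
      calc ‖∑ n ∈ F.filter (· ∈ nearbyLattice ξ), c n * windowedFourier ψ φ n ξ‖ ^ 2
          ≤ (∑ n ∈ F.filter (· ∈ nearbyLattice ξ), ‖c n * windowedFourier ψ φ n ξ‖) ^ 2 :=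
            pow_le_pow_left₀ (norm_nonneg _) (norm_sum_le _ _) 2
        _ ≤ (F.filter (· ∈ nearbyLattice ξ)).card
              * ∑ n ∈ F.filter (· ∈ nearbyLattice ξ), ‖c n * windowedFourier ψ φ n ξ‖ ^ 2 :=
            sq_sum_le_card_mul_sum_sq
        _ ≤ 3 ^ d * ∑ n ∈ F, ‖c n * windowedFourier ψ φ n ξ‖ ^ 2 :=
            mul_le_mul hcard (Finset.sum_le_sum_of_subset_of_nonneg (Finset.filter_subset _ _)
              fun n _ _ => by positivity) (Finset.sum_nonneg fun n _ => by positivity)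
              (by positivity)
        _ = _ := by simp_rw [norm_mul, mul_pow]
    have h := ENNReal.ofReal_le_ofReal hreal
    rw [ENNReal.ofReal_mul (by positivity),
      ENNReal.ofReal_sum_of_nonneg fun n _ => by positivity] at h
    simp_rw [ENNReal.ofReal_mul (sq_nonneg _), ENNReal.ofReal_pow (norm_nonneg _), ofReal_norm] at h
    simpa using h
  rw [← enorm_fourier_eq, enorm_sq_eq_lintegral]
  calc ∫⁻ ξ, ‖(𝓕 (∑ n ∈ F, c n • windowProj ψ n φ) : L2 d) ξ‖ₑ ^ 2
      = ∫⁻ ξ, ‖∑ n ∈ F, c n * windowedFourier ψ φ n ξ‖ₑ ^ 2 := by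
        refine lintegral_congr_ae ?_
        filter_upwards [coeFn_fourier_sum_windowProj (ψ := ψ) φ F c] with ξ hξ
        rw [hξ]
    _ ≤ ∫⁻ ξ, 3 ^ d * ∑ n ∈ F, ‖c n‖ₑ ^ 2 * ‖windowedFourier ψ φ n ξ‖ₑ ^ 2 := lintegral_mono hpt
    _ = _ := by
        rw [lintegral_const_mul' _ _ (by finiteness), lintegral_finsetSum]
        · simp_rw [enorm_windowProj_sq_eq]
          congr 1
          refine Finset.sum_congr rfl fun n _ => ?_
          rw [lintegral_const_mul' _ _ (by finiteness)]
        · exact fun n _ => ((measurable_windowedFourier φ n).enorm.pow_const 2).const_mul _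

theorem tsum_enorm_windowProj_sq_lt_top (hψ : IsWienerWindow ψ) (φ : L2 d) :
    ∑' n, ‖windowProj ψ n φ‖ₑ ^ 2 < ⊤ := by
  obtain ⟨M, hM⟩ := exists_norm_schwartz_le ψ
  have hterm : ∀ n, ‖windowProj ψ n φ‖ₑ ^ 2
      ≤ ENNReal.ofReal M ^ 2 * ∫⁻ ξ in latticeCube n, ‖(𝓕 φ : L2 d) ξ‖ₑ ^ 2 := by
    intro n
    rw [enorm_windowProj_sq_eq, ← lintegral_indicator (isClosed_latticeCube n).measurableSet,
      ← lintegral_const_mul' _ _ (by finiteness)]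
    refine lintegral_mono fun ξ => ?_
    rw [windowedFourier, enorm_mul, mul_pow]
    by_cases h : ψ (ξ - latticePoint n) = 0
    · simp [h]
    · rw [Set.indicator_of_mem (mem_latticeCube_of_window_ne_zero hψ h)]
      refine mul_le_mul_left (pow_le_pow_left' ?_ 2) _
      rw [← ofReal_norm]
      exact ENNReal.ofReal_le_ofReal (hM _)
  refine (ENNReal.tsum_le_tsum hterm).trans_lt ?_
  rw [ENNReal.tsum_mul_left]
  refine ENNReal.mul_lt_top (by finiteness) ((tsum_lintegral_latticeCube_le _
    ((measurable_coeFn_fourier φ).enorm.pow_const 2)).trans_lt ?_)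
  rw [← enorm_sq_eq_lintegral]
  finiteness

theorem summable_smul_windowProj (hψ : IsWienerWindow ψ) (φ : L2 d) {c : (Fin d → ℤ) → ℂ}
    (hc : ∑' n, ‖c n‖ₑ ^ 2 * ‖windowProj ψ n φ‖ₑ ^ 2 ≠ ⊤) :
    Summable fun n => c n • windowProj ψ n φ := by
  have hfin : ∀ n, ‖c n‖ₑ ^ 2 * ‖windowProj ψ n φ‖ₑ ^ 2
      = ENNReal.ofReal (‖c n‖ ^ 2 * ‖windowProj ψ n φ‖ ^ 2) := fun n => by
    rw [ENNReal.ofReal_mul (sq_nonneg _), ENNReal.ofReal_pow (norm_nonneg _),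
      ENNReal.ofReal_pow (norm_nonneg _), ofReal_norm, ofReal_norm]
  have hs : Summable fun n => ‖c n‖ ^ 2 * ‖windowProj ψ n φ‖ ^ 2 := by
    simp_rw [hfin] at hc
    refine (ENNReal.summable_toReal hc).congr fun n => ?_
    rw [ENNReal.toReal_ofReal (by positivity)]
  rw [summable_iff_vanishing_norm] at hs ⊢
  intro ε hε
  obtain ⟨s, hs⟩ := hs (ε ^ 2 / 3 ^ d) (by positivity)
  refine ⟨s, fun t ht => ?_⟩
  have h1 := hs t ht
  rw [Real.norm_eq_abs, abs_of_nonneg (Finset.sum_nonneg fun n _ => by positivity),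
    lt_div_iff₀ (by positivity)] at h1
  have h2 := enorm_sum_windowProj_sq_le hψ φ t c
  simp_rw [hfin] at h2
  rw [← ENNReal.ofReal_sum_of_nonneg fun n _ => by positivity, ← ofReal_norm,
    ← ENNReal.ofReal_pow (norm_nonneg _),
    show (3 : ℝ≥0∞) ^ d = ENNReal.ofReal (3 ^ d) by simp [ENNReal.ofReal_pow],
    ← ENNReal.ofReal_mul (by positivity), ENNReal.ofReal_le_ofReal_iff
      (mul_nonneg (by positivity) (Finset.sum_nonneg fun n _ => by positivity))] at h2
  exact lt_of_pow_lt_pow_left₀ 2 hε.le (by linarith)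

/-- Almost sure unconditional convergence of the Wiener randomization. -/
theorem ae_summable_randomTerm (hψ : IsWienerWindow ψ) {Ω : Type*} [MeasurableSpace Ω]
    {P : Measure Ω} [IsProbabilityMeasure P] {g : (Fin d → ℤ) → Ω → ℂ} {c : NNReal}
    (hg : IsRandomizer P g c) (φ : L2 d) : ∀ᵐ ω ∂P, Summable (randomTerm ψ g φ ω) := by
  have hmom : ∀ n, ∫⁻ ω, ‖g n ω‖ₑ ^ 2 ∂P ≤ 4 * ENNReal.ofReal (4 * Real.exp 1 * c * 2) := fun n => by
    have := hg.lintegral_enorm_sum_rpow_le {n} (fun _ => 1) (k := 2) (by norm_num)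
    simpa using this
  have hm : ∀ n, Measurable fun ω => ‖g n ω‖ₑ ^ 2 * ‖windowProj ψ n φ‖ₑ ^ 2 := fun n =>
    ((hg.measurable n).enorm.pow_const 2).mul_const _
  have hfin : ∫⁻ ω, ∑' n, ‖g n ω‖ₑ ^ 2 * ‖windowProj ψ n φ‖ₑ ^ 2 ∂P ≠ ⊤ := by
    rw [lintegral_tsum fun n => (hm n).aemeasurable]
    refine ne_top_of_le_ne_top ?_ (ENNReal.tsum_le_tsum fun n => ?_)
      (b := ∑' n, 4 * ENNReal.ofReal (4 * Real.exp 1 * c * 2) * ‖windowProj ψ n φ‖ₑ ^ 2)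
    · rw [ENNReal.tsum_mul_left]
      exact ENNReal.mul_ne_top (by finiteness) (tsum_enorm_windowProj_sq_lt_top hψ φ).ne
    · rw [lintegral_mul_const' _ _ (by finiteness)]
      exact mul_le_mul_left (hmom n) _
  filter_upwards [ae_lt_top (Measurable.tsum hm) hfin] with ω hω
  exact summable_smul_windowProj hψ φ hω.ne

theorem norm_schrodinger_sub (t : ℝ) (f h : L2 d) :
    ‖schrodinger t f - schrodinger t h‖ = ‖f - h‖ := by
  have hsub : ∀ a b : L2 d, (𝓕 (a - b) : L2 d) = 𝓕 a - 𝓕 b := fun a b =>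
    map_sub (FourierTransform.fourierₗ ℂ (L2 d)) a b
  rw [← Lp.norm_fourier_eq (f - h), ← Lp.norm_fourier_eq (schrodinger t f - _), hsub, hsub,
    Lp.norm_def, Lp.norm_def]
  congr 1
  refine eLpNorm_congr_norm_ae ?_
  filter_upwards [Lp.coeFn_sub (𝓕 (schrodinger t f) : L2 d) (𝓕 (schrodinger t h)),
    Lp.coeFn_sub (𝓕 f : L2 d) (𝓕 h),
    coeFn_fourier_fourierMultiplier (memLp_schrodingerSymbol t) f,
    coeFn_fourier_fourierMultiplier (memLp_schrodingerSymbol t) h] with ξ h1 h2 h3 h4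
  rw [h1, h2, Pi.sub_apply, Pi.sub_apply, schrodinger, schrodinger, h3, h4, ← mul_sub, norm_mul,
    norm_schrodingerSymbol, one_mul]

theorem eLpNorm_le_liminf_of_tendstoInMeasure {α E : Type*} [MeasurableSpace α] {μ : Measure α}
    [NormedAddCommGroup E] {f : ℕ → α → E} {h : α → E} {p : ℝ≥0∞}
    (hf : ∀ j, AEStronglyMeasurable (f j) μ) (hlim : TendstoInMeasure μ f Filter.atTop h) :
    eLpNorm h p μ ≤ Filter.liminf (fun j => eLpNorm (f j) p μ) Filter.atTop := by
  by_contra! hlt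
  obtain ⟨C, hC1, hC2⟩ := exists_between hlt
  have hfreq := Filter.frequently_lt_of_liminf_lt (by isBoundedDefault) hC1
  have hne : (Filter.atTop ⊓ Filter.principal {j | eLpNorm (f j) p μ < C}).NeBot :=
    Filter.frequently_mem_iff_neBot.1 hfreq
  refine absurd (eLpNorm_le_of_tendstoInMeasure (C := C) ?_
    (fun ε hε => (hlim ε hε).mono_left inf_le_left) hf
    (u := Filter.atTop ⊓ Filter.principal {j | eLpNorm (f j) p μ < C})) hC2.not_ge
  exact Filter.eventually_inf_principal.2 (Filter.Eventually.of_forall fun j hj => le_of_lt hj)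

/-- Lower semicontinuity of the space-time norm along `L²`-convergent sequences. -/
theorem strichartzNorm_le_liminf {q ρ : ℝ} (hq : 0 < q) (hρ : 0 < ρ) {f : ℕ → L2 d} {h : L2 d}
    (hlim : Filter.Tendsto f Filter.atTop (nhds h)) {u : ℕ → ℝ → Space d → ℂ}
    (hum : ∀ j, Measurable (Function.uncurry (u j)))
    (hu : ∀ j t, ⇑(schrodinger t (f j)) =ᵐ[volume] u j t) :
    strichartzNorm (ENNReal.ofReal q) (ENNReal.ofReal ρ) h
      ≤ Filter.liminf (fun j => mixedNorm volume volume q ρ fun t x => ‖u j t x‖ₑ) Filter.atTop := by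
  set e : ℕ → ℝ → ℝ≥0∞ := fun j t => ∫⁻ x, ‖u j t x‖ₑ ^ ρ with he
  have hem : ∀ j, Measurable (e j) := fun j =>
    ((hum j).enorm.pow_const ρ).lintegral_prod_right'
  have ht : ∀ t, eLpNorm (schrodinger t h) (ENNReal.ofReal ρ) volume
      ≤ Filter.liminf (fun j => e j t ^ (1 / ρ)) Filter.atTop := by
    intro t
    have hL2 : Filter.Tendsto (fun j => schrodinger t (f j)) Filter.atTop
        (nhds (schrodinger t h)) := by
      rw [tendsto_iff_norm_sub_tendsto_zero] at hlim ⊢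
      simpa only [norm_schrodinger_sub] using hlim
    refine (eLpNorm_le_liminf_of_tendstoInMeasure (fun j => (Lp.stronglyMeasurable
      (schrodinger t (f j))).aestronglyMeasurable)
      (tendstoInMeasure_of_tendsto_Lp hL2)).trans (le_of_eq ?_)
    congr 1
    ext j
    rw [eLpNorm_congr_ae (hu j t), eLpNorm_eq_lintegral_rpow_enorm_toReal (by simpa using hρ)
      (by simp), ENNReal.toReal_ofReal hρ.le]
  have hlift : ∀ {s : ℝ}, 0 < s → ∀ y : ℕ → ℝ≥0∞, (Filter.liminf y Filter.atTop) ^ s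
      = Filter.liminf (fun j => y j ^ s) Filter.atTop := fun {s} hs y =>
    (ENNReal.orderIsoRpow s hs).liminf_apply
  rw [strichartzNorm, eLpNorm_eq_lintegral_rpow_enorm_toReal (by simpa using hq) (by simp),
    ENNReal.toReal_ofReal hq.le]
  simp_rw [enorm_eq_self, mixedNorm]
  rw [← hlift (by positivity)]
  refine ENNReal.rpow_le_rpow ?_ (by positivity)
  refine le_trans (lintegral_mono fun t => ?_)
    (lintegral_liminf_le fun j => (hem j).pow_const (q / ρ))
  refine (ENNReal.rpow_le_rpow (ht t) hq.le).trans (le_of_eq ?_)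
  rw [hlift hq]
  congr 1
  ext j
  rw [← ENNReal.rpow_mul]
  congr 1; ring

end Sums

/-! ### Moments and tails of the space-time norm -/

section Tail

variable {d : ℕ} {Ω : Type*} [MeasurableSpace Ω] {P : Measure Ω} [IsProbabilityMeasure P]

/-- Moments of the space-time norm of a randomised sum are controlled by the square sum of the
space-time norms of the terms: Minkowski's inequality moves the expectation inside the mixed norm, the
moment bound is applied pointwise, and Minkowski's inequality moves the square sum outside. -/
theorem IsRandomizer.lintegral_mixedNorm_sum_rpow_le {g : (Fin d → ℤ) → Ω → ℂ} {c : NNReal}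
    (hg : IsRandomizer P g c) {v : (Fin d → ℤ) → ℝ → Space d → ℂ}
    (hv : ∀ n, Measurable (Function.uncurry (v n))) {q ρ k : ℝ} (hq : 2 ≤ q) (hρ : 2 ≤ ρ)
    (hqk : q ≤ k) (hρk : ρ ≤ k) (F : Finset (Fin d → ℤ)) :
    ∫⁻ ω, (mixedNorm volume volume q ρ fun t x => ‖∑ n ∈ F, g n ω * v n t x‖ₑ) ^ k ∂P
      ≤ 4 * (ENNReal.ofReal (4 * Real.exp 1 * c * k)
        * ∑' n, (mixedNorm volume volume q ρ fun t x => ‖v n t x‖ₑ) ^ 2) ^ (k / 2) := by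
  have hk : 0 < k := by linarith
  set B := ENNReal.ofReal (4 * Real.exp 1 * c * k) with hB
  set m : ℝ≥0∞ := 4 ^ (1 / k) * B ^ (1 / 2 : ℝ) with hm
  have hmtop : m ≠ ⊤ := ENNReal.mul_ne_top
    (ENNReal.rpow_ne_top_of_nonneg (by positivity) (by norm_num))
    (ENNReal.rpow_ne_top_of_nonneg (by norm_num) ENNReal.ofReal_ne_top)
  have hZ : Measurable fun z : Ω × ℝ × Space d => ‖∑ n ∈ F, g n z.1 * v n z.2.1 z.2.2‖ₑ :=
    (Finset.measurable_sum F fun n _ => ((hg.measurable n).comp measurable_fst).mul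
      ((hv n).comp measurable_snd)).enorm
  have hV : Measurable fun z : (Fin d → ℤ) × ℝ × Space d => ‖v z.1 z.2.1 z.2.2‖ₑ :=
    (measurable_from_prod_countable_right fun n => hv n).enorm
  have h1 := lintegral_mixedNorm_rpow_le (μ := P) (σ := volume) (ν := volume)
    (Z := fun ω t x => ‖∑ n ∈ F, g n ω * v n t x‖ₑ) (by linarith : 0 < q) (by linarith : 0 < ρ)
    hqk hρk hZ
  have h2 : ∀ t x, (∫⁻ ω, ‖∑ n ∈ F, g n ω * v n t x‖ₑ ^ k ∂P) ^ (1 / k)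
      ≤ m * (∫⁻ n, ‖v n t x‖ₑ ^ (2 : ℝ) ∂Measure.count) ^ (1 / 2 : ℝ) := by
    intro t x
    refine (ENNReal.rpow_le_rpow (hg.lintegral_enorm_sum_rpow_le F (fun n => v n t x) hk)
      (by positivity)).trans ?_
    rw [ENNReal.mul_rpow_of_nonneg _ _ (by positivity), ← ENNReal.rpow_mul,
      show k / 2 * (1 / k) = 1 / 2 by field_simp, ENNReal.mul_rpow_of_nonneg _ _ (by norm_num),
      ← mul_assoc, lintegral_count]
    refine mul_le_mul_right (ENNReal.rpow_le_rpow ?_ (by norm_num)) _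
    simp_rw [ENNReal.rpow_two]
    exact ENNReal.sum_le_tsum F
  have h3 := mixedNorm_lintegral_rpow_le (μ := Measure.count) (σ := volume) (ν := volume)
    (Z := fun n t x => ‖v n t x‖ₑ) two_pos hq hρ hV
  have h4 := h1.trans ((mixedNorm_mono (by linarith) (by linarith) h2).trans
    ((mixedNorm_const_mul (by linarith) (by linarith) hmtop).le.trans (mul_le_mul_right h3 m)))
  have h5 := ENNReal.rpow_le_rpow h4 hk.le
  rw [← ENNReal.rpow_mul, one_div_mul_cancel hk.ne', ENNReal.rpow_one] at h5
  refine h5.trans (le_of_eq ?_)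
  rw [lintegral_count, hm]
  simp_rw [ENNReal.rpow_two]
  rw [mul_assoc, ← ENNReal.mul_rpow_of_nonneg _ _ (by norm_num),
    ENNReal.mul_rpow_of_nonneg _ _ hk.le, ← ENNReal.rpow_mul, ← ENNReal.rpow_mul,
    one_div_mul_cancel hk.ne', ENNReal.rpow_one, one_div_mul_eq_div]

/-- The space-time norm of the randomised wave has a measurable majorant with gaussian moment growth:
the lower limit of the norms of finite partial sums. -/
theorem exists_measurable_majorant {ψ : 𝓢(Space d, ℂ)} (hψ : IsWienerWindow ψ) {q ρ : ℝ}
    (hq : 2 ≤ q) (hρ : 2 ≤ ρ) {g : (Fin d → ℤ) → Ω → ℂ} {c : NNReal} (hg : IsRandomizer P g c)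
    (φ : L2 d) :
    ∃ L : Ω → ℝ≥0∞, Measurable L ∧ (∀ᵐ ω ∂P, strichartzNorm (ENNReal.ofReal q) (ENNReal.ofReal ρ)
        (randomization ψ g φ ω) ≤ L ω) ∧
      ∀ k, q ≤ k → ρ ≤ k → ∫⁻ ω, L ω ^ k ∂P ≤ 4 * (ENNReal.ofReal (4 * Real.exp 1 * c * k)
        * ∑' n, (mixedNorm volume volume q ρ
          fun t x => ‖evolution (windowedFourier ψ φ n) t x‖ₑ) ^ 2) ^ (k / 2) := by
  obtain ⟨F, hF⟩ := Filter.exists_seq_tendsto (Filter.atTop : Filter (Finset (Fin d → ℤ)))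
  set v : (Fin d → ℤ) → ℝ → Space d → ℂ := fun n => evolution (windowedFourier ψ φ n) with hvdef
  have hv : ∀ n, Measurable (Function.uncurry (v n)) := fun n =>
    (continuous_evolution (integrable_windowedFourier hψ φ n)).measurable
  set N : ℕ → Ω → ℝ≥0∞ := fun j ω =>
    mixedNorm volume volume q ρ fun t x => ‖∑ n ∈ F j, g n ω * v n t x‖ₑ with hN
  have hNm : ∀ j, Measurable (N j) := by
    intro j
    have hZ : Measurable fun z : (Ω × ℝ) × Space d =>
        ‖∑ n ∈ F j, g n z.1.1 * v n z.1.2 z.2‖ₑ ^ ρ :=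
      ((Finset.measurable_sum (F j) fun n _ => ((hg.measurable n).comp measurable_fst.fst).mul
        ((hv n).comp (measurable_fst.snd.prodMk measurable_snd))).enorm).pow_const ρ
    have h2 : Measurable fun z : Ω × ℝ =>
        (∫⁻ x, ‖∑ n ∈ F j, g n z.1 * v n z.2 x‖ₑ ^ ρ) ^ (q / ρ) :=
      hZ.lintegral_prod_right'.pow_const _
    exact h2.lintegral_prod_right'.pow_const _
  refine ⟨fun ω => Filter.liminf (fun j => N j ω) Filter.atTop, Measurable.liminf hNm, ?_, ?_⟩
  · filter_upwards [ae_summable_randomTerm hψ hg φ] with ω hω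
    refine strichartzNorm_le_liminf (by linarith) (by linarith) (hω.hasSum.comp hF)
      (u := fun j t x => ∑ n ∈ F j, g n ω * v n t x) (fun j => ?_) (fun j t => ?_)
    · exact Finset.measurable_sum (F j) fun n _ => (hv n).const_mul (g n ω)
    · exact coeFn_schrodinger_sum hψ φ (F j) (fun n => g n ω) t
  · intro k hqk hρk
    have hk : 0 < k := by linarith
    calc ∫⁻ ω, Filter.liminf (fun j => N j ω) Filter.atTop ^ k ∂P
        = ∫⁻ ω, Filter.liminf (fun j => N j ω ^ k) Filter.atTop ∂P :=
          lintegral_congr fun ω => (ENNReal.orderIsoRpow k hk).liminf_apply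
      _ ≤ Filter.liminf (fun j => ∫⁻ ω, N j ω ^ k ∂P) Filter.atTop :=
          lintegral_liminf_le fun j => (hNm j).pow_const k
      _ ≤ _ := by
          refine (Filter.liminf_le_liminf (Filter.Eventually.of_forall fun j =>
            hg.lintegral_mixedNorm_sum_rpow_le hv hq hρ hqk hρk (F j))).trans ?_
          rw [Filter.liminf_const]

/-- Gaussian moment growth implies a gaussian tail: Markov's inequality at the exponent
`k = λ² / (e B A)`, if this is admissible; otherwise the asserted bound exceeds `1`. -/
theorem measure_lt_le_of_lintegral_rpow_le {L : Ω → ℝ≥0∞} (hL : Measurable L) {B A k₀ : ℝ}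
    (hB : 0 < B) (hA : 0 ≤ A) (hk₀ : 0 < k₀)
    (h : ∀ k, k₀ ≤ k → ∫⁻ ω, L ω ^ k ∂P ≤ 4 * ENNReal.ofReal (B * k * A) ^ (k / 2))
    {lam : ℝ} (hlam : 0 < lam) :
    P {ω | ENNReal.ofReal lam < L ω}
      ≤ ENNReal.ofReal (4 * Real.exp (k₀ / 2)
        * Real.exp (-(1 / (2 * Real.exp 1 * B)) * lam ^ 2 * A⁻¹)) := by
  have he := Real.exp_pos 1
  set k := lam ^ 2 / (Real.exp 1 * B * A) with hk
  have hexp : -(1 / (2 * Real.exp 1 * B)) * lam ^ 2 * A⁻¹ = -(k / 2) := by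
    rw [hk]
    rcases hA.eq_or_lt with h0 | h0
    · simp [← h0]
    · field_simp
  rw [hexp]
  rcases lt_or_ge k k₀ with hlt | hge
  · refine prob_le_one.trans ?_
    rw [ENNReal.one_le_ofReal, mul_assoc, ← Real.exp_add]
    have : 1 ≤ Real.exp (k₀ / 2 + -(k / 2)) := Real.one_le_exp (by linarith)
    linarith
  · have hk0 : 0 < k := hk₀.trans_le hge
    have hA0 : 0 < A := by
      rcases hA.eq_or_lt with h0 | h0
      · rw [hk, ← h0] at hk0
        simp at hk0
      · exact h0
    have hBkA : B * k * A = lam ^ 2 * Real.exp (-1) := by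
      rw [hk, Real.exp_neg]
      field_simp
    have hpow : ENNReal.ofReal (B * k * A) ^ (k / 2)
        = ENNReal.ofReal lam ^ k * ENNReal.ofReal (Real.exp (-(k / 2))) := by
      rw [hBkA, ENNReal.ofReal_mul (sq_nonneg _), ENNReal.mul_rpow_of_nonneg _ _ (by positivity),
        ENNReal.ofReal_pow hlam.le, ← ENNReal.rpow_two, ← ENNReal.rpow_mul,
        ENNReal.ofReal_rpow_of_pos (Real.exp_pos _), ← Real.exp_mul]
      congr 2
      · ring
      · congr 1; ring
    have hl0 : ENNReal.ofReal lam ^ k ≠ 0 := by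
      simp [ENNReal.rpow_eq_zero_iff, hlam]
    have hlt : ENNReal.ofReal lam ^ k ≠ ⊤ :=
      ENNReal.rpow_ne_top_of_nonneg hk0.le ENNReal.ofReal_ne_top
    have h1 := mul_meas_ge_le_lintegral (μ := P) (hL.pow_const k) (ENNReal.ofReal lam ^ k)
    have h2 : P {ω | ENNReal.ofReal lam < L ω} ≤ P {ω | ENNReal.ofReal lam ^ k ≤ L ω ^ k} :=
      measure_mono fun ω hω => ENNReal.rpow_le_rpow (le_of_lt hω) hk0.le
    have h3 : ENNReal.ofReal lam ^ k * P {ω | ENNReal.ofReal lam < L ω}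
        ≤ ENNReal.ofReal lam ^ k * (4 * ENNReal.ofReal (Real.exp (-(k / 2)))) := by
      refine (mul_le_mul_right h2 _).trans (h1.trans ((h k hge).trans (le_of_eq ?_)))
      rw [hpow]
      ring
    refine ((ENNReal.mul_le_mul_iff_right hl0 hlt).1 h3).trans ?_
    rw [show (4 : ℝ≥0∞) = ENNReal.ofReal 4 by simp, ← ENNReal.ofReal_mul (by norm_num)]
    refine ENNReal.ofReal_le_ofReal (mul_le_mul_of_nonneg_right ?_ (Real.exp_pos _).le)
    have : 1 ≤ Real.exp (k₀ / 2) := Real.one_le_exp (by linarith)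
    linarith

/-- The level at which a gaussian tail has probability at most `ε`. -/
theorem mul_exp_neg_le {C ε : ℝ} (hC : 1 ≤ C) (hε : 0 < ε) (hε2 : ε ≤ 1 / 2) :
    C * Real.exp (-(1 + Real.log C / Real.log 2) * Real.log (1 / ε)) ≤ ε := by
  have hl2 : 0 < Real.log 2 := Real.log_pos (by norm_num)
  have hle : Real.log 2 ≤ Real.log (1 / ε) :=
    Real.log_le_log (by norm_num) (by rw [le_div_iff₀ hε]; linarith)
  have hlC : 0 ≤ Real.log C := Real.log_nonneg hC
  have h1 : Real.log C ≤ Real.log C / Real.log 2 * Real.log (1 / ε) := by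
    rw [div_mul_eq_mul_div, le_div_iff₀ hl2]
    exact mul_le_mul_of_nonneg_left hle hlC
  calc C * Real.exp (-(1 + Real.log C / Real.log 2) * Real.log (1 / ε))
      = Real.exp (Real.log C + -(1 + Real.log C / Real.log 2) * Real.log (1 / ε)) := by
        rw [Real.exp_add, Real.exp_log (by linarith)]
    _ ≤ Real.exp (-Real.log (1 / ε)) := Real.exp_le_exp.2 (by linarith)
    _ = ε := by rw [one_div, Real.log_inv, neg_neg, Real.exp_log hε]

end Tail

/-! ### Exponents -/

theorem SchrodingerAdmissible.strichartzExponents {d : ℕ} {q r : ℝ≥0∞}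
    (h : SchrodingerAdmissible d q r) (hq : q < ∞) (hr : r < ∞) :
    StrichartzExponents ((d : ℝ) / 2) (1 / 2 - 1 / r.toReal) (1 / r.toReal)
      (q.toReal / (q.toReal - 1)) q.toReal := by
  obtain ⟨hq2, hr2, heq, -⟩ := h
  have hq2' : 2 ≤ q.toReal := by
    simpa using (ENNReal.toReal_le_toReal (by norm_num) hq.ne).2 hq2
  have hr2' : 2 ≤ r.toReal := by
    simpa using (ENNReal.toReal_le_toReal (by norm_num) hr.ne).2 hr2
  have hqne : q ≠ 0 := fun h0 => by simp [h0] at hq2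
  have hrne : r ≠ 0 := fun h0 => by simp [h0] at hr2
  have heq' : 2 / q.toReal + d / r.toReal = d / 2 := by
    have := congrArg ENNReal.toReal heq
    rw [ENNReal.toReal_add (ENNReal.div_ne_top (by norm_num) hqne)
      (ENNReal.div_ne_top (by simp) hrne)] at this
    simpa using this
  have hq0 : 0 < 2 / q.toReal := by positivity
  have hscal : 1 / q.toReal = (d : ℝ) / 2 * (1 / 2 - 1 / r.toReal) := by
    have h1 : 2 / q.toReal = 2 * (1 / q.toReal) := by ring
    have h2 : (d : ℝ) / r.toReal = d * (1 / r.toReal) := by ring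
    rw [h1, h2] at heq'
    linarith
  have hd : (0 : ℝ) < d := by
    rcases (Nat.cast_nonneg (α := ℝ) d).eq_or_lt with h0 | h0
    · rw [← h0] at heq'
      simp at heq'
      linarith [hq2', heq', hq0]
    · exact h0
  exact
    { σ_pos := by positivity
      a_pos := by
        by_contra! hle
        have : 1 / q.toReal ≤ 0 := hscal ▸ mul_nonpos_of_nonneg_of_nonpos (by positivity) hle
        have : 0 < 1 / q.toReal := by positivity
        linarith
      b_pos := by positivity
      add_eq := by ring
      two_le := hq2'
      conj := (Real.HolderConjugate.conjExponent (by linarith)).symm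
      scaling := hscal }

end WienerRandomization

/-! ### The randomised Strichartz estimate -/

open WienerRandomization in
theorem mainTheorem3 {d : ℕ} (ψ : 𝓢(Space d, ℂ)) (hψ : IsWienerWindow ψ)
    {q r r' : ℝ≥0∞} (hadm : SchrodingerAdmissible d q r) (hq : q < ∞) (hr : r < ∞)
    (hrr' : r ≤ r') (hr' : r' < ∞) {c₀ : ℝ} (hc₀ : 0 < c₀) :
    ∃ C c K : ℝ, 0 < C ∧ 0 < c ∧ 0 < K ∧
      ∀ (Ω : Type*) [MeasurableSpace Ω] (P : Measure Ω) [IsProbabilityMeasure P]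
        (g : (Fin d → ℤ) → Ω → ℂ), IsRandomizer P g c₀ → ∀ φ : L2 d,
        (∀ᵐ ω ∂P, Summable (randomTerm ψ g φ ω)) ∧
        (∀ lam : ℝ, 0 < lam →
          P {ω | ENNReal.ofReal lam < strichartzNorm q r' (randomization ψ g φ ω)}
            ≤ ENNReal.ofReal (C * Real.exp (-c * lam ^ 2 * (‖φ‖ ^ 2)⁻¹))) ∧
        (∀ ε : ℝ, 0 < ε → ε ≤ 1 / 2 →
          ∃ A : Set Ω, MeasurableSet A ∧ P A ≤ ENNReal.ofReal ε ∧
            ∀ ω ∉ A, strichartzNorm q r' (randomization ψ g φ ω)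
              ≤ ENNReal.ofReal (K * Real.sqrt (Real.log (1 / ε)) * ‖φ‖)) := by
  lift c₀ to NNReal using hc₀.le
  have hX := hadm.strichartzExponents hq hr
  obtain ⟨S, hS, hsq⟩ := exists_tsum_evolution_window_le hψ hX rfl
    ((ENNReal.toReal_le_toReal hr.ne hr'.ne).2 hrr')
  have hq2 : 2 ≤ q.toReal := hX.two_le
  have hr2 : 2 ≤ r'.toReal := by
    simpa using (ENNReal.toReal_le_toReal (by norm_num) hr'.ne).2 (hadm.2.1.trans hrr')
  set k₀ := max q.toReal r'.toReal with hk₀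
  have hk₀pos : 0 < k₀ := lt_max_of_lt_left (by linarith)
  -- One is added to the square-function constant only to make it positive.
  set B : ℝ := 4 * Real.exp 1 * c₀ * (S.toReal + 1) with hB
  have hBpos : 0 < B := by positivity
  set C : ℝ := 4 * Real.exp (k₀ / 2) with hC
  have hC1 : 1 ≤ C := by
    have : 1 ≤ Real.exp (k₀ / 2) := Real.one_le_exp (by linarith)
    linarith
  set c : ℝ := 1 / (2 * Real.exp 1 * B) with hc
  have hcpos : 0 < c := by positivity
  -- With this `K` the tail at the level `K √(log (1/ε)) ‖φ‖` is at most `ε`.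
  set K : ℝ := Real.sqrt ((1 + Real.log C / Real.log 2) / c) with hK
  have hKarg : 0 < (1 + Real.log C / Real.log 2) / c := by
    have : 0 ≤ Real.log C / Real.log 2 :=
      div_nonneg (Real.log_nonneg hC1) (Real.log_nonneg (by norm_num))
    positivity
  have hcK : c * K ^ 2 = 1 + Real.log C / Real.log 2 := by
    rw [hK, Real.sq_sqrt hKarg.le]
    field_simp
  refine ⟨C, c, K, by positivity, hcpos, Real.sqrt_pos.2 hKarg, ?_⟩
  intro Ω _ P _ g hg φ
  obtain ⟨L, hL, hLae, hLk⟩ := exists_measurable_majorant hψ hq2 hr2 hg φ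
  rw [ENNReal.ofReal_toReal hq.ne, ENNReal.ofReal_toReal hr'.ne] at hLae
  have hsum : ∑' n, (mixedNorm volume volume q.toReal r'.toReal
      fun t x => ‖evolution (windowedFourier ψ φ n) t x‖ₑ) ^ 2
      ≤ ENNReal.ofReal ((S.toReal + 1) * ‖φ‖ ^ 2) := by
    have h := hsq _ (measurable_coeFn_fourier φ) (Lp.memLp (𝓕 φ : L2 d))
    rw [← Lp.enorm_def, enorm_fourier_eq] at h
    refine le_trans (le_of_eq (tsum_congr fun n => ?_)) (h.trans ?_)
    · rw [mixedNorm, ← ENNReal.rpow_two, ← ENNReal.rpow_mul, one_div_mul_eq_div]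
      rfl
    · rw [ENNReal.ofReal_mul (by positivity), ENNReal.ofReal_pow (norm_nonneg _), ofReal_norm]
      refine mul_le_mul_left ?_ _
      rw [← ENNReal.ofReal_toReal hS]
      exact ENNReal.ofReal_le_ofReal (by simp)
  have hmom : ∀ k, k₀ ≤ k →
      ∫⁻ ω, L ω ^ k ∂P ≤ 4 * ENNReal.ofReal (B * k * ‖φ‖ ^ 2) ^ (k / 2) := by
    intro k hk
    have hk0 : 0 < k := hk₀pos.trans_le hk
    refine (hLk k ((le_max_left _ _).trans hk) ((le_max_right _ _).trans hk)).trans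
      (mul_le_mul_right (ENNReal.rpow_le_rpow ((mul_le_mul_right hsum _).trans (le_of_eq ?_))
        (by positivity)) _)
    rw [← ENNReal.ofReal_mul (by positivity), hB]
    congr 1
    ring
  have htail : ∀ lam : ℝ, 0 < lam → P {ω | ENNReal.ofReal lam < L ω}
      ≤ ENNReal.ofReal (C * Real.exp (-c * lam ^ 2 * (‖φ‖ ^ 2)⁻¹)) := fun lam hlam =>
    measure_lt_le_of_lintegral_rpow_le hL hBpos (by positivity) hk₀pos hmom hlam
  refine ⟨ae_summable_randomTerm hψ hg φ, fun lam hlam => ?_, fun ε hε hε2 => ?_⟩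
  · refine (measure_mono_ae ?_).trans (htail lam hlam)
    filter_upwards [hLae] with ω hω hlt
    exact lt_of_lt_of_le hlt hω
  · set lev : ℝ := K * Real.sqrt (Real.log (1 / ε)) * ‖φ‖ with hlev
    have hlog : 0 < Real.log (1 / ε) :=
      Real.log_pos (by rw [lt_div_iff₀ hε]; linarith)
    have hPlev : P {ω | ENNReal.ofReal lev < L ω} ≤ ENNReal.ofReal ε := by
      rcases (norm_nonneg φ).eq_or_lt with h0 | h0
      · have hint := hmom k₀ le_rfl
        rw [← h0] at hint
        have hz : ∫⁻ ω, L ω ^ k₀ ∂P = 0 := by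
          simpa [ENNReal.zero_rpow_of_pos (half_pos hk₀pos)] using hint
        rw [lintegral_eq_zero_iff (hL.pow_const k₀)] at hz
        have : P {ω | ENNReal.ofReal lev < L ω} = 0 := by
          refine measure_mono_null_ae ?_ (measure_empty (μ := P))
          filter_upwards [hz] with ω hω hlt
          have : L ω = 0 := by
            simpa [ENNReal.rpow_eq_zero_iff, hk₀pos, hk₀pos.not_gt] using hω
          have hlt' : ENNReal.ofReal lev < L ω := hlt
          simp [this] at hlt'
        rw [this]
        exact zero_le
      · have hKpos : 0 < K := Real.sqrt_pos.2 hKarg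
        refine (htail lev (by positivity)).trans (ENNReal.ofReal_le_ofReal ?_)
        have hexp : -c * lev ^ 2 * (‖φ‖ ^ 2)⁻¹
            = -(1 + Real.log C / Real.log 2) * Real.log (1 / ε) := by
          rw [← hcK, hlev, mul_pow, mul_pow, Real.sq_sqrt hlog.le]
          field_simp
        rw [hexp]
        exact mul_exp_neg_le hC1 hε hε2
    refine ⟨{ω | ENNReal.ofReal lev < L ω} ∪ toMeasurable P
      {ω | ¬ strichartzNorm q r' (randomization ψ g φ ω) ≤ L ω},
      (measurableSet_lt measurable_const hL).union (measurableSet_toMeasurable _ _), ?_, ?_⟩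
    · refine (measure_union_le _ _).trans ?_
      rw [measure_toMeasurable, ae_iff.1 hLae, add_zero]
      exact hPlev
    · intro ω hω
      simp only [Set.mem_union, not_or] at hω
      have h1 : strichartzNorm q r' (randomization ψ g φ ω) ≤ L ω := by
        by_contra hcon
        exact hω.2 (subset_toMeasurable _ _ hcon)
      exact h1.trans (not_lt.1 hω.1)
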